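/- Let $N\ge 1$, let $\Omega\subset\mathbb{R}^N$ be a bounded domain (nonempty, open, connected) with smooth boundary, let $1<p,q<\infty$, $\alpha>0$ and $\beta>1$ with $\frac{\alpha}{p}+\frac{\beta}{q}=1$, and assume that $p\ge N$ or $q>N$. Call $(u,v)\in W^{1,p}_0(\Omega)\times W^{1,q}(\Omega)\setminus\{(0,0)\}$ an eigenfunction corresponding to $\lambda\in\mathbb{R}$ if it is a weak solution of $$-\Delta_p u=\lambda\alpha|u|^{\alpha-2}u|v|^{\beta},\qquad -\Delta_q v=\lambda\beta|u|^{\alpha}|v|^{\beta-2}v\quad\text{in }\Omega,\qquad u=0,\quad |\nabla v|^{q-2}\frac{\partial v}{\partial\nu}=0\quad\text{on }\partial\Omega,$$ that is, for all $(w,z)\in W^{1,p}_0(\Omega)\times W^{1,q}(\Omega)$ the integrands on the right-hand sides below are integrable and $$\int_\Omega|\nabla u|^{p-2}\nabla u\cdot\nabla w\,dx=\lambda\alpha\int_\Omega|u|^{\alpha-2}u|v|^{\beta}w\,dx,\qquad \int_\Omega|\nabla v|^{q-2}\nabla v\cdot\nabla z\,dx=\lambda\beta\int_\Omega|u|^{\alpha}|v|^{\beta-2}vz\,dx$$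 (with $|t|^{s-2}t:=0$ at $t=0$). Call $\lambda$ a nontrivial eigenvalue if it has an eigenfunction $(u,v)$ with $uv\not\equiv0$ in $\Omega$. Let $$\mathcal{A}_{p,q}^{\alpha,\beta}=\Big\{(u,v)\in W^{1,p}_0(\Omega)\times W^{1,q}(\Omega)\colon uv\not\equiv0,\ \int_\Omega|u|^{\alpha}|v|^{\beta-2}v\,dx=0\Big\},$$ $$\lambda_{p,q}^{\alpha,\beta}=\inf\left\{\frac{\int_\Omega\frac{|\nabla u|^p}{p}\,dx+\int_\Omega\frac{|\nabla v|^q}{q}\,dx}{\int_\Omega|u|^\alpha|v|^\beta\,dx}\colon(u,v)\in\mathcal{A}_{p,q}^{\alpha,\beta}\right\}.$$ Then $\lambda_{p,q}^{\alpha,\beta}$ is the first (that is, the smallest) nontrivial eigenvalue. Moreover, the infimum is attained, and every minimizer $(u,v)\in\mathcal{A}_{p,q}^{\alpha,\beta}$ is an eigenfunction corresponding to $\lambda_{p,q}^{\alpha,\beta}$. -/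

import Mathlib

open MeasureTheory Filter Topology
open scoped ContDiff ENNReal

noncomputable section

namespace DirichletNeumann

/-- Euclidean space `ℝ^N`. -/
abbrev E (N : ℕ) : Type := EuclideanSpace ℝ (Fin N)

variable {N : ℕ}

/-- A bounded domain (nonempty, open, connected, bounded set) with smooth boundary: near each
boundary point, `Ω` is the set where a smooth function with nonvanishing differential at that point
is negative. -/
structure IsSmoothBoundedDomain (Ω : Set (E N)) : Prop where
  isOpen : IsOpen Ω
  isConnected : IsConnected Ω
  isBounded : Bornology.IsBounded Ω
  smooth_boundary : ∀ x₀ ∈ frontier Ω, ∃ U : Set (E N), IsOpen U ∧ x₀ ∈ U ∧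
    ∃ ρ : E N → ℝ, ContDiff ℝ ∞ ρ ∧ fderiv ℝ ρ x₀ ≠ 0 ∧ Ω ∩ U = {x ∈ U | ρ x < 0}

/-- Test functions: `φ ∈ C_c^∞(Ω)`. -/
def IsTestFunction (Ω : Set (E N)) (φ : E N → ℝ) : Prop :=
  ContDiff ℝ ∞ φ ∧ HasCompactSupport φ ∧ tsupport φ ⊆ Ω

/-- `G` is a weak (distributional) gradient of `u` in `Ω`. -/
def IsWeakGradient (Ω : Set (E N)) (u : E N → ℝ) (G : E N → E N) : Prop :=
  LocallyIntegrableOn u Ω ∧ LocallyIntegrableOn G Ω ∧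
    ∀ φ : E N → ℝ, IsTestFunction Ω φ →
      ∫ x in Ω, u x • gradient φ x = - ∫ x in Ω, φ x • G x

open Classical in
/-- The weak gradient `∇u` of `u` in `Ω` (unique up to null subsets of `Ω`); the value is `0` if
there is none. -/
def weakGradient (Ω : Set (E N)) (u : E N → ℝ) : E N → E N :=
  if h : ∃ G, IsWeakGradient Ω u G then h.choose else 0

/-- `u ∈ W^{1,p}(Ω)`. -/
def MemW1 (Ω : Set (E N)) (p : ℝ) (u : E N → ℝ) : Prop :=
  MemLp u (ENNReal.ofReal p) (volume.restrict Ω) ∧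
    ∃ G, IsWeakGradient Ω u G ∧ MemLp G (ENNReal.ofReal p) (volume.restrict Ω)

/-- `u ∈ W_0^{1,p}(Ω)`, the closure of `C_c^∞(Ω)` in `W^{1,p}(Ω)`. -/
def MemW1Zero (Ω : Set (E N)) (p : ℝ) (u : E N → ℝ) : Prop :=
  MemW1 Ω p u ∧ ∃ φ : ℕ → E N → ℝ, (∀ n, IsTestFunction Ω (φ n)) ∧
    Tendsto (fun n => eLpNorm (fun x => u x - φ n x) (ENNReal.ofReal p) (volume.restrict Ω))
      atTop (𝓝 0) ∧
    Tendsto (fun n => eLpNorm (fun x => weakGradient Ω u x - gradient (φ n) x)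
      (ENNReal.ofReal p) (volume.restrict Ω)) atTop (𝓝 0)

/-- `uv ≢ 0` in `Ω` (as classes of functions modulo null sets). -/
def ProdNontrivial (Ω : Set (E N)) (u v : E N → ℝ) : Prop :=
  ¬ ∀ᵐ x ∂(volume.restrict Ω), u x * v x = 0

/-- `(u,v) ∈ W_0^{1,p}(Ω) × W^{1,q}(Ω) ∖ {(0,0)}` is an eigenfunction for `lam`: a weak solution of
`-Δ_p u = lam α |u|^{α-2} u |v|^β`, `-Δ_q v = lam β |u|^α |v|^{β-2} v` in `Ω` with Dirichlet
condition for `u` and Neumann condition for `v`. The products on the right-hand side are required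
to be integrable against all admissible `w` and `z`. -/
def IsEigenfunction (Ω : Set (E N)) (p q α β lam : ℝ) (u v : E N → ℝ) : Prop :=
  MemW1Zero Ω p u ∧ MemW1 Ω q v ∧
  ¬ (∀ᵐ x ∂(volume.restrict Ω), u x = 0 ∧ v x = 0) ∧
  (∀ w : E N → ℝ, MemW1Zero Ω p w →
    IntegrableOn (fun x => |u x| ^ (α - 2) * u x * |v x| ^ β * w x) Ω ∧
    ∫ x in Ω, ‖weakGradient Ω u x‖ ^ (p - 2) *
        inner ℝ (weakGradient Ω u x) (weakGradient Ω w x)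
      = lam * α * ∫ x in Ω, |u x| ^ (α - 2) * u x * |v x| ^ β * w x) ∧
  (∀ z : E N → ℝ, MemW1 Ω q z →
    IntegrableOn (fun x => |u x| ^ α * (|v x| ^ (β - 2) * v x) * z x) Ω ∧
    ∫ x in Ω, ‖weakGradient Ω v x‖ ^ (q - 2) *
        inner ℝ (weakGradient Ω v x) (weakGradient Ω z x)
      = lam * β * ∫ x in Ω, |u x| ^ α * (|v x| ^ (β - 2) * v x) * z x)

/-- `lam` is a nontrivial eigenvalue: it has an eigenfunction `(u,v)` with `uv ≢ 0`. -/
def IsNontrivialEigenvalue (Ω : Set (E N)) (p q α β lam : ℝ) : Prop :=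
  ∃ u v : E N → ℝ, ProdNontrivial Ω u v ∧ IsEigenfunction Ω p q α β lam u v

/-- The admissible class `𝒜_{p,q}^{α,β}`. -/
def Admissible (Ω : Set (E N)) (p q α β : ℝ) (u v : E N → ℝ) : Prop :=
  MemW1Zero Ω p u ∧ MemW1 Ω q v ∧ ProdNontrivial Ω u v ∧
    ∫ x in Ω, |u x| ^ α * (|v x| ^ (β - 2) * v x) = 0

/-- The Rayleigh quotient. -/
def rayleigh (Ω : Set (E N)) (p q α β : ℝ) (u v : E N → ℝ) : ℝ :=
  ((∫ x in Ω, ‖weakGradient Ω u x‖ ^ p / p) + ∫ x in Ω, ‖weakGradient Ω v x‖ ^ q / q) /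
    ∫ x in Ω, |u x| ^ α * |v x| ^ β

/-- The set of values of the Rayleigh quotient on the admissible class. -/
def rayleighValues (Ω : Set (E N)) (p q α β : ℝ) : Set ℝ :=
  {r | ∃ u v : E N → ℝ, Admissible Ω p q α β u v ∧ rayleigh Ω p q α β u v = r}

/-- `λ_{p,q}^{α,β}`, the infimum of the Rayleigh quotient over the admissible class. -/
def lambdaInf (Ω : Set (E N)) (p q α β : ℝ) : ℝ :=
  sInf (rayleighValues Ω p q α β)

end DirichletNeumann

end

open MeasureTheory Filter Topology
open scoped ContDiff ENNReal

noncomputable section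

namespace DirichletNeumann

variable {N : ℕ}

/-! ### Convergence in `L^p` -/

section LpTools

variable {X F : Type*} [MeasurableSpace X] [NormedAddCommGroup F] {μ : Measure X} {p : ℝ}

/-! For `u` not a.e. zero, the function c ↦ ∫ |u|^α |v + c|^β is strictly convex and coercive, and
its derivative is β times the constraint integral. Hence every `v` has a constant shift that
satisfies the constraint, and this shift minimizes the coupling ∫ |u|^α |v|^β among all shifts.
Shifts do not change ∇v, so the constrained problem is equivalent to the unconstrained inequality λ
· min_c ∫ |u|^α |v + c|^β ≤ energy (`lambdaInf_mul_le`), and no Lagrange multiplier appears. The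
relation α/p + β/q = 1 makes the quotient invariant under (u, v) ↦ (t^{1/p} u, t^{1/q} v) and, by
weighted AM-GM, makes the coupling continuous on L^p × L^q.

Existence. In a minimizing sequence normalized to coupling 1, the constraint forces every shift of
v_n to have coupling at least 1. Poincaré bounds u_n, Poincaré–Wirtinger bounds suitable shifts of
v_n, and Rellich gives strong limits in L^p × L^q. A midpoint argument takes the place of weak
compactness: the minimum over shifts is lower semicontinuous (`eventually_le_coupling`), so the
midpoint of two late terms has energy at least λ up to a small error, and uniform convexity of |·|^p
makes the gradients Cauchy (`exists_minimizer_of_tendsto`). The Sobolev tools rest on the formula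
v(x + h) − v(x) = ∫₀¹ h·∇v(x + σh) dσ and on a cone condition for Ω.

Equation for v. The coupling is convex in v, so its tangent inequality bounds it from below along v
+ tz + c for all c at once; comparing with the differentiable energy gives the equation
(`right_equation`).

Equation for u. This is more delicate, since |u|^α is not differentiable at 0 when α ≤ 1. With (u,
v), also (|u|, v) is a minimizer. For u ≥ 0, the perturbations u + tw with w ≥ 0 and Fatou's lemma
give integrability of the source and a supersolution inequality (`supersolution`), while scaling u
gives equality for w = u. Testing with the positive part of u + tw and letting t → 0 extends the
inequality to all w (`left_inequality`), and −w turns it into an equality. To return from |u| to u,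
a logarithmic estimate for supersolutions puts ∇|u| / |u| locally in L^p; hence sign u has zero weak
gradient and is constant on the connected set Ω.

Smallest eigenvalue. For a nontrivial eigenvalue, Poincaré excludes λ = 0, the test function z = 1
yields the constraint, and testing with u and v themselves shows that the quotient equals λ. So
every nontrivial eigenvalue is a value of the quotient. -/

theorem ofReal_ne_zero_of_one_lt (hp : 1 < p) : ENNReal.ofReal p ≠ 0 := by
  simp; linarith

theorem one_le_ofReal_of_one_lt (hp : 1 < p) : 1 ≤ ENNReal.ofReal p :=
  ENNReal.one_le_ofReal.2 hp.le

theorem memLp_ofReal_iff (hp : 1 < p) {f : X → F} :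
    MemLp f (ENNReal.ofReal p) μ ↔
      AEStronglyMeasurable f μ ∧ Integrable (fun x => ‖f x‖ ^ p) μ := by
  have hp0 : (ENNReal.ofReal p).toReal = p := ENNReal.toReal_ofReal (by linarith)
  constructor
  · intro h
    refine ⟨h.1, ?_⟩
    have := (integrable_norm_rpow_iff h.1 (ofReal_ne_zero_of_one_lt hp) ENNReal.ofReal_ne_top).2 h
    rwa [hp0] at this
  · rintro ⟨h, h'⟩
    refine (integrable_norm_rpow_iff h (ofReal_ne_zero_of_one_lt hp) ENNReal.ofReal_ne_top).1 ?_
    rwa [hp0]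

theorem _root_.MeasureTheory.MemLp.integrable_rpow (hp : 1 < p) {f : X → F}
    (h : MemLp f (ENNReal.ofReal p) μ) : Integrable (fun x => ‖f x‖ ^ p) μ :=
  ((memLp_ofReal_iff hp).1 h).2

theorem eLpNorm_ofReal_eq (hp : 1 < p) {f : X → F} (h : MemLp f (ENNReal.ofReal p) μ) :
    eLpNorm f (ENNReal.ofReal p) μ = ENNReal.ofReal ((∫ x, ‖f x‖ ^ p ∂μ) ^ p⁻¹) := by
  have hp0 : (ENNReal.ofReal p).toReal = p := ENNReal.toReal_ofReal (by linarith)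
  have := h.eLpNorm_eq_integral_rpow_norm (ofReal_ne_zero_of_one_lt hp) ENNReal.ofReal_ne_top
  rwa [hp0] at this

theorem integral_rpow_nonneg (f : X → F) : 0 ≤ ∫ x, ‖f x‖ ^ p ∂μ :=
  integral_nonneg fun _ => Real.rpow_nonneg (norm_nonneg _) _

/-- Convergence to zero in `L^p` in terms of the integral of the `p`-th power. -/
theorem tendsto_eLpNorm_zero_iff {ι : Type*} {l : Filter ι} (hp : 1 < p) {f : ι → X → F}
    (h : ∀ i, MemLp (f i) (ENNReal.ofReal p) μ) :
    Tendsto (fun i => eLpNorm (f i) (ENNReal.ofReal p) μ) l (𝓝 0) ↔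
      Tendsto (fun i => ∫ x, ‖f i x‖ ^ p ∂μ) l (𝓝 0) := by
  have hp0 : 0 < p := by linarith
  have e : (fun i => eLpNorm (f i) (ENNReal.ofReal p) μ)
      = fun i => ENNReal.ofReal ((∫ x, ‖f i x‖ ^ p ∂μ) ^ p⁻¹) :=
    funext fun i => eLpNorm_ofReal_eq hp (h i)
  rw [e]
  constructor
  · intro H
    have H1 := (ENNReal.tendsto_toReal ENNReal.zero_ne_top).comp H
    have H2 := H1.rpow_const (p := p) (Or.inr hp0.le)
    simp only [Function.comp_def, ENNReal.toReal_zero, Real.zero_rpow hp0.ne'] at H2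
    refine H2.congr fun i => ?_
    rw [ENNReal.toReal_ofReal (Real.rpow_nonneg (integral_rpow_nonneg _) _),
      ← Real.rpow_mul (integral_rpow_nonneg _), inv_mul_cancel₀ hp0.ne', Real.rpow_one]
  · intro H
    have H1 := H.rpow_const (p := p⁻¹) (Or.inr (by positivity))
    rw [Real.zero_rpow (by positivity)] at H1
    simpa using ENNReal.tendsto_ofReal H1

/-- Dominated convergence in `L^p`. -/
theorem tendsto_eLpNorm_of_dominated (hp : 1 < p) {f : ℕ → X → F} {g : X → ℝ}
    (hf : ∀ n, AEStronglyMeasurable (f n) μ) (hg : MemLp g (ENNReal.ofReal p) μ)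
    (hb : ∀ n, ∀ᵐ x ∂μ, ‖f n x‖ ≤ g x) (hlim : ∀ᵐ x ∂μ, Tendsto (fun n => f n x) atTop (𝓝 0)) :
    Tendsto (fun n => eLpNorm (f n) (ENNReal.ofReal p) μ) atTop (𝓝 0) := by
  have hp0 : 0 < p := by linarith
  have hm : ∀ n, MemLp (f n) (ENNReal.ofReal p) μ := fun n => hg.mono (hf n) <| by
    filter_upwards [hb n] with x hx using hx.trans (Real.le_norm_self _)
  rw [tendsto_eLpNorm_zero_iff hp hm]
  have := tendsto_integral_of_dominated_convergence (F := fun n x => ‖f n x‖ ^ p) (f := fun _ => 0)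
    (μ := μ) (fun x => ‖g x‖ ^ p) (fun n => (hm n).integrable_rpow hp |>.1) (hg.integrable_rpow hp)
    (fun n => by
      filter_upwards [hb n] with x hx
      rw [Real.norm_of_nonneg (Real.rpow_nonneg (norm_nonneg _) _)]
      exact Real.rpow_le_rpow (norm_nonneg _) (hx.trans (Real.le_norm_self _)) hp0.le)
    (by
      filter_upwards [hlim] with x hx
      have := (tendsto_norm.comp hx).rpow_const (p := p) (Or.inr hp0.le)
      simpa [Function.comp_def, Real.zero_rpow hp0.ne'] using this)
  simpa using this

theorem tendsto_eLpNorm_one_of_tendsto [IsFiniteMeasure μ] {ι : Type*} {l : Filter ι} (hp : 1 < p)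
    {f : ι → X → F} (hf : ∀ i, AEStronglyMeasurable (f i) μ)
    (h : Tendsto (fun i => eLpNorm (f i) (ENNReal.ofReal p) μ) l (𝓝 0)) :
    Tendsto (fun i => eLpNorm (f i) 1 μ) l (𝓝 0) := by
  have h2 : Tendsto (fun i => eLpNorm (f i) (ENNReal.ofReal p) μ *
      μ Set.univ ^ (1 / (1 : ℝ≥0∞).toReal - 1 / (ENNReal.ofReal p).toReal)) l (𝓝 0) := by
    have := ENNReal.Tendsto.mul_const (b := μ Set.univ ^ (1 / (1 : ℝ≥0∞).toReal -
      1 / (ENNReal.ofReal p).toReal)) h (Or.inr ?_)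
    · simpa using this
    · refine ENNReal.rpow_ne_top_of_nonneg ?_ (measure_ne_top _ _)
      rw [ENNReal.toReal_ofReal (by linarith), ENNReal.toReal_one, sub_nonneg]
      rw [div_le_div_iff₀ (by linarith) (by norm_num)]; linarith
  exact tendsto_of_tendsto_of_tendsto_of_le_of_le tendsto_const_nhds h2 (fun _ => zero_le)
    fun i => eLpNorm_le_eLpNorm_mul_rpow_measure_univ (one_le_ofReal_of_one_lt hp) (hf i)

/-- Strong `L^p` convergence implies convergence of integrals against bounded functions. -/
theorem tendsto_integral_bilin_of_tendsto [IsFiniteMeasure μ] [NormedSpace ℝ F]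
    {F₂ F₃ : Type*} [NormedAddCommGroup F₂] [NormedSpace ℝ F₂] [NormedAddCommGroup F₃]
    [NormedSpace ℝ F₃] (B : F →L[ℝ] F₂ →L[ℝ] F₃) {ι : Type*}
    {l : Filter ι} (hp : 1 < p) {f : ι → X → F} {f₀ : X → F} {h : X → F₂} {C : ℝ}
    (hf : ∀ i, MemLp (f i) (ENNReal.ofReal p) μ) (hf₀ : MemLp f₀ (ENNReal.ofReal p) μ)
    (hh : AEStronglyMeasurable h μ) (hC : ∀ x, ‖h x‖ ≤ C)
    (hlim : Tendsto (fun i => eLpNorm (fun x => f i x - f₀ x) (ENNReal.ofReal p) μ) l (𝓝 0)) :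
    Tendsto (fun i => ∫ x, B (f i x) (h x) ∂μ) l (𝓝 (∫ x, B (f₀ x) (h x) ∂μ)) := by
  have hm : ∀ i, AEStronglyMeasurable (fun x => f i x - f₀ x) μ := fun i => ((hf i).sub hf₀).1
  have h1 := tendsto_eLpNorm_one_of_tendsto hp hm hlim
  have hi : ∀ i, Integrable (f i) μ := fun i => (hf i).integrable (one_le_ofReal_of_one_lt hp)
  have hi₀ : Integrable f₀ μ := hf₀.integrable (one_le_ofReal_of_one_lt hp)
  have hb : ∀ (a : F) (x : X), ‖B a (h x)‖ ≤ ‖B‖ * C * ‖a‖ := fun a x =>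
    (B.le_opNorm₂ a (h x)).trans (by
      nlinarith [mul_le_mul_of_nonneg_left (hC x) (mul_nonneg (norm_nonneg B) (norm_nonneg a))])
  have key : ∀ {g : X → F}, Integrable g μ → Integrable (fun x => B (g x) (h x)) μ := fun hg =>
    (hg.norm.const_mul (‖B‖ * C)).mono' (B.aestronglyMeasurable_comp₂ hg.1 hh)
      (Eventually.of_forall fun x => hb _ x)
  refine tendsto_integral_of_L1 _ (key hi₀).1 (Eventually.of_forall fun i => key (hi i)) ?_
  have h2 : Tendsto (fun i => ENNReal.ofReal (‖B‖ * C) * eLpNorm (fun x => f i x - f₀ x) 1 μ) l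
      (𝓝 0) := by
    have := ENNReal.Tendsto.const_mul (a := ENNReal.ofReal (‖B‖ * C)) h1
      (Or.inr ENNReal.ofReal_ne_top)
    rwa [mul_zero] at this
  refine tendsto_of_tendsto_of_tendsto_of_le_of_le tendsto_const_nhds h2 (fun _ => zero_le)
    fun i => ?_
  simp only [eLpNorm_one_eq_lintegral_enorm]
  rw [← lintegral_const_mul'' _ (hm i).enorm]
  refine lintegral_mono fun x => ?_
  have hC0 : 0 ≤ C := (norm_nonneg _).trans (hC x)
  have hn : 0 ≤ ‖B‖ * C := by positivity
  simp only [← ofReal_norm]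
  rw [← ENNReal.ofReal_mul hn]
  refine ENNReal.ofReal_le_ofReal ?_
  have : B (f i x) (h x) - B (f₀ x) (h x) = B (f i x - f₀ x) (h x) := by simp
  rw [this]
  exact hb _ x

theorem memLp_of_bounded [IsFiniteMeasure μ] {f : X → F} {C : ℝ} (hf : AEStronglyMeasurable f μ)
    (hC : ∀ x, ‖f x‖ ≤ C) : MemLp f (ENNReal.ofReal p) μ :=
  MemLp.of_bound hf C (Eventually.of_forall hC)

end LpTools

/-! ### Test functions and their gradients -/

section TestFunctions

variable {Ω : Set (E N)} {φ ψ : E N → ℝ}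

theorem IsTestFunction.continuous (h : IsTestFunction Ω φ) : Continuous φ := h.1.continuous

theorem IsTestFunction.differentiable (h : IsTestFunction Ω φ) : Differentiable ℝ φ :=
  h.1.differentiable (by simp)

theorem gradient_eq_toDual (φ : E N → ℝ) :
    gradient φ = fun x => (InnerProductSpace.toDual ℝ (E N)).symm (fderiv ℝ φ x) := rfl

theorem IsTestFunction.continuous_gradient (h : IsTestFunction Ω φ) : Continuous (gradient φ) := by
  rw [gradient_eq_toDual]
  exact (LinearIsometryEquiv.continuous _).comp (h.1.continuous_fderiv (by simp))

theorem IsTestFunction.hasCompactSupport_gradient (h : IsTestFunction Ω φ) :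
    HasCompactSupport (gradient φ) := by
  have := h.2.1.fderiv (𝕜 := ℝ)
  exact this.comp_left (g := (InnerProductSpace.toDual ℝ (E N)).symm) (map_zero _)

theorem IsTestFunction.exists_bound (h : IsTestFunction Ω φ) : ∃ C, ∀ x, ‖φ x‖ ≤ C :=
  h.2.1.exists_bound_of_continuous h.continuous

theorem IsTestFunction.exists_bound_gradient (h : IsTestFunction Ω φ) :
    ∃ C, ∀ x, ‖gradient φ x‖ ≤ C :=
  h.hasCompactSupport_gradient.exists_bound_of_continuous h.continuous_gradient

theorem IsTestFunction.tsupport_gradient_subset (φ : E N → ℝ) :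
    tsupport (gradient φ) ⊆ tsupport φ := by
  refine (closure_mono ?_).trans (tsupport_fderiv_subset ℝ (f := φ))
  intro x hx hx'
  apply hx
  simp [gradient, hx']

theorem IsTestFunction.eq_zero_of_notMem (h : IsTestFunction Ω φ) {x : E N} (hx : x ∉ Ω) :
    φ x = 0 := image_eq_zero_of_notMem_tsupport fun hx' => hx (h.2.2 hx')

theorem IsTestFunction.gradient_eq_zero_of_notMem (h : IsTestFunction Ω φ) {x : E N} (hx : x ∉ Ω) :
    gradient φ x = 0 :=
  image_eq_zero_of_notMem_tsupport fun hx' =>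
    hx (h.2.2 (IsTestFunction.tsupport_gradient_subset φ hx'))

theorem IsTestFunction.add (h : IsTestFunction Ω φ) (h' : IsTestFunction Ω ψ) :
    IsTestFunction Ω (fun x => φ x + ψ x) :=
  ⟨h.1.add h'.1, h.2.1.add h'.2.1, (tsupport_add φ ψ).trans (Set.union_subset h.2.2 h'.2.2)⟩

theorem IsTestFunction.mul_left (h : IsTestFunction Ω φ) (hψ : ContDiff ℝ ∞ ψ) :
    IsTestFunction Ω (fun x => ψ x * φ x) :=
  ⟨hψ.mul h.1, h.2.1.mul_left, (tsupport_mul_subset_right).trans h.2.2⟩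

theorem IsTestFunction.const_mul (h : IsTestFunction Ω φ) (c : ℝ) :
    IsTestFunction Ω (fun x => c * φ x) := h.mul_left contDiff_const

theorem IsTestFunction.comp (h : IsTestFunction Ω φ) {F : ℝ → ℝ} (hF : ContDiff ℝ ∞ F)
    (h0 : F 0 = 0) : IsTestFunction Ω (fun x => F (φ x)) := by
  refine ⟨hF.comp h.1, h.2.1.comp_left h0, ?_⟩
  refine (closure_mono ?_).trans h.2.2
  intro x hx hx'
  exact hx (by simp [hx', h0])

theorem gradient_add_apply (hφ : Differentiable ℝ φ) (hψ : Differentiable ℝ ψ) (x : E N) :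
    gradient (fun x => φ x + ψ x) x = gradient φ x + gradient ψ x := by
  simp only [gradient]
  rw [fderiv_fun_add (hφ x) (hψ x), map_add]

theorem gradient_mul_apply (hφ : Differentiable ℝ φ) (hψ : Differentiable ℝ ψ) (x : E N) :
    gradient (fun x => φ x * ψ x) x = φ x • gradient ψ x + ψ x • gradient φ x := by
  simp only [gradient]
  rw [fderiv_fun_mul (hφ x) (hψ x), map_add]
  simp

theorem gradient_const_mul_apply (hφ : Differentiable ℝ φ) (c : ℝ) (x : E N) :
    gradient (fun x => c * φ x) x = c • gradient φ x := by
  simp only [gradient]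
  rw [fderiv_const_mul (hφ x)]
  simp

theorem gradient_comp_apply (hφ : Differentiable ℝ φ) {F : ℝ → ℝ} (hF : Differentiable ℝ F)
    (x : E N) : gradient (fun x => F (φ x)) x = deriv F (φ x) • gradient φ x := by
  simp only [gradient]
  have : fderiv ℝ (fun x => F (φ x)) x = deriv F (φ x) • fderiv ℝ φ x :=
    ((hF (φ x)).hasDerivAt.comp_hasFDerivAt x (hφ x).hasFDerivAt).fderiv
  rw [this]; simp

end TestFunctions

/-! ### Weak gradients -/

section WeakGradient

variable {Ω : Set (E N)} {u v : E N → ℝ} {G H : E N → E N} {φ : E N → ℝ}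

theorem integrableOn_smul_of_hasCompactSupport {F₁ F₂ F₃ : Type*} [NormedAddCommGroup F₁]
    [NormedSpace ℝ F₁] [NormedAddCommGroup F₂] [NormedSpace ℝ F₂] [NormedAddCommGroup F₃]
    [NormedSpace ℝ F₃] (B : F₁ →L[ℝ] F₂ →L[ℝ] F₃) {f : E N → F₁} {g : E N → F₂}
    (hf : LocallyIntegrableOn f Ω) (hg : Continuous g) (hgc : HasCompactSupport g)
    (hgs : tsupport g ⊆ Ω) : Integrable (fun x => B (f x) (g x)) := by
  have h1 : IntegrableOn f (tsupport g) := hf.integrableOn_compact_subset hgs hgc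
  obtain ⟨C, hC⟩ := hgc.exists_bound_of_continuous hg
  have h2 : IntegrableOn (fun x => B (f x) (g x)) (tsupport g) := by
    refine (h1.norm.const_mul (‖B‖ * C)).mono'
      (B.aestronglyMeasurable_comp₂ h1.1 hg.aestronglyMeasurable) (Eventually.of_forall fun x => ?_)
    refine (B.le_opNorm₂ _ _).trans ?_
    nlinarith [mul_le_mul_of_nonneg_left (hC x) (mul_nonneg (norm_nonneg B) (norm_nonneg (f x)))]
  refine (integrableOn_iff_integrable_of_support_subset ?_).1 h2
  intro x hx
  by_contra hx'
  apply hx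
  simp [image_eq_zero_of_notMem_tsupport hx']

theorem IsTestFunction.integrable_smul (h : IsTestFunction Ω φ) {F : Type*} [NormedAddCommGroup F]
    [NormedSpace ℝ F] {f : E N → F} (hf : LocallyIntegrableOn f Ω) :
    Integrable (fun x => φ x • f x) :=
  integrableOn_smul_of_hasCompactSupport (ContinuousLinearMap.lsmul ℝ ℝ).flip hf h.continuous h.2.1
    h.2.2

theorem IsTestFunction.integrable_smul_gradient (h : IsTestFunction Ω φ)
    (hf : LocallyIntegrableOn u Ω) : Integrable (fun x => u x • gradient φ x) :=
  integrableOn_smul_of_hasCompactSupport (ContinuousLinearMap.lsmul ℝ ℝ) hf h.continuous_gradient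
    h.hasCompactSupport_gradient ((IsTestFunction.tsupport_gradient_subset φ).trans h.2.2)

theorem IsTestFunction.setIntegral_smul (h : IsTestFunction Ω φ) {F : Type*}
    [NormedAddCommGroup F] [NormedSpace ℝ F] (f : E N → F) :
    ∫ x in Ω, φ x • f x = ∫ x, φ x • f x :=
  setIntegral_eq_integral_of_forall_compl_eq_zero fun x hx => by simp [h.eq_zero_of_notMem hx]

theorem IsTestFunction.setIntegral_smul_gradient (h : IsTestFunction Ω φ) (u : E N → ℝ) :
    ∫ x in Ω, u x • gradient φ x = ∫ x, u x • gradient φ x :=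
  setIntegral_eq_integral_of_forall_compl_eq_zero fun x hx => by
    simp [h.gradient_eq_zero_of_notMem hx]

/-- Weak gradients are unique up to null sets. -/
theorem IsWeakGradient.ae_eq (hΩ : IsOpen Ω) (h : IsWeakGradient Ω u G) (h' : IsWeakGradient Ω u H) :
    G =ᵐ[volume.restrict Ω] H := by
  have key := hΩ.ae_eq_zero_of_integral_contDiff_smul_eq_zero (f := fun x => G x - H x)
    (μ := volume) (h.2.1.sub h'.2.1) (fun g hg hgc hgs => by
      have hg' : IsTestFunction Ω g := ⟨hg, hgc, hgs⟩
      have e := (h.2.2 g hg').symm.trans (h'.2.2 g hg')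
      rw [neg_inj, hg'.setIntegral_smul, hg'.setIntegral_smul] at e
      simp only [smul_sub]
      rw [integral_sub (hg'.integrable_smul h.2.1) (hg'.integrable_smul h'.2.1), e, sub_self])
  rw [EventuallyEq, ae_restrict_iff' hΩ.measurableSet]
  filter_upwards [key] with x hx hxΩ using sub_eq_zero.1 (hx hxΩ)

theorem IsWeakGradient.congr (h : IsWeakGradient Ω u G)
    (hu : u =ᵐ[volume.restrict Ω] v) (hG : G =ᵐ[volume.restrict Ω] H) : IsWeakGradient Ω v H := by
  refine ⟨h.1.congr hu, h.2.1.congr hG, fun φ hφ => ?_⟩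
  have e1 : ∫ x in Ω, v x • gradient φ x = ∫ x in Ω, u x • gradient φ x :=
    integral_congr_ae (by filter_upwards [hu] with x hx; rw [hx])
  have e2 : ∫ x in Ω, φ x • H x = ∫ x in Ω, φ x • G x :=
    integral_congr_ae (by filter_upwards [hG] with x hx; rw [hx])
  rw [e1, e2, h.2.2 φ hφ]

theorem IsWeakGradient.add (h : IsWeakGradient Ω u G) (h' : IsWeakGradient Ω v H) :
    IsWeakGradient Ω (fun x => u x + v x) (fun x => G x + H x) := by
  refine ⟨h.1.add h'.1, h.2.1.add h'.2.1, fun φ hφ => ?_⟩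
  simp only [add_smul, smul_add]
  rw [integral_add (hφ.integrable_smul_gradient h.1).integrableOn
    (hφ.integrable_smul_gradient h'.1).integrableOn, integral_add
    (hφ.integrable_smul h.2.1).integrableOn (hφ.integrable_smul h'.2.1).integrableOn,
    h.2.2 φ hφ, h'.2.2 φ hφ, neg_add]

theorem IsWeakGradient.const_mul (h : IsWeakGradient Ω u G) (c : ℝ) :
    IsWeakGradient Ω (fun x => c * u x) (fun x => c • G x) := by
  refine ⟨fun x hx => (h.1 x hx).smul c, fun x hx => (h.2.1 x hx).smul c, fun φ hφ => ?_⟩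
  have e1 : ∀ x, (c * u x) • gradient φ x = c • (u x • gradient φ x) := fun x => mul_smul _ _ _
  have e2 : ∀ x, φ x • c • G x = c • (φ x • G x) := fun x => smul_comm _ _ _
  simp only [e1, e2]
  rw [integral_smul, integral_smul, h.2.2 φ hφ, smul_neg]

/-- Smooth functions have their gradient as weak gradient. -/
theorem isWeakGradient_of_contDiff (hu : ContDiff ℝ ∞ u) :
    IsWeakGradient Ω u (gradient u) := by
  have hgc : Continuous (gradient u) := by
    rw [gradient_eq_toDual]
    exact (LinearIsometryEquiv.continuous _).comp (hu.continuous_fderiv (by simp))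
  refine ⟨hu.continuous.locallyIntegrable.locallyIntegrableOn _,
    hgc.locallyIntegrable.locallyIntegrableOn _, fun φ hφ => ?_⟩
  rw [hφ.setIntegral_smul, hφ.setIntegral_smul_gradient]
  have i1 := hφ.integrable_smul_gradient (hu.continuous.locallyIntegrable.locallyIntegrableOn Ω)
  have i2 := hφ.integrable_smul (hgc.locallyIntegrable.locallyIntegrableOn Ω)
  have i3 := hφ.integrable_smul (hu.continuous.locallyIntegrable.locallyIntegrableOn Ω)
  -- Pairing with a fixed vector `e` reduces the vector identity to integration by parts in the
  -- direction `e`.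
  refine ext_inner_left ℝ fun e => ?_
  rw [inner_neg_right, ← integral_inner i1, ← integral_inner i2]
  have hd : Differentiable ℝ u := hu.differentiable (by simp)
  have := integral_mul_fderiv_eq_neg_fderiv_mul_of_integrable (μ := (volume : Measure (E N)))
    (f := u) (g := φ) (v := e) ?_ ?_ ?_ (fun x _ => hd x) (fun x _ => hφ.differentiable x)
  · simpa [inner_smul_right, inner_gradient_right, mul_comm] using this
  · simpa [inner_smul_right, inner_gradient_right, mul_comm] using i2.const_inner (𝕜 := ℝ) e
  · simpa [inner_smul_right, inner_gradient_right, mul_comm] using i1.const_inner (𝕜 := ℝ) e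
  · simpa [mul_comm] using i3

theorem isWeakGradient_const (c : ℝ) : IsWeakGradient Ω (fun _ => c) (fun _ => 0) := by
  have := isWeakGradient_of_contDiff (Ω := Ω) (u := fun _ : E N => c) contDiff_const
  rwa [gradient_fun_const'] at this

theorem weakGradient_spec (h : IsWeakGradient Ω u G) : IsWeakGradient Ω u (weakGradient Ω u) := by
  have h' : ∃ G, IsWeakGradient Ω u G := ⟨G, h⟩
  rw [weakGradient, dif_pos h']
  exact h'.choose_spec

theorem weakGradient_ae_eq (hΩ : IsOpen Ω) (h : IsWeakGradient Ω u G) :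
    weakGradient Ω u =ᵐ[volume.restrict Ω] G := (weakGradient_spec h).ae_eq hΩ h

end WeakGradient

/-! ### Sobolev spaces with an explicit gradient -/

section Sobolev

variable {Ω : Set (E N)} {u v : E N → ℝ} {G H : E N → E N} {p : ℝ}

/-- `u ∈ W^{1,p}(Ω)` with weak gradient `G`. -/
structure HasW1 (Ω : Set (E N)) (p : ℝ) (u : E N → ℝ) (G : E N → E N) : Prop where
  memLp : MemLp u (ENNReal.ofReal p) (volume.restrict Ω)
  grad : IsWeakGradient Ω u G
  memLp_grad : MemLp G (ENNReal.ofReal p) (volume.restrict Ω)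

/-- `u ∈ W_0^{1,p}(Ω)` with weak gradient `G`. -/
structure HasW0 (Ω : Set (E N)) (p : ℝ) (u : E N → ℝ) (G : E N → E N) : Prop extends
    HasW1 Ω p u G where
  approx : ∃ φ : ℕ → E N → ℝ, (∀ n, IsTestFunction Ω (φ n)) ∧
    Tendsto (fun n => eLpNorm (fun x => u x - φ n x) (ENNReal.ofReal p) (volume.restrict Ω))
      atTop (𝓝 0) ∧
    Tendsto (fun n => eLpNorm (fun x => G x - gradient (φ n) x)
      (ENNReal.ofReal p) (volume.restrict Ω)) atTop (𝓝 0)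

theorem HasW1.memW1 (h : HasW1 Ω p u G) : MemW1 Ω p u := ⟨h.memLp, G, h.grad, h.memLp_grad⟩

theorem MemW1.hasW1 (hΩ : IsOpen Ω) (h : MemW1 Ω p u) : HasW1 Ω p u (weakGradient Ω u) := by
  obtain ⟨h1, G, h2, h3⟩ := h
  exact ⟨h1, weakGradient_spec h2, h3.ae_eq (weakGradient_ae_eq hΩ h2).symm⟩

theorem HasW1.congr (h : HasW1 Ω p u G) (hu : u =ᵐ[volume.restrict Ω] v)
    (hG : G =ᵐ[volume.restrict Ω] H) : HasW1 Ω p v H :=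
  ⟨h.memLp.ae_eq hu, h.grad.congr hu hG, h.memLp_grad.ae_eq hG⟩

theorem HasW0.congr (h : HasW0 Ω p u G) (hu : u =ᵐ[volume.restrict Ω] v)
    (hG : G =ᵐ[volume.restrict Ω] H) : HasW0 Ω p v H := by
  refine ⟨h.toHasW1.congr hu hG, ?_⟩
  obtain ⟨φ, h1, h2, h3⟩ := h.approx
  refine ⟨φ, h1, h2.congr fun n => eLpNorm_congr_ae ?_, h3.congr fun n => eLpNorm_congr_ae ?_⟩
  · filter_upwards [hu] with x hx; rw [hx]
  · filter_upwards [hG] with x hx; rw [hx]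

theorem HasW0.memW1Zero (hΩ : IsOpen Ω) (h : HasW0 Ω p u G) : MemW1Zero Ω p u :=
  ⟨h.toHasW1.memW1,
    (h.congr (EventuallyEq.refl _ _) (weakGradient_ae_eq hΩ h.grad).symm).approx⟩

theorem MemW1Zero.hasW0 (hΩ : IsOpen Ω) (h : MemW1Zero Ω p u) :
    HasW0 Ω p u (weakGradient Ω u) := ⟨h.1.hasW1 hΩ, h.2⟩

theorem HasW1.add (h : HasW1 Ω p u G) (h' : HasW1 Ω p v H) :
    HasW1 Ω p (fun x => u x + v x) (fun x => G x + H x) :=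
  ⟨h.memLp.add h'.memLp, h.grad.add h'.grad, h.memLp_grad.add h'.memLp_grad⟩

theorem HasW1.const_mul (h : HasW1 Ω p u G) (c : ℝ) :
    HasW1 Ω p (fun x => c * u x) (fun x => c • G x) :=
  ⟨h.memLp.const_mul c, h.grad.const_mul c, h.memLp_grad.const_smul c⟩

theorem HasW1.sub (h : HasW1 Ω p u G) (h' : HasW1 Ω p v H) :
    HasW1 Ω p (fun x => u x - v x) (fun x => G x - H x) := by
  simpa [sub_eq_add_neg] using h.add (h'.const_mul (-1))

theorem hasW1_const [IsFiniteMeasure (volume.restrict Ω)] (c : ℝ) :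
    HasW1 Ω p (fun _ => c) (fun _ => 0) :=
  ⟨memLp_const c, isWeakGradient_const c, memLp_const 0⟩

theorem HasW1.add_const [IsFiniteMeasure (volume.restrict Ω)] (h : HasW1 Ω p u G) (c : ℝ) :
    HasW1 Ω p (fun x => u x + c) G := by
  simpa using h.add (hasW1_const c)

theorem tendsto_zero_of_le_add {ι : Type*} {l : Filter ι} {a b c : ι → ℝ≥0∞}
    (ha : Tendsto a l (𝓝 0)) (hb : Tendsto b l (𝓝 0)) (h : ∀ i, c i ≤ a i + b i) :
    Tendsto c l (𝓝 0) :=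
  tendsto_of_tendsto_of_tendsto_of_le_of_le tendsto_const_nhds (by simpa using ha.add hb)
    (fun _ => zero_le) h

theorem IsTestFunction.hasW1 [IsFiniteMeasure (volume.restrict Ω)] {φ : E N → ℝ}
    (h : IsTestFunction Ω φ) : HasW1 Ω p φ (gradient φ) := by
  obtain ⟨C, hC⟩ := h.exists_bound
  obtain ⟨D, hD⟩ := h.exists_bound_gradient
  exact ⟨memLp_of_bounded h.continuous.aestronglyMeasurable hC, isWeakGradient_of_contDiff h.1,
    memLp_of_bounded h.continuous_gradient.aestronglyMeasurable hD⟩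

theorem IsTestFunction.hasW0 [IsFiniteMeasure (volume.restrict Ω)] {φ : E N → ℝ}
    (h : IsTestFunction Ω φ) : HasW0 Ω p φ (gradient φ) :=
  ⟨h.hasW1, fun _ => φ, fun _ => h, by simp, by simp⟩

theorem HasW0.add [IsFiniteMeasure (volume.restrict Ω)] (hp : 1 < p) (h : HasW0 Ω p u G)
    (h' : HasW0 Ω p v H) :
    HasW0 Ω p (fun x => u x + v x) (fun x => G x + H x) := by
  refine ⟨h.toHasW1.add h'.toHasW1, ?_⟩
  obtain ⟨φ, h1, h2, h3⟩ := h.approx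
  obtain ⟨ψ, h1', h2', h3'⟩ := h'.approx
  refine ⟨fun n x => φ n x + ψ n x, fun n => (h1 n).add (h1' n),
    tendsto_zero_of_le_add h2 h2' fun n => ?_, tendsto_zero_of_le_add h3 h3' fun n => ?_⟩
  · refine le_trans (le_of_eq ?_) (eLpNorm_add_le (h.memLp.1.sub (IsTestFunction.hasW1 (p := p) (h1 n)).memLp.1)
      (h'.memLp.1.sub (IsTestFunction.hasW1 (p := p) (h1' n)).memLp.1) (one_le_ofReal_of_one_lt hp))
    congr 1; ext x; simp; ring
  · refine le_trans (le_of_eq ?_) (eLpNorm_add_le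
      (h.memLp_grad.1.sub (IsTestFunction.hasW1 (p := p) (h1 n)).memLp_grad.1)
      (h'.memLp_grad.1.sub (IsTestFunction.hasW1 (p := p) (h1' n)).memLp_grad.1) (one_le_ofReal_of_one_lt hp))
    congr 1; ext1 x
    rw [gradient_add_apply (h1 n).differentiable (h1' n).differentiable]
    simp only [Pi.add_apply]; abel

theorem HasW0.const_mul (h : HasW0 Ω p u G) (c : ℝ) :
    HasW0 Ω p (fun x => c * u x) (fun x => c • G x) := by
  refine ⟨h.toHasW1.const_mul c, ?_⟩
  obtain ⟨φ, h1, h2, h3⟩ := h.approx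
  have key : ∀ {a : ℕ → ℝ≥0∞}, Tendsto a atTop (𝓝 0) →
      Tendsto (fun n => ‖c‖ₑ * a n) atTop (𝓝 0) := fun ha => by
    simpa using ENNReal.Tendsto.const_mul (a := ‖c‖ₑ) ha (Or.inr enorm_ne_top)
  refine ⟨fun n x => c * φ n x, fun n => (h1 n).const_mul c, (key h2).congr fun n => ?_,
    (key h3).congr fun n => ?_⟩
  · rw [← eLpNorm_const_smul]
    congr 1; ext x; simp; ring
  · rw [← eLpNorm_const_smul]
    congr 1; ext1 x
    rw [gradient_const_mul_apply (h1 n).differentiable]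
    simp [smul_sub]

theorem locallyIntegrableOn_of_memLp {F : Type*} [NormedAddCommGroup F]
    [IsFiniteMeasure (volume.restrict Ω)] (hp : 1 < p) {f : E N → F}
    (h : MemLp f (ENNReal.ofReal p) (volume.restrict Ω)) : LocallyIntegrableOn f Ω :=
  IntegrableOn.locallyIntegrableOn (h.integrable (one_le_ofReal_of_one_lt hp))

/-- `W^{1,p}` is closed: strong limits of functions and gradients. -/
theorem hasW1_of_tendsto [IsFiniteMeasure (volume.restrict Ω)] (hp : 1 < p)
    {f : ℕ → E N → ℝ} {g : ℕ → E N → E N} (h : ∀ n, HasW1 Ω p (f n) (g n))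
    (hu : MemLp u (ENNReal.ofReal p) (volume.restrict Ω))
    (hG : MemLp G (ENNReal.ofReal p) (volume.restrict Ω))
    (hf : Tendsto (fun n => eLpNorm (fun x => f n x - u x) (ENNReal.ofReal p)
      (volume.restrict Ω)) atTop (𝓝 0))
    (hg : Tendsto (fun n => eLpNorm (fun x => g n x - G x) (ENNReal.ofReal p)
      (volume.restrict Ω)) atTop (𝓝 0)) : HasW1 Ω p u G := by
  refine ⟨hu, ⟨locallyIntegrableOn_of_memLp hp hu, locallyIntegrableOn_of_memLp hp hG,
    fun φ hφ => ?_⟩, hG⟩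
  obtain ⟨C, hC⟩ := hφ.exists_bound
  obtain ⟨D, hD⟩ := hφ.exists_bound_gradient
  have l1 := tendsto_integral_bilin_of_tendsto (ContinuousLinearMap.lsmul ℝ ℝ) hp
    (fun n => (h n).memLp) hu hφ.continuous_gradient.aestronglyMeasurable hD hf
  have l2 := tendsto_integral_bilin_of_tendsto (ContinuousLinearMap.lsmul ℝ ℝ).flip hp
    (fun n => (h n).memLp_grad) hG hφ.continuous.aestronglyMeasurable hC hg
  refine tendsto_nhds_unique l1 (l2.neg.congr fun n => ?_)
  exact ((h n).grad.2.2 φ hφ).symm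

/-- `W_0^{1,p}` is closed. -/
theorem hasW0_of_tendsto [IsFiniteMeasure (volume.restrict Ω)] (hp : 1 < p)
    {f : ℕ → E N → ℝ} {g : ℕ → E N → E N} (h : ∀ n, HasW0 Ω p (f n) (g n))
    (hu : MemLp u (ENNReal.ofReal p) (volume.restrict Ω))
    (hG : MemLp G (ENNReal.ofReal p) (volume.restrict Ω))
    (hf : Tendsto (fun n => eLpNorm (fun x => f n x - u x) (ENNReal.ofReal p)
      (volume.restrict Ω)) atTop (𝓝 0))
    (hg : Tendsto (fun n => eLpNorm (fun x => g n x - G x) (ENNReal.ofReal p)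
      (volume.restrict Ω)) atTop (𝓝 0)) : HasW0 Ω p u G := by
  refine ⟨hasW1_of_tendsto hp (fun n => (h n).toHasW1) hu hG hf hg, ?_⟩
  -- Diagonal choice: a test function within 1/n of the n-th term, in function and gradient. For n =
  -- 0 the bound is `⊤`, so nothing is required.
  have key : ∀ n : ℕ, ∃ φ, IsTestFunction Ω φ ∧
      eLpNorm (fun x => f n x - φ x) (ENNReal.ofReal p) (volume.restrict Ω) ≤ (n : ℝ≥0∞)⁻¹ ∧
      eLpNorm (fun x => g n x - gradient φ x) (ENNReal.ofReal p) (volume.restrict Ω)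
        ≤ (n : ℝ≥0∞)⁻¹ := fun n => by
    obtain ⟨φ, h1, h2, h3⟩ := (h n).approx
    have hn : (0 : ℝ≥0∞) < (n : ℝ≥0∞)⁻¹ := by simp
    obtain ⟨k, hk2, hk3⟩ := ((h2.eventually (ge_mem_nhds hn)).and
      (h3.eventually (ge_mem_nhds hn))).exists
    exact ⟨φ k, h1 k, hk2, hk3⟩
  choose φ h1 h2 h3 using key
  have hz := ENNReal.tendsto_inv_nat_nhds_zero
  refine ⟨φ, h1, tendsto_zero_of_le_add hf hz fun n => ?_,
    tendsto_zero_of_le_add hg hz fun n => ?_⟩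
  · refine le_trans ?_ (add_le_add_right (h2 n) _)
    rw [show (fun x => f n x - u x) = f n - u from rfl, eLpNorm_sub_comm (f n) u]
    refine le_trans (le_of_eq ?_) (eLpNorm_add_le (hu.1.sub (h n).memLp.1)
      ((h n).memLp.1.sub (IsTestFunction.hasW1 (p := p) (h1 n)).memLp.1) (one_le_ofReal_of_one_lt hp))
    congr 1; ext x; simp
  · refine le_trans ?_ (add_le_add_right (h3 n) _)
    rw [show (fun x => g n x - G x) = g n - G from rfl, eLpNorm_sub_comm (g n) G]
    refine le_trans (le_of_eq ?_) (eLpNorm_add_le (hG.1.sub (h n).memLp_grad.1)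
      ((h n).memLp_grad.1.sub (IsTestFunction.hasW1 (p := p) (h1 n)).memLp_grad.1) (one_le_ofReal_of_one_lt hp))
    congr 1; ext1 x; simp

end Sobolev

/-! ### Translations of Sobolev functions -/

section Translation

/-- Jensen's inequality, obtained from Hölder against the constant 1. -/
theorem rpow_lintegral_le_lintegral_rpow {X : Type*} [MeasurableSpace X] {ν : Measure X}
    [IsProbabilityMeasure ν] {q : ℝ} (hq : 1 < q) {f : X → ℝ≥0∞} (hf : AEMeasurable f ν) :
    (∫⁻ x, f x ∂ν) ^ q ≤ ∫⁻ x, f x ^ q ∂ν := by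
  have h := ENNReal.lintegral_mul_le_Lp_mul_Lq ν (Real.HolderConjugate.conjExponent hq) hf
    (aemeasurable_const (b := (1 : ℝ≥0∞)))
  simp only [Pi.mul_apply, mul_one, ENNReal.one_rpow, lintegral_const, measure_univ] at h
  have hq0 : 0 < q := by linarith
  calc (∫⁻ x, f x ∂ν) ^ q ≤ ((∫⁻ x, f x ^ q ∂ν) ^ (1 / q)) ^ q :=
        ENNReal.rpow_le_rpow h hq0.le
    _ = _ := by rw [← ENNReal.rpow_mul, one_div_mul_cancel hq0.ne', ENNReal.rpow_one]

/-- The points from which the segment in direction `h` stays in `Ω`. -/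
def segmentInside (Ω : Set (E N)) (h : E N) : Set (E N) :=
  {x | ∀ σ ∈ Set.Icc (0 : ℝ) 1, x + σ • h ∈ Ω}

variable {Ω : Set (E N)} {v : E N → ℝ} {G : E N → E N}

theorem isOpen_segmentInside (hΩ : IsOpen Ω) (h : E N) : IsOpen (segmentInside Ω h) := by
  rw [isOpen_iff_mem_nhds]
  intro x hx
  refine isCompact_Icc.eventually_forall_of_forall_eventually fun σ hσ => ?_
  have hc : Continuous fun y : E N × ℝ => y.1 + y.2 • h := by fun_prop
  exact (hΩ.preimage hc).mem_nhds (hx σ hσ)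

theorem IsTestFunction.translate {A : Set (E N)} {φ : E N → ℝ} (hφ : IsTestFunction A φ) (k : E N)
    (hk : ∀ x ∈ A, x + k ∈ Ω) : IsTestFunction Ω (fun y => φ (y - k)) := by
  refine ⟨hφ.1.comp (contDiff_id.sub contDiff_const), ?_, ?_⟩
  · exact hφ.2.1.comp_homeomorph (Homeomorph.subRight k)
  · have : tsupport (fun y => φ (y - k)) = (fun y => y - k) ⁻¹' tsupport φ :=
      tsupport_comp_eq_preimage φ (Homeomorph.subRight k)
    rw [this]
    intro y hy
    simpa using hk _ (hφ.2.2 hy)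

theorem gradient_translate (φ : E N → ℝ) (k x : E N) :
    gradient (fun y => φ (y - k)) x = gradient φ (x - k) := by
  simp only [gradient, sub_eq_add_neg, fderiv_comp_add_right]

theorem setLIntegral_translate_le {K K' : Set (E N)} (hK : MeasurableSet K)
    (hK' : MeasurableSet K') {k : E N} (hk : ∀ x ∈ K, x + k ∈ K') (f : E N → ℝ≥0∞) :
    ∫⁻ x in K, f (x + k) ≤ ∫⁻ x in K', f x := by
  rw [← lintegral_indicator hK, ← lintegral_indicator hK',
    ← lintegral_add_right_eq_self (K'.indicator f) k]
  refine lintegral_mono fun x => ?_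
  by_cases hx : x ∈ K
  · simp [hx, hk x hx]
  · simp [hx]

/-- Integrating over x first, the translate of `K` by σh lies in `K'`, so ∫_{K'} |f| is a bound
uniform in σ. This licenses Fubini in the translation formula. -/
theorem integrable_translate_prod {ν : Measure ℝ} [IsFiniteMeasure ν] {K K' : Set (E N)}
    {F : Type*} [NormedAddCommGroup F] {f : E N → F} (hf : StronglyMeasurable f) {h : E N}
    (hKm : MeasurableSet K) (hKm' : MeasurableSet K') (hKK : ∀ᵐ σ ∂ν, ∀ x ∈ K, x + σ • h ∈ K')
    (hi : IntegrableOn f K') :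
    Integrable (fun z : E N × ℝ => f (z.1 + z.2 • h)) ((volume.restrict K).prod ν) := by
  have hm : Measurable fun z : E N × ℝ => z.1 + z.2 • h := by fun_prop
  refine ⟨(hf.comp_measurable hm).aestronglyMeasurable, ?_⟩
  rw [HasFiniteIntegral, lintegral_prod_symm (fun z : E N × ℝ => ‖f (z.1 + z.2 • h)‖ₑ)
    (hf.comp_measurable hm).enorm.aemeasurable]
  calc ∫⁻ σ, (∫⁻ x in K, ‖f (x + σ • h)‖ₑ) ∂ν ≤ ∫⁻ _σ, (∫⁻ x in K', ‖f x‖ₑ) ∂ν := by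
        refine lintegral_mono_ae ?_
        filter_upwards [hKK] with σ hσ using setLIntegral_translate_le hKm hKm' hσ fun x => ‖f x‖ₑ
    _ < ⊤ := by
        rw [lintegral_const]
        exact ENNReal.mul_lt_top hi.2 (measure_lt_top _ _)

/-- Absolute continuity of Sobolev functions along translations, tested against `φ`. -/
theorem IsWeakGradient.integral_translate (hw : IsWeakGradient Ω v G)
    (hG : StronglyMeasurable G) (h : E N) {φ : E N → ℝ}
    (hφ : IsTestFunction (segmentInside Ω h) φ) :
    ∫ x, φ x • (v (x + h) - v x) =
      ∫ x, φ x • ∫ σ in Set.Ioc (0 : ℝ) 1, inner ℝ h (G (x + σ • h)) := by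
  set ν : Measure ℝ := volume.restrict (Set.Ioc (0 : ℝ) 1) with hν
  set K := tsupport φ with hK
  have hKc : IsCompact K := hφ.2.1
  -- The union of all segments issuing from supp φ in the direction `h`: a compact subset of Ω, so v
  -- and G are integrable on it.
  set K' : Set (E N) := (fun z : E N × ℝ => z.1 + z.2 • h) '' (K ×ˢ Set.Icc (0 : ℝ) 1) with hK'
  have hKc' : IsCompact K' := (hKc.prod isCompact_Icc).image (by fun_prop)
  have hKΩ : K' ⊆ Ω := by
    rintro _ ⟨⟨x, σ⟩, ⟨hx, hσ⟩, rfl⟩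
    exact hφ.2.2 hx σ hσ
  have hmem : ∀ x ∈ K, ∀ σ ∈ Set.Icc (0 : ℝ) 1, x + σ • h ∈ K' :=
    fun x hx σ hσ => ⟨(x, σ), ⟨hx, hσ⟩, rfl⟩
  have hKK : ∀ᵐ σ ∂ν, ∀ x ∈ K, x + σ • h ∈ K' := by
    filter_upwards [ae_restrict_mem measurableSet_Ioc] with σ hσ x hx
    exact hmem x hx σ ⟨hσ.1.le, hσ.2⟩
  have hvK : IntegrableOn v K' := hw.1.integrableOn_compact_subset hKΩ hKc'
  have hGK : IntegrableOn G K' := hw.2.1.integrableOn_compact_subset hKΩ hKc'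
  have hz : ∀ y, y ∉ K' → ∀ σ ∈ Set.Icc (0 : ℝ) 1, y - σ • h ∉ K := fun y hy σ hσ hyK =>
    hy (by simpa using hmem _ hyK σ hσ)
  have hgz : ∀ y, y ∉ K → gradient φ y = 0 := fun y hy => image_eq_zero_of_notMem_tsupport
    fun hx => hy (IsTestFunction.tsupport_gradient_subset φ hx)
  have hφz : ∀ y, y ∉ K → φ y = 0 := fun y hy => image_eq_zero_of_notMem_tsupport hy
  -- The translation is moved from v to φ, where the fundamental theorem of calculus is classical.
  have ftc : ∀ y, φ (y - h) - φ y = - ∫ σ, inner ℝ h (gradient φ (y - σ • h)) ∂ν := fun y => by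
    have hd : ∀ σ ∈ Set.uIcc (0 : ℝ) 1, HasDerivAt (fun σ : ℝ => φ (y - σ • h))
        (-inner ℝ h (gradient φ (y - σ • h))) σ := fun σ _ => by
      have h1 : HasDerivAt (fun σ : ℝ => y - σ • h) (-h) σ := by
        simpa using ((hasDerivAt_id σ).smul_const h).const_sub y
      have h2 := (hφ.differentiable (y - σ • h)).hasFDerivAt.comp_hasDerivAt σ h1
      have e : -inner ℝ h (gradient φ (y - σ • h)) = fderiv ℝ φ (y - σ • h) (-h) := by
        simp [inner_gradient_right]
      rw [e]
      exact h2
    have hc : Continuous fun σ : ℝ => -inner ℝ h (gradient φ (y - σ • h)) :=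
      (continuous_const.inner (hφ.continuous_gradient.comp (by fun_prop))).neg
    have := intervalIntegral.integral_eq_sub_of_hasDerivAt hd (hc.intervalIntegrable _ _)
    rw [intervalIntegral.integral_of_le zero_le_one, integral_neg] at this
    simpa using this.symm
  have iv0 : Integrable fun x => φ x • v x := by
    refine hφ.integrable_smul (hw.1.mono_set fun x hx => ?_)
    simpa using hx 0 (by simp)
  have tφ : IsTestFunction Ω (fun y => φ (y - h)) := hφ.translate h fun x hx => by
    simpa using hx 1 (by simp)
  have iv1 : Integrable fun x => φ (x - h) • v x := tφ.integrable_smul hw.1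
  have iv1' : Integrable fun x => φ x • v (x + h) := by
    have := iv1.comp_add_right h
    simpa using this
  have e1 : ∫ x, φ x • (v (x + h) - v x) = ∫ y in K', v y * (φ (y - h) - φ y) := by
    simp only [smul_sub]
    rw [integral_sub iv1' iv0]
    have : ∫ x, φ x • v (x + h) = ∫ x, φ (x - h) • v x := by
      rw [← integral_add_right_eq_self (fun x => φ (x - h) • v x) h]; simp
    rw [this, ← integral_sub iv1 iv0, setIntegral_eq_integral_of_forall_compl_eq_zero]
    · congr 1; ext y; simp only [smul_eq_mul]; ring
    · intro y hy
      rw [hφz _ (by simpa using hz y hy 1 (by simp)), hφz _ (by simpa using hz y hy 0 (by simp))]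
      simp
  obtain ⟨D, hD⟩ := hφ.exists_bound_gradient
  have cg : Continuous fun z : E N × ℝ => inner ℝ h (gradient φ (z.1 - z.2 • h)) :=
    continuous_const.inner (hφ.continuous_gradient.comp (by fun_prop))
  have i1 : Integrable (fun z : E N × ℝ => v z.1 * inner ℝ h (gradient φ (z.1 - z.2 • h)))
      ((volume.restrict K').prod ν) := by
    refine (Integrable.comp_fst hvK ν).mul_bdd (c := ‖h‖ * D) cg.aestronglyMeasurable
      (Eventually.of_forall fun z => ?_)
    exact (norm_inner_le_norm _ _).trans (mul_le_mul_of_nonneg_left (hD _) (norm_nonneg _))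
  have e2 : ∫ y in K', v y * (φ (y - h) - φ y) =
      - ∫ σ, (∫ y in K', v y * inner ℝ h (gradient φ (y - σ • h))) ∂ν := by
    rw [← integral_integral_swap i1, ← integral_neg]
    congr 1; ext y
    rw [ftc, mul_neg, integral_const_mul]
  -- For each σ the weak gradient is tested with φ(· − σh), which is supported in Ω because the
  -- whole segment is.
  have e3 : ∀ σ ∈ Set.Ioc (0 : ℝ) 1, ∫ y in K', v y * inner ℝ h (gradient φ (y - σ • h)) =
      - ∫ x, φ x * inner ℝ h (G (x + σ • h)) := fun σ hσ => by
    have hσ' : σ ∈ Set.Icc (0 : ℝ) 1 := ⟨hσ.1.le, hσ.2⟩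
    have t : IsTestFunction Ω (fun y => φ (y - σ • h)) := hφ.translate _ fun x hx => hx σ hσ'
    have key := hw.2.2 _ t
    rw [t.setIntegral_smul_gradient, t.setIntegral_smul] at key
    rw [setIntegral_eq_integral_of_forall_compl_eq_zero fun y hy => by
      rw [hgz _ (hz y hy σ hσ')]; simp]
    have key2 := congrArg (fun a => inner ℝ h a) key
    simp only [inner_neg_right] at key2
    rw [← integral_inner (t.integrable_smul_gradient hw.1),
      ← integral_inner (t.integrable_smul hw.2.1)] at key2
    simp only [inner_smul_right, gradient_translate] at key2
    rw [key2, neg_inj, ← integral_add_right_eq_self _ (σ • h)]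
    simp
  have e4 : ∫ σ, (∫ y in K', v y * inner ℝ h (gradient φ (y - σ • h))) ∂ν =
      - ∫ σ, (∫ x in K, φ x * inner ℝ h (G (x + σ • h))) ∂ν := by
    rw [← integral_neg]
    refine integral_congr_ae ?_
    filter_upwards [ae_restrict_mem measurableSet_Ioc] with σ hσ
    rw [e3 σ hσ, setIntegral_eq_integral_of_forall_compl_eq_zero fun y hy => by
      rw [hφz _ hy]; simp]
  obtain ⟨C, hC⟩ := hφ.exists_bound
  have i2 : Integrable (fun z : E N × ℝ => φ z.1 * inner ℝ h (G (z.1 + z.2 • h)))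
      ((volume.restrict K).prod ν) := by
    have := (integrable_translate_prod hG hKc.measurableSet hKc'.measurableSet hKK
      hGK).const_inner (𝕜 := ℝ) h
    exact this.bdd_mul (c := C) (hφ.continuous.comp continuous_fst).aestronglyMeasurable
      (Eventually.of_forall fun z => hC _)
  rw [e1, e2, e4, neg_neg, ← integral_integral_swap i2,
    setIntegral_eq_integral_of_forall_compl_eq_zero fun y hy => by rw [hφz _ hy]; simp]
  simp only [integral_const_mul, smul_eq_mul]

/-- Both sides are locally integrable on the open set `segmentInside Ω h` and agree against every
test function there. -/
theorem IsWeakGradient.translate_ae_eq (hΩ : IsOpen Ω) (hw : IsWeakGradient Ω v G)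
    (hG : StronglyMeasurable G) (h : E N) :
    ∀ᵐ x, x ∈ segmentInside Ω h →
      v (x + h) - v x = ∫ σ in Set.Ioc (0 : ℝ) 1, inner ℝ h (G (x + σ • h)) := by
  have hA := isOpen_segmentInside hΩ h
  set ν : Measure ℝ := volume.restrict (Set.Ioc (0 : ℝ) 1) with hν
  have hloc : ∀ K ⊆ segmentInside Ω h, IsCompact K → ∃ K', IsCompact K' ∧ K' ⊆ Ω ∧
      ∀ x ∈ K, ∀ σ ∈ Set.Icc (0 : ℝ) 1, x + σ • h ∈ K' := fun K hK hKc =>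
    ⟨(fun z : E N × ℝ => z.1 + z.2 • h) '' (K ×ˢ Set.Icc (0 : ℝ) 1),
      (hKc.prod isCompact_Icc).image (by fun_prop), by
        rintro _ ⟨⟨x, σ⟩, ⟨hx, hσ⟩, rfl⟩
        exact hK hx σ hσ, fun x hx σ hσ => ⟨(x, σ), ⟨hx, hσ⟩, rfl⟩⟩
  have l1 : LocallyIntegrableOn (fun x => v (x + h) - v x) (segmentInside Ω h) := by
    rw [locallyIntegrableOn_iff hA.isLocallyClosed]
    intro K hK hKc
    obtain ⟨K', hKc', hKΩ, hKK⟩ := hloc K hK hKc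
    have hvK : IntegrableOn v K' := hw.1.integrableOn_compact_subset hKΩ hKc'
    refine Integrable.sub ?_ (hvK.mono_set fun x hx => by simpa using hKK x hx 0 (by simp))
    have := ((measurePreserving_add_right volume h).integrableOn_comp_preimage
      (measurableEmbedding_addRight h)).2 hvK
    exact this.mono_set fun x hx => by simpa using hKK x hx 1 (by simp)
  have l2 : LocallyIntegrableOn (fun x => ∫ σ, inner ℝ h (G (x + σ • h)) ∂ν)
      (segmentInside Ω h) := by
    rw [locallyIntegrableOn_iff hA.isLocallyClosed]
    intro K hK hKc
    obtain ⟨K', hKc', hKΩ, hKK⟩ := hloc K hK hKc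
    have hGK : IntegrableOn G K' := hw.2.1.integrableOn_compact_subset hKΩ hKc'
    have hKK' : ∀ᵐ σ ∂ν, ∀ x ∈ K, x + σ • h ∈ K' := by
      filter_upwards [ae_restrict_mem measurableSet_Ioc] with σ hσ x hx
      exact hKK x hx σ ⟨hσ.1.le, hσ.2⟩
    exact ((integrable_translate_prod hG hKc.measurableSet hKc'.measurableSet hKK'
      hGK).const_inner (𝕜 := ℝ) h).integral_prod_left
  have := hA.ae_eq_zero_of_integral_contDiff_smul_eq_zero (μ := volume) (l1.sub l2)
    (fun φ h1 h2 h3 => by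
      have hφ : IsTestFunction (segmentInside Ω h) φ := ⟨h1, h2, h3⟩
      simp only [Pi.sub_apply]
      have : ∀ x, φ x • (v (x + h) - v x - ∫ σ, inner ℝ h (G (x + σ • h)) ∂ν) =
        φ x • (v (x + h) - v x) - φ x • ∫ σ, inner ℝ h (G (x + σ • h)) ∂ν := fun x => smul_sub _ _ _
      simp only [this]
      rw [integral_sub (hφ.integrable_smul l1) (hφ.integrable_smul l2),
        hw.integral_translate hG h hφ, sub_self])
  filter_upwards [this] with x hx hxA using sub_eq_zero.1 (hx hxA)

/-- The `L^q` modulus of continuity of a Sobolev function under translations. -/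
theorem IsWeakGradient.lintegral_translate_le (hΩ : IsOpen Ω) (hw : IsWeakGradient Ω v G)
    {q : ℝ} (hq : 1 < q) (h : E N) {A : Set (E N)} (hA : A ⊆ segmentInside Ω h) :
    ∫⁻ x in A, ‖v (x + h) - v x‖ₑ ^ q ≤ ‖h‖ₑ ^ q * ∫⁻ x in Ω, ‖G x‖ₑ ^ q := by
  have hq0 : 0 < q := by linarith
  have hS := isOpen_segmentInside hΩ h
  have mv := hw.1.aestronglyMeasurable
  have mG := hw.2.1.aestronglyMeasurable
  -- Measurable representatives, so that (x, σ) ↦ G(x + σh) is jointly measurable.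
  set v' := mv.mk v
  set G' := mG.mk G
  have hw' : IsWeakGradient Ω v' G' := hw.congr mv.ae_eq_mk mG.ae_eq_mk
  have key := hw'.translate_ae_eq hΩ mG.stronglyMeasurable_mk h
  have hvv : ∀ᵐ x, x ∈ Ω → v x = v' x := (ae_restrict_iff' hΩ.measurableSet).1 mv.ae_eq_mk
  have hvv' : ∀ᵐ x, x + h ∈ Ω → v (x + h) = v' (x + h) :=
    (measurePreserving_add_right volume h).quasiMeasurePreserving.ae hvv
  set ν : Measure ℝ := volume.restrict (Set.Ioc (0 : ℝ) 1) with hν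
  have : IsProbabilityMeasure ν := ⟨by simp [hν]⟩
  have hm : Measurable fun z : E N × ℝ => z.1 + z.2 • h := by fun_prop
  have hGm : Measurable fun z : E N × ℝ => ‖G' (z.1 + z.2 • h)‖ₑ ^ q :=
    (mG.stronglyMeasurable_mk.comp_measurable hm).enorm.pow_const q
  calc ∫⁻ x in A, ‖v (x + h) - v x‖ₑ ^ q
      ≤ ∫⁻ x in segmentInside Ω h, ‖v (x + h) - v x‖ₑ ^ q := lintegral_mono_set hA
    _ ≤ ∫⁻ x in segmentInside Ω h, (∫⁻ σ, ‖h‖ₑ ^ q * ‖G' (x + σ • h)‖ₑ ^ q ∂ν) := by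
        refine lintegral_mono_ae ?_
        rw [ae_restrict_iff' hS.measurableSet]
        filter_upwards [key, hvv, hvv'] with x h1 h2 h3 hx
        rw [h2 (by simpa using hx 0 (by simp)), h3 (by simpa using hx 1 (by simp)), h1 hx]
        have m1 : Measurable fun σ : ℝ => ‖h‖ₑ * ‖G' (x + σ • h)‖ₑ :=
          (mG.stronglyMeasurable_mk.comp_measurable (by fun_prop)).enorm.const_mul _
        calc ‖∫ σ, inner ℝ h (G' (x + σ • h)) ∂ν‖ₑ ^ q
            ≤ (∫⁻ σ, ‖h‖ₑ * ‖G' (x + σ • h)‖ₑ ∂ν) ^ q := by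
              refine ENNReal.rpow_le_rpow ((enorm_integral_le_lintegral_enorm _).trans
                (lintegral_mono fun σ => ?_)) hq0.le
              simp only [← ofReal_norm]
              rw [← ENNReal.ofReal_mul (norm_nonneg _)]
              exact ENNReal.ofReal_le_ofReal (norm_inner_le_norm _ _)
          _ ≤ ∫⁻ σ, (‖h‖ₑ * ‖G' (x + σ • h)‖ₑ) ^ q ∂ν :=
              rpow_lintegral_le_lintegral_rpow hq m1.aemeasurable
          _ = _ := by simp only [ENNReal.mul_rpow_of_nonneg _ _ hq0.le]
    _ = ∫⁻ σ, (∫⁻ x in segmentInside Ω h, ‖h‖ₑ ^ q * ‖G' (x + σ • h)‖ₑ ^ q) ∂ν :=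
        lintegral_lintegral_swap (hGm.const_mul _).aemeasurable
    _ ≤ ∫⁻ _σ, (‖h‖ₑ ^ q * ∫⁻ x in Ω, ‖G x‖ₑ ^ q) ∂ν := by
        refine lintegral_mono_ae ?_
        filter_upwards [ae_restrict_mem measurableSet_Ioc] with σ hσ
        have hm' : Measurable fun x : E N => ‖G' (x + σ • h)‖ₑ ^ q :=
          (mG.stronglyMeasurable_mk.comp_measurable (by fun_prop)).enorm.pow_const q
        rw [lintegral_const_mul _ hm']
        refine mul_le_mul_right ?_ _
        have : ∫⁻ x in Ω, ‖G x‖ₑ ^ q = ∫⁻ x in Ω, ‖G' x‖ₑ ^ q :=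
          lintegral_congr_ae (by filter_upwards [mG.ae_eq_mk] with x hx; rw [hx])
        rw [this]
        exact setLIntegral_translate_le hS.measurableSet hΩ.measurableSet
          (fun x hx => hx σ ⟨hσ.1.le, hσ.2⟩) fun x => ‖G' x‖ₑ ^ q
    _ = _ := by simp

/-- The translation estimate with G = 0 gives v(x + h) = v(x) for a.e. x, for each h. Fubini
exchanges the quantifiers: since the ball has positive measure, it contains a base point x with v(x
+ h) = v(x) for a.e. admissible h. -/
theorem IsWeakGradient.ae_const_ball (hΩ : IsOpen Ω) (hw : IsWeakGradient Ω v fun _ => 0)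
    {x₀ : E N} {r : ℝ} (hr : 0 < r) (hB : Metric.ball x₀ r ⊆ Ω) :
    ∃ c, ∀ᵐ x, x ∈ Metric.ball x₀ r → v x = c := by
  set B := Metric.ball x₀ r with hBdef
  have mB : MeasurableSet B := measurableSet_ball
  have mv := hw.1.aestronglyMeasurable
  set v' := mv.mk v
  have hvv : ∀ᵐ x, x ∈ Ω → v x = v' x := (ae_restrict_iff' hΩ.measurableSet).1 mv.ae_eq_mk
  have hw' : IsWeakGradient Ω v' fun _ => 0 := hw.congr mv.ae_eq_mk (EventuallyEq.refl _ _)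
  have mv' : Measurable v' := mv.stronglyMeasurable_mk.measurable
  have hA : ∀ h : E N, ∫⁻ x in B ∩ {x | x + h ∈ B}, ‖v' (x + h) - v' x‖ₑ ^ (2 : ℝ) = 0 := fun h => by
    have := hw'.lintegral_translate_le hΩ (q := 2) (by norm_num) h
      (A := B ∩ {x | x + h ∈ B}) (fun x hx σ hσ => hB ?_)
    · simpa using this
    · have := (convex_ball x₀ r).add_smul_sub_mem hx.1 hx.2 hσ
      simpa [hBdef] using this
  have mS : Measurable fun z : E N × E N => ‖v' (z.1 + z.2) - v' z.1‖ₑ ^ (2 : ℝ) :=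
    ((mv'.comp (measurable_fst.add measurable_snd)).sub (mv'.comp measurable_fst)).enorm.pow_const _
  have mI : MeasurableSet {z : E N × E N | z.1 ∈ B ∧ z.1 + z.2 ∈ B} :=
    (measurable_fst mB).inter ((measurable_fst.add measurable_snd) mB)
  have hz : ∫⁻ x, ∫⁻ h, ({z : E N × E N | z.1 ∈ B ∧ z.1 + z.2 ∈ B}).indicator
      (fun z => ‖v' (z.1 + z.2) - v' z.1‖ₑ ^ (2 : ℝ)) (x, h) = 0 := by
    rw [lintegral_lintegral_swap (by exact (mS.indicator mI).aemeasurable)]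
    refine (lintegral_congr fun h => ?_).trans lintegral_zero
    have mh : MeasurableSet (B ∩ {x | x + h ∈ B}) := mB.inter ((measurable_id.add_const h) mB)
    rw [← hA h, ← lintegral_indicator mh]
    rfl
  rw [lintegral_eq_zero_iff (by exact (mS.indicator mI).lintegral_prod_right')] at hz
  have hpos : 0 < volume B := Metric.measure_ball_pos _ _ hr
  obtain ⟨x, hxB, hx⟩ : ∃ x ∈ B, ∫⁻ h, ({z : E N × E N | z.1 ∈ B ∧ z.1 + z.2 ∈ B}).indicator
      (fun z => ‖v' (z.1 + z.2) - v' z.1‖ₑ ^ (2 : ℝ)) (x, h) = 0 := by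
    by_contra! hcon
    have : volume B = 0 := measure_mono_null (fun x hx => hcon x hx) (ae_iff.1 hz)
    exact hpos.ne' this
  rw [lintegral_eq_zero_iff (by exact (mS.indicator mI).comp measurable_prodMk_left)] at hx
  refine ⟨v' x, ?_⟩
  have h2 := (measurePreserving_sub_right volume x).quasiMeasurePreserving.ae hx
  filter_upwards [h2, hvv] with y hy hyv hyB
  rw [hyv (hB hyB)]
  have : ‖v' y - v' x‖ₑ ^ (2 : ℝ) = 0 := by simpa [Set.indicator, hxB, hyB] using hy
  simpa [sub_eq_zero] using this

/-- A function with vanishing weak gradient on a connected open set is constant. -/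
theorem IsWeakGradient.ae_const (hΩ : IsOpen Ω) (hc : IsPreconnected Ω)
    (hw : IsWeakGradient Ω v fun _ => 0) : ∃ c, ∀ᵐ x ∂(volume.restrict Ω), v x = c := by
  have hloc : ∀ x ∈ Ω, ∃ r > 0, ∃ c, Metric.ball x r ⊆ Ω ∧
      ∀ᵐ y, y ∈ Metric.ball x r → v y = c := fun x hx => by
    obtain ⟨r, hr, hB⟩ := Metric.isOpen_iff.1 hΩ x hx
    obtain ⟨c, hc⟩ := hw.ae_const_ball hΩ hr hB
    exact ⟨r, hr, c, hB, hc⟩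
  choose! r hr c hB hrc using hloc
  -- Two nearby centres have balls overlapping in a set of positive measure, so their constants
  -- agree; connectedness propagates the equality.
  have hconst : ∀ x ∈ Ω, ∀ y ∈ Ω, c x = c y := fun x hx y hy => by
    refine hc.induction₂ (fun x y => c x = c y) (fun x hx => ?_) (fun x y z _ _ _ => Eq.trans)
      (fun x y _ _ => Eq.symm) hx hy
    filter_upwards [self_mem_nhdsWithin, mem_nhdsWithin_of_mem_nhds
      (Metric.ball_mem_nhds x (hr x hx))] with y hy hyB
    have hpos : 0 < volume (Metric.ball x (r x) ∩ Metric.ball y (r y)) :=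
      (Metric.isOpen_ball.inter Metric.isOpen_ball).measure_pos _
        ⟨y, hyB, Metric.mem_ball_self (hr y hy)⟩
    by_contra hne
    refine hpos.ne' (measure_mono_null ?_ (ae_iff.1 ((hrc x hx).and (hrc y hy))))
    intro z hz hz'
    exact hne ((hz'.1 hz.1).symm.trans (hz'.2 hz.2))
  rcases Ω.eq_empty_or_nonempty with rfl | ⟨x₀, hx₀⟩
  · simp
  refine ⟨c x₀, ?_⟩
  rw [ae_restrict_iff' hΩ.measurableSet, ae_iff]
  refine measure_null_of_locally_null _ fun x hx => ?_
  have hxΩ : x ∈ Ω := by by_contra h; exact hx fun h' => absurd h' h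
  refine ⟨{y | ¬(y ∈ Ω → v y = c x₀)} ∩ Metric.ball x (r x),
    Filter.inter_mem self_mem_nhdsWithin (mem_nhdsWithin_of_mem_nhds
      (Metric.ball_mem_nhds x (hr x hxΩ))), measure_mono_null ?_ (ae_iff.1 (hrc x hxΩ))⟩
  rintro y ⟨hy, hyB⟩ hy'
  exact hy fun _ => (hy' hyB).trans (hconst x hxΩ x₀ hx₀)

end Translation

/-! ### The cone condition -/

section Cone

variable {Ω : Set (E N)}

/-- Uniform cone condition near each point of the closure. -/
theorem IsSmoothBoundedDomain.exists_cone (hΩ : IsSmoothBoundedDomain Ω) {x₀ : E N}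
    (hx₀ : x₀ ∈ closure Ω) : ∃ V ∈ 𝓝 x₀, ∃ e : E N, ∃ r > 0, ∀ x ∈ Ω ∩ V,
      ∀ z ∈ Metric.ball e (2 * r), ∀ s ∈ Set.Icc (0 : ℝ) 1, x + s • z ∈ Ω := by
  by_cases hx : x₀ ∈ Ω
  · obtain ⟨δ, hδ, hB⟩ := Metric.isOpen_iff.1 hΩ.isOpen x₀ hx
    -- At an interior point the cone may be a full ball, with axis vector 0.
    refine ⟨Metric.ball x₀ (δ / 2), Metric.ball_mem_nhds _ (by positivity), 0, δ / 4, by positivity,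
      fun x hx z hz s hs => hB ?_⟩
    have h1 := hx.2
    rw [mem_ball_iff_norm] at h1 hz ⊢
    rw [sub_zero] at hz
    calc ‖x + s • z - x₀‖ = ‖(x - x₀) + s • z‖ := by congr 1; abel
      _ ≤ ‖x - x₀‖ + ‖s • z‖ := norm_add_le _ _
      _ ≤ ‖x - x₀‖ + 1 * ‖z‖ := by
        rw [norm_smul, Real.norm_of_nonneg hs.1]
        have := mul_le_mul_of_nonneg_right hs.2 (norm_nonneg z)
        linarith
      _ < δ := by linarith
  · have hfr : x₀ ∈ frontier Ω := by
      rw [hΩ.isOpen.frontier_eq]; exact ⟨hx₀, hx⟩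
    obtain ⟨U, hU, hxU, ρ, hρ, hρ0, hΩU⟩ := hΩ.smooth_boundary x₀ hfr
    obtain ⟨e', he'⟩ : ∃ e', fderiv ℝ ρ x₀ e' < 0 := by
      by_contra! hcon
      apply hρ0
      ext e
      refine le_antisymm ?_ (by simpa using hcon e)
      have := hcon (-e)
      simpa using this
    have hcont : Continuous fun z : E N × E N => fderiv ℝ ρ z.1 z.2 :=
      ((hρ.continuous_fderiv (by simp)).comp continuous_fst).clm_apply continuous_snd
    have hnhds : {z : E N × E N | z.1 ∈ U ∧ fderiv ℝ ρ z.1 z.2 < 0} ∈ 𝓝 (x₀, e') :=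
      ((hU.preimage continuous_fst).inter (isOpen_Iio.preimage hcont)).mem_nhds ⟨hxU, he'⟩
    obtain ⟨δ, hδ, hB⟩ := Metric.mem_nhds_iff.1 hnhds
    have hB' : ∀ x ∈ Metric.ball x₀ δ, ∀ z ∈ Metric.ball e' δ, x ∈ U ∧ fderiv ℝ ρ x z < 0 :=
      fun x hx z hz => by
        have hmem : ((x, z) : E N × E N) ∈ Metric.ball (x₀, e') δ := by
          rw [Metric.mem_ball, Prod.dist_eq]
          exact max_lt (Metric.mem_ball.1 hx) (Metric.mem_ball.1 hz)
        have h2 := hB hmem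
        rwa [Set.mem_ofPred_eq] at h2
    -- κ shortens the vectors of the δ-ball around `e'` to length at most δ/2, so segments from the
    -- smaller ball stay in the region where ρ decreases in these directions.
    set κ : ℝ := min 1 (δ / 2 / (‖e'‖ + δ)) with hκ
    have hκ0 : 0 < κ := lt_min one_pos (by positivity)
    have hκ1 : κ * (‖e'‖ + δ) ≤ δ / 2 := by
      calc κ * (‖e'‖ + δ) ≤ δ / 2 / (‖e'‖ + δ) * (‖e'‖ + δ) := by
            gcongr; exact min_le_right _ _
        _ = δ / 2 := by field_simp
    refine ⟨Metric.ball x₀ (δ / 2), Metric.ball_mem_nhds _ (by positivity), κ • e', κ * δ / 2,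
      by positivity, fun x hx z hz s hs => ?_⟩
    set z' := κ⁻¹ • z with hz'
    have hzz : z = κ • z' := by rw [hz', smul_smul, mul_inv_cancel₀ hκ0.ne', one_smul]
    have hzB : z' ∈ Metric.ball e' δ := by
      rw [mem_ball_iff_norm] at hz ⊢
      rw [hzz, ← smul_sub, norm_smul, Real.norm_of_nonneg hκ0.le] at hz
      have : κ * ‖z' - e'‖ < κ * δ := by linarith
      exact lt_of_mul_lt_mul_left this hκ0.le
    have hnz : ‖z‖ ≤ δ / 2 := by
      rw [mem_ball_iff_norm] at hzB
      rw [hzz, norm_smul, Real.norm_of_nonneg hκ0.le]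
      refine le_trans ?_ hκ1
      gcongr
      calc ‖z'‖ = ‖e' + (z' - e')‖ := by congr 1; abel
        _ ≤ ‖e'‖ + ‖z' - e'‖ := norm_add_le _ _
        _ ≤ _ := by linarith
    have hseg : ∀ t ∈ Set.Icc (0 : ℝ) 1, x + t • z ∈ Metric.ball x₀ δ := fun t ht => by
      have h1 := hx.2
      rw [mem_ball_iff_norm] at h1 ⊢
      calc ‖x + t • z - x₀‖ = ‖(x - x₀) + t • z‖ := by congr 1; abel
        _ ≤ ‖x - x₀‖ + ‖t • z‖ := norm_add_le _ _
        _ ≤ ‖x - x₀‖ + 1 * ‖z‖ := by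
          rw [norm_smul, Real.norm_of_nonneg ht.1]
          have := mul_le_mul_of_nonneg_right ht.2 (norm_nonneg z)
          linarith
        _ < δ := by linarith
    have hder : ∀ t : ℝ, HasDerivAt (fun t : ℝ => ρ (x + t • z)) (fderiv ℝ ρ (x + t • z) z) t :=
      fun t => by
        have h1 : HasDerivAt (fun t : ℝ => x + t • z) z t := by
          simpa using ((hasDerivAt_id t).smul_const z).const_add x
        exact ((hρ.differentiable (by simp)) (x + t • z)).hasFDerivAt.comp_hasDerivAt t h1
    -- ρ is negative at x and decreases along the segment, so the segment cannot leave Ω.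
    have hanti : AntitoneOn (fun t : ℝ => ρ (x + t • z)) (Set.Icc 0 1) := by
      refine antitoneOn_of_deriv_nonpos (convex_Icc 0 1)
        (fun t _ => (hder t).continuousAt.continuousWithinAt)
        (fun t _ => (hder t).differentiableAt.differentiableWithinAt) fun t ht => ?_
      rw [interior_Icc] at ht
      rw [(hder t).deriv, hzz, map_smul, ← hzz, smul_eq_mul]
      have := (hB' _ (hseg t ⟨ht.1.le, ht.2.le⟩) z' hzB).2
      exact mul_nonpos_of_nonneg_of_nonpos hκ0.le this.le
    have hxU : x ∈ U := (hB' x (by simpa using hseg 0 (by simp)) z' hzB).1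
    have hρx : ρ x < 0 := (hΩU.subset ⟨hx.1, hxU⟩).2
    have h1 : ρ (x + s • z) ≤ ρ x := by
      simpa using hanti (Set.left_mem_Icc.2 zero_le_one) hs hs.1
    exact (hΩU.superset ⟨(hB' _ (hseg s hs) z' hzB).1, h1.trans_lt hρx⟩).1

end Cone

/-! ### Real-valued `L^p` integrals and completeness -/

section LpReal

variable {X F : Type*} [MeasurableSpace X] [NormedAddCommGroup F] {μ : Measure X} {p : ℝ}

theorem lintegral_enorm_rpow_eq (hp : 1 < p) {f : X → F} (h : MemLp f (ENNReal.ofReal p) μ) :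
    ∫⁻ x, ‖f x‖ₑ ^ p ∂μ = ENNReal.ofReal (∫ x, ‖f x‖ ^ p ∂μ) := by
  rw [ofReal_integral_eq_lintegral_ofReal (h.integrable_rpow hp)
    (Eventually.of_forall fun x => Real.rpow_nonneg (norm_nonneg _) _)]
  refine lintegral_congr fun x => ?_
  rw [← ofReal_norm, ENNReal.ofReal_rpow_of_nonneg (norm_nonneg _) (by linarith)]

theorem exists_tendsto_of_cauchy [CompleteSpace F] (hp : 1 < p) {f : ℕ → X → F}
    (hf : ∀ n, MemLp (f n) (ENNReal.ofReal p) μ)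
    (hc : Tendsto (fun n : ℕ × ℕ => ∫ x, ‖f n.1 x - f n.2 x‖ ^ p ∂μ) atTop (𝓝 0)) :
    ∃ g, MemLp g (ENNReal.ofReal p) μ ∧
      Tendsto (fun n => eLpNorm (fun x => f n x - g x) (ENNReal.ofReal p) μ) atTop (𝓝 0) := by
  have : Fact (1 ≤ ENNReal.ofReal p) := ⟨one_le_ofReal_of_one_lt hp⟩
  have hc' := (tendsto_eLpNorm_zero_iff hp
    (f := fun (n : ℕ × ℕ) x => f n.1 x - f n.2 x) (fun n => (hf n.1).sub (hf n.2))).2 hc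
  have hcs : CauchySeq fun n => (hf n).toLp (f n) := by
    rw [cauchySeq_iff_tendsto_dist_atTop_0]
    have := (ENNReal.tendsto_toReal ENNReal.zero_ne_top).comp hc'
    refine this.congr fun n => ?_
    rw [dist_eq_norm, ← MemLp.toLp_sub, Lp.norm_toLp]
    rfl
  obtain ⟨g, hg⟩ := cauchySeq_tendsto_of_complete hcs
  refine ⟨g, Lp.memLp g, ?_⟩
  rw [Lp.tendsto_Lp_iff_tendsto_eLpNorm'] at hg
  refine hg.congr fun n => eLpNorm_congr_ae ?_
  filter_upwards [(hf n).coeFn_toLp] with x hx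
  simp [hx]

theorem add_rpow_le_mul_rpow_add_rpow {a b : ℝ} (ha : 0 ≤ a) (hb : 0 ≤ b) (hp : 1 ≤ p) :
    (a + b) ^ p ≤ 2 ^ (p - 1) * (a ^ p + b ^ p) := by
  lift a to NNReal using ha
  lift b to NNReal using hb
  exact_mod_cast NNReal.rpow_add_le_mul_rpow_add_rpow a b hp

theorem norm_sub_rpow_le {a b : F} (hp : 1 < p) :
    ‖a - b‖ ^ p ≤ 2 ^ (p - 1) * (‖a‖ ^ p + ‖b‖ ^ p) :=
  (Real.rpow_le_rpow (norm_nonneg _) (norm_sub_le a b) (by linarith)).trans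
    (add_rpow_le_mul_rpow_add_rpow (norm_nonneg _) (norm_nonneg _) hp.le)

end LpReal

/-! ### Ehrling's inequality on a cone patch -/

section Ehrling

variable {Ω : Set (E N)} {v : E N → ℝ} {G : E N → E N} {q : ℝ}

/-- |B| v(x) = ∫_B v − ∫_B (v − v(x)): the value at x is controlled by the average over any ball B,
not necessarily containing x, and by the oscillation relative to v(x). -/
theorem enorm_rpow_le_average (hq : 1 < q) (hv : Measurable v) {B : Set (E N)}
    (hB0 : volume B ≠ 0) (hBt : volume B ≠ ⊤) (hi : IntegrableOn v B) (x : E N) :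
    ‖v x‖ₑ ^ q ≤ 2 ^ (q - 1) * ((volume B)⁻¹ ^ q * ‖∫ y in B, v y‖ₑ ^ q +
      (volume B)⁻¹ * ∫⁻ y in B, ‖v y - v x‖ₑ ^ q) := by
  have hq0 : 0 < q := by linarith
  set κ := volume B with hκ
  set ν : Measure (E N) := κ⁻¹ • volume.restrict B with hν
  have : IsProbabilityMeasure ν := ⟨by
    simp only [hν, Measure.smul_apply, Measure.restrict_apply_univ, smul_eq_mul]
    exact ENNReal.inv_mul_cancel hB0 hBt⟩
  have hfin : IsFiniteMeasure (volume.restrict B) := ⟨by simpa using hBt.lt_top⟩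
  have h1 : ‖v x‖ₑ ≤ κ⁻¹ * ‖∫ y in B, v y‖ₑ + κ⁻¹ * ∫⁻ y in B, ‖v y - v x‖ₑ := by
    have e : (∫ y in B, v y) - ∫ y in B, (v y - v x) = κ.toReal * v x := by
      rw [integral_sub hi (integrable_const _)]
      simp [Measure.real, hκ]
    have e2 : κ * ‖v x‖ₑ ≤ ‖∫ y in B, v y‖ₑ + ∫⁻ y in B, ‖v y - v x‖ₑ := by
      calc κ * ‖v x‖ₑ = ‖(∫ y in B, v y) - ∫ y in B, (v y - v x)‖ₑ := by
            rw [e, enorm_mul, Real.enorm_of_nonneg ENNReal.toReal_nonneg, ENNReal.ofReal_toReal hBt]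
        _ ≤ ‖∫ y in B, v y‖ₑ + ‖∫ y in B, (v y - v x)‖ₑ := enorm_sub_le
        _ ≤ _ := by gcongr; exact enorm_integral_le_lintegral_enorm _
    calc ‖v x‖ₑ = κ⁻¹ * (κ * ‖v x‖ₑ) := by
          rw [← mul_assoc, ENNReal.inv_mul_cancel hB0 hBt, one_mul]
      _ ≤ κ⁻¹ * (‖∫ y in B, v y‖ₑ + ∫⁻ y in B, ‖v y - v x‖ₑ) := mul_le_mul_right e2 _
      _ = _ := mul_add _ _ _
  have m : Measurable fun y => ‖v y - v x‖ₑ := (hv.sub_const _).enorm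
  have h2 : (κ⁻¹ * ∫⁻ y in B, ‖v y - v x‖ₑ) ^ q ≤ κ⁻¹ * ∫⁻ y in B, ‖v y - v x‖ₑ ^ q := by
    have := rpow_lintegral_le_lintegral_rpow (ν := ν) hq m.aemeasurable
    simpa [hν, lintegral_smul_measure] using this
  calc ‖v x‖ₑ ^ q ≤ (κ⁻¹ * ‖∫ y in B, v y‖ₑ + κ⁻¹ * ∫⁻ y in B, ‖v y - v x‖ₑ) ^ q :=
        ENNReal.rpow_le_rpow h1 hq0.le
    _ ≤ 2 ^ (q - 1) * ((κ⁻¹ * ‖∫ y in B, v y‖ₑ) ^ q + (κ⁻¹ * ∫⁻ y in B, ‖v y - v x‖ₑ) ^ q) :=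
        ENNReal.rpow_add_le_mul_rpow_add_rpow _ _ hq.le
    _ ≤ _ := by
        rw [ENNReal.mul_rpow_of_nonneg _ _ hq0.le]
        gcongr

/-- Ehrling-type inequality on a patch satisfying a cone condition, measurable version. -/
theorem ehrling_patch (hq : 1 < q) (hΩ : IsOpen Ω) (hb : Bornology.IsBounded Ω) {V : Set (E N)}
    {e : E N} {r : ℝ} (hr : 0 < r) (hcone : ∀ x ∈ Ω ∩ V,
      ∀ z ∈ Metric.ball e (2 * r), ∀ s ∈ Set.Icc (0 : ℝ) 1, x + s • z ∈ Ω) {ε : ℝ} (hε : 0 < ε) :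
    ∃ (T : Finset (Set (E N))) (C : ℝ≥0∞), C ≠ ⊤ ∧ (∀ B ∈ T, B ⊆ Ω) ∧
      ∀ (v : E N → ℝ) (G : E N → E N), Measurable v → IsWeakGradient Ω v G → IntegrableOn v Ω →
        ∫⁻ x in Ω ∩ V, ‖v x‖ₑ ^ q ≤
          C * ∑ B ∈ T, ‖∫ y in B, v y‖ₑ ^ q + ENNReal.ofReal ε * ∫⁻ x in Ω, ‖G x‖ₑ ^ q := by
  classical
  have hq0 : 0 < q := by linarith
  set D := ‖e‖ + 2 * r with hD
  have hD0 : 0 < D := by positivity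
  -- The scale s makes the oscillation term small: translations sz along the cone have length at
  -- most sD, 2^N is the volume ratio of balls of radii 2R and R, and 2^(q−1) comes from splitting
  -- the q-th power.
  obtain ⟨s, hs0, hs1, hsε⟩ : ∃ s : ℝ, 0 < s ∧ s ≤ 1 ∧
      2 ^ (q - 1) * 2 ^ N * (s * D) ^ q ≤ ε := by
    have hc : Tendsto (fun s : ℝ => 2 ^ (q - 1) * 2 ^ N * (s * D) ^ q) (𝓝[>] 0) (𝓝 0) := by
      have : Continuous fun s : ℝ => (2 : ℝ) ^ (q - 1) * 2 ^ N * (s * D) ^ q :=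
        continuous_const.mul ((continuous_id.mul continuous_const).rpow_const
          fun _ => Or.inr hq0.le)
      have h0 := this.tendsto 0
      simp only [zero_mul, Real.zero_rpow hq0.ne', mul_zero] at h0
      exact h0.mono_left nhdsWithin_le_nhds
    have h2 : ∀ᶠ s : ℝ in 𝓝[>] 0, s ∈ Set.Ioc (0 : ℝ) 1 := Ioc_mem_nhdsGT zero_lt_one
    obtain ⟨s, h1, h2⟩ := ((hc.eventually (ge_mem_nhds hε)).and h2).exists
    exact ⟨s, h2.1, h2.2, h1⟩
  set R := s * r with hR
  have hR0 : 0 < R := mul_pos hs0 hr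
  have hAb : TotallyBounded (Ω ∩ V) :=
    (hb.subset Set.inter_subset_left).isCompact_closure.totallyBounded.subset subset_closure
  obtain ⟨t, htA, htf, htc⟩ := hAb.exists_subset (Metric.dist_mem_uniformity hR0)
  set κ := volume (Metric.ball (0 : E N) R) with hκ
  have hκB : ∀ y : E N, volume (Metric.ball y R) = κ := fun y => Measure.addHaar_ball_center _ _ _
  have hκ0 : κ ≠ 0 := (Metric.measure_ball_pos _ _ hR0).ne'
  have hκt : κ ≠ ⊤ := measure_ball_lt_top.ne
  -- One test ball for each point y of a finite R-net of Ω ∩ V, pushed into Ω along the cone. For x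
  -- within R of y it lies in x + B(se, 2R), hence in the cone at x.
  set T : Finset (Set (E N)) := htf.toFinset.image fun y => Metric.ball (y + s • e) R with hT
  have hmem : ∀ {x y : E N}, dist x y < R → ∀ k ∈ Metric.ball (y + s • e) R,
      k - x ∈ Metric.ball (s • e) (2 * R) := fun {x y} hxy k hk => by
    rw [mem_ball_iff_norm] at hk ⊢
    rw [dist_eq_norm, norm_sub_rev] at hxy
    calc ‖k - x - s • e‖ = ‖(k - (y + s • e)) + (y - x)‖ := by congr 1; abel
      _ ≤ ‖k - (y + s • e)‖ + ‖y - x‖ := norm_add_le _ _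
      _ < 2 * R := by linarith
  have hball : ∀ k ∈ Metric.ball (s • e) (2 * R), ∃ z ∈ Metric.ball e (2 * r), k = s • z :=
    fun k hk => by
      refine ⟨s⁻¹ • k, ?_, by rw [smul_smul, mul_inv_cancel₀ hs0.ne', one_smul]⟩
      rw [mem_ball_iff_norm] at hk ⊢
      have : k - s • e = s • (s⁻¹ • k - e) := by
        rw [smul_sub, smul_smul, mul_inv_cancel₀ hs0.ne', one_smul]
      rw [this, norm_smul, Real.norm_of_nonneg hs0.le] at hk
      have : s * ‖s⁻¹ • k - e‖ < s * (2 * r) := by rw [hR] at hk; linarith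
      exact lt_of_mul_lt_mul_left this hs0.le
  have hTΩ : ∀ B ∈ T, B ⊆ Ω := by
    intro B hB k hk
    simp only [hT, Finset.mem_image, Set.Finite.mem_toFinset] at hB
    obtain ⟨y, hy, rfl⟩ := hB
    obtain ⟨z, hz, hkz⟩ := hball (k - y) (hmem (x := y) (y := y) (by simpa using hR0) k hk)
    have := hcone y (htA hy) z hz s ⟨hs0.le, hs1⟩
    rwa [← hkz, add_sub_cancel] at this
  refine ⟨T, 2 ^ (q - 1) * κ⁻¹ ^ q * volume Ω, ?_, hTΩ, fun v G hv hw hvi => ?_⟩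
  · refine ENNReal.mul_ne_top (ENNReal.mul_ne_top (ENNReal.rpow_ne_top_of_nonneg (by linarith)
      (by simp)) (ENNReal.rpow_ne_top_of_nonneg hq0.le (ENNReal.inv_ne_top.2 hκ0)))
      hb.measure_lt_top.ne
  have mK : MeasurableSet (Metric.ball (s • e) (2 * R)) := measurableSet_ball
  have hpt : ∀ x ∈ Ω ∩ V, ‖v x‖ₑ ^ q ≤ 2 ^ (q - 1) * κ⁻¹ ^ q * ∑ B ∈ T, ‖∫ y in B, v y‖ₑ ^ q +
      2 ^ (q - 1) * κ⁻¹ * ∫⁻ k in Metric.ball (s • e) (2 * R), ‖v (x + k) - v x‖ₑ ^ q := by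
    intro x hx
    obtain ⟨y, hy, hxy⟩ := Set.mem_iUnion₂.1 (htc hx)
    have hBT : Metric.ball (y + s • e) R ∈ T :=
      Finset.mem_image_of_mem _ (htf.mem_toFinset.2 hy)
    have h := enorm_rpow_le_average hq hv (B := Metric.ball (y + s • e) R)
      (by rwa [hκB]) (by rwa [hκB]) (hvi.mono_set (hTΩ _ hBT)) x
    rw [hκB, mul_add, ← mul_assoc, ← mul_assoc] at h
    refine h.trans (add_le_add (mul_le_mul_right (Finset.single_le_sum
      (f := fun B => ‖∫ y in B, v y‖ₑ ^ q) (fun _ _ => zero_le) hBT) _) (mul_le_mul_right ?_ _))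
    have := setLIntegral_translate_le (K := Metric.ball (y + s • e) R) (k := -x)
      measurableSet_ball mK (fun k hk => by
        rw [← sub_eq_add_neg]; exact hmem hxy k hk) fun k => ‖v (x + k) - v x‖ₑ ^ q
    refine le_trans (le_of_eq (lintegral_congr fun k => ?_)) this
    simp
  have mvv : Measurable fun z : E N × E N => ‖v (z.1 + z.2) - v z.1‖ₑ ^ q :=
    ((hv.comp (measurable_fst.add measurable_snd)).sub (hv.comp measurable_fst)).enorm.pow_const _
  have hvol : volume (Metric.ball (s • e) (2 * R)) = 2 ^ N * κ := by
    rw [Measure.addHaar_ball_mul_of_pos _ _ (by norm_num : (0 : ℝ) < 2)]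
    simp [hκ]
  -- Every offset k is sz with z in the cone, so the whole segment from x to x + k lies in Ω and the
  -- translation estimate applies.
  have hkbd : ∀ k ∈ Metric.ball (s • e) (2 * R),
      ∫⁻ x in Ω ∩ V, ‖v (x + k) - v x‖ₑ ^ q ≤
        ENNReal.ofReal ((s * D) ^ q) * ∫⁻ x in Ω, ‖G x‖ₑ ^ q := fun k hk => by
    obtain ⟨z, hz, rfl⟩ := hball k hk
    refine (hw.lintegral_translate_le hΩ hq (s • z) fun x hx σ hσ => ?_).trans
      (mul_le_mul_left ?_ _)
    · rw [smul_smul]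
      exact hcone x hx z hz _ ⟨mul_nonneg hσ.1 hs0.le, mul_le_one₀ hσ.2 hs0.le hs1⟩
    · rw [← ofReal_norm, ENNReal.ofReal_rpow_of_nonneg (norm_nonneg _) hq0.le]
      refine ENNReal.ofReal_le_ofReal (Real.rpow_le_rpow (norm_nonneg _) ?_ hq0.le)
      rw [norm_smul, Real.norm_of_nonneg hs0.le]
      refine mul_le_mul_of_nonneg_left ?_ hs0.le
      rw [mem_ball_iff_norm] at hz
      calc ‖z‖ = ‖e + (z - e)‖ := by congr 1; abel
        _ ≤ ‖e‖ + ‖z - e‖ := norm_add_le _ _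
        _ ≤ D := by rw [hD]; linarith
  set S := ∑ B ∈ T, ‖∫ y in B, v y‖ₑ ^ q
  set I := ∫⁻ x in Ω, ‖G x‖ₑ ^ q
  have mlp : Measurable fun x => ∫⁻ k in Metric.ball (s • e) (2 * R), ‖v (x + k) - v x‖ₑ ^ q :=
    Measurable.lintegral_prod_right' mvv
  calc ∫⁻ x in Ω ∩ V, ‖v x‖ₑ ^ q
      ≤ ∫⁻ x in Ω ∩ V, (2 ^ (q - 1) * κ⁻¹ ^ q * S +
        2 ^ (q - 1) * κ⁻¹ * ∫⁻ k in Metric.ball (s • e) (2 * R), ‖v (x + k) - v x‖ₑ ^ q) :=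
        setLIntegral_mono (measurable_const.add (mlp.const_mul _)) hpt
    _ = 2 ^ (q - 1) * κ⁻¹ ^ q * S * volume (Ω ∩ V) + 2 ^ (q - 1) * κ⁻¹ *
        ∫⁻ k in Metric.ball (s • e) (2 * R), (∫⁻ x in Ω ∩ V, ‖v (x + k) - v x‖ₑ ^ q) := by
        rw [lintegral_add_left measurable_const, lintegral_const_mul _ mlp, lintegral_const,
          Measure.restrict_apply_univ, lintegral_lintegral_swap (by exact mvv.aemeasurable)]
    _ ≤ 2 ^ (q - 1) * κ⁻¹ ^ q * S * volume Ω + 2 ^ (q - 1) * κ⁻¹ *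
        ∫⁻ _k in Metric.ball (s • e) (2 * R), (ENNReal.ofReal ((s * D) ^ q) * I) := by
        refine add_le_add (mul_le_mul_right (measure_mono Set.inter_subset_left) _)
          (mul_le_mul_right (setLIntegral_mono measurable_const hkbd) _)
    _ = 2 ^ (q - 1) * κ⁻¹ ^ q * volume Ω * S +
        2 ^ (q - 1) * 2 ^ N * ENNReal.ofReal ((s * D) ^ q) * (κ⁻¹ * κ) * I := by
        rw [lintegral_const, Measure.restrict_apply_univ, hvol]
        ring
    _ ≤ _ := by
        gcongr
        rw [ENNReal.inv_mul_cancel hκ0 hκt, mul_one]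
        refine le_trans (le_of_eq ?_) (ENNReal.ofReal_le_ofReal hsε)
        rw [ENNReal.ofReal_mul (by positivity), ENNReal.ofReal_mul (by positivity),
          ← ENNReal.ofReal_rpow_of_pos (x := 2) (by norm_num), ENNReal.ofReal_pow (by norm_num)]
        simp

end Ehrling

/-! ### Ehrling's inequality on the domain and Rellich compactness -/

section Rellich

variable {Ω : Set (E N)} {v : E N → ℝ} {G : E N → E N} {q : ℝ}

theorem IsSmoothBoundedDomain.isFiniteMeasure (hΩ : IsSmoothBoundedDomain Ω) :
    IsFiniteMeasure (volume.restrict Ω) :=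
  ⟨by simpa using hΩ.isBounded.measure_lt_top⟩

/-- Compact induction on the closure of Ω: cone patches give the local statement, and a union of two
sets is handled by taking ε/2 on each and merging the families of test balls. -/
theorem ehrling_lintegral (hq : 1 < q) (hΩ : IsSmoothBoundedDomain Ω) {ε : ℝ} (hε : 0 < ε) :
    ∃ (T : Finset (Set (E N))) (C : ℝ≥0∞), C ≠ ⊤ ∧ (∀ B ∈ T, B ⊆ Ω) ∧
      ∀ (v : E N → ℝ) (G : E N → E N), Measurable v → IsWeakGradient Ω v G → IntegrableOn v Ω →
        ∫⁻ x in Ω, ‖v x‖ₑ ^ q ≤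
          C * ∑ B ∈ T, ‖∫ y in B, v y‖ₑ ^ q + ENNReal.ofReal ε * ∫⁻ x in Ω, ‖G x‖ₑ ^ q := by
  classical
  have key : ∀ ε : ℝ, 0 < ε → ∃ (T : Finset (Set (E N))) (C : ℝ≥0∞), C ≠ ⊤ ∧ (∀ B ∈ T, B ⊆ Ω) ∧
      ∀ (v : E N → ℝ) (G : E N → E N), Measurable v → IsWeakGradient Ω v G → IntegrableOn v Ω →
        ∫⁻ x in Ω ∩ closure Ω, ‖v x‖ₑ ^ q ≤
          C * ∑ B ∈ T, ‖∫ y in B, v y‖ₑ ^ q + ENNReal.ofReal ε * ∫⁻ x in Ω, ‖G x‖ₑ ^ q := by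
    refine hΩ.isBounded.isCompact_closure.induction_on
      (p := fun S => ∀ ε : ℝ, 0 < ε → ∃ (T : Finset (Set (E N))) (C : ℝ≥0∞), C ≠ ⊤ ∧
        (∀ B ∈ T, B ⊆ Ω) ∧ ∀ (v : E N → ℝ) (G : E N → E N), Measurable v → IsWeakGradient Ω v G →
          IntegrableOn v Ω → ∫⁻ x in Ω ∩ S, ‖v x‖ₑ ^ q ≤
            C * ∑ B ∈ T, ‖∫ y in B, v y‖ₑ ^ q + ENNReal.ofReal ε * ∫⁻ x in Ω, ‖G x‖ₑ ^ q)
      ?_ ?_ ?_ ?_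
    · exact fun ε _ => ⟨∅, 0, by simp, by simp, by simp⟩
    · intro s t hst ht ε hε
      obtain ⟨T, C, hC, hT, h⟩ := ht ε hε
      exact ⟨T, C, hC, hT, fun v G h1 h2 h3 =>
        (lintegral_mono_set (Set.inter_subset_inter_right _ hst)).trans (h v G h1 h2 h3)⟩
    · intro s t hs ht ε hε
      obtain ⟨T, C, hC, hT, h⟩ := hs (ε / 2) (half_pos hε)
      obtain ⟨T', C', hC', hT', h'⟩ := ht (ε / 2) (half_pos hε)
      refine ⟨T ∪ T', C + C', ENNReal.add_ne_top.2 ⟨hC, hC'⟩, fun B hB => ?_,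
        fun v G h1 h2 h3 => ?_⟩
      · rcases Finset.mem_union.1 hB with hB | hB
        exacts [hT B hB, hT' B hB]
      · rw [Set.inter_union_distrib_left]
        refine (lintegral_union_le _ _ _).trans
          ((add_le_add (h v G h1 h2 h3) (h' v G h1 h2 h3)).trans ?_)
        have l1 : ∑ B ∈ T, ‖∫ y in B, v y‖ₑ ^ q ≤ ∑ B ∈ T ∪ T', ‖∫ y in B, v y‖ₑ ^ q :=
          Finset.sum_le_sum_of_subset Finset.subset_union_left
        have l2 : ∑ B ∈ T', ‖∫ y in B, v y‖ₑ ^ q ≤ ∑ B ∈ T ∪ T', ‖∫ y in B, v y‖ₑ ^ q :=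
          Finset.sum_le_sum_of_subset Finset.subset_union_right
        have l3 : ENNReal.ofReal ε = ENNReal.ofReal (ε / 2) + ENNReal.ofReal (ε / 2) := by
          rw [← ENNReal.ofReal_add (by positivity) (by positivity), add_halves]
        calc _ ≤ (C * ∑ B ∈ T ∪ T', ‖∫ y in B, v y‖ₑ ^ q
              + ENNReal.ofReal (ε / 2) * ∫⁻ x in Ω, ‖G x‖ₑ ^ q) +
              (C' * ∑ B ∈ T ∪ T', ‖∫ y in B, v y‖ₑ ^ q
              + ENNReal.ofReal (ε / 2) * ∫⁻ x in Ω, ‖G x‖ₑ ^ q) := by gcongr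
          _ = _ := by rw [l3]; ring
    · intro x hx
      obtain ⟨V, hV, e, r, hr, hcone⟩ := hΩ.exists_cone hx
      exact ⟨V, mem_nhdsWithin_of_mem_nhds hV, fun ε hε =>
        ehrling_patch hq hΩ.isOpen hΩ.isBounded hr hcone hε⟩
  obtain ⟨T, C, hC, hT, h⟩ := key ε hε
  rw [Set.inter_eq_left.2 subset_closure] at h
  exact ⟨T, C, hC, hT, h⟩

/-- Ehrling-type inequality: the `L^q` norm is controlled by finitely many integrals up to a small
multiple of the norm of the gradient. -/
theorem ehrling (hq : 1 < q) (hΩ : IsSmoothBoundedDomain Ω) {ε : ℝ} (hε : 0 < ε) :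
    ∃ (T : Finset (Set (E N))) (C : ℝ), 0 ≤ C ∧ (∀ B ∈ T, B ⊆ Ω) ∧
      ∀ (v : E N → ℝ) (G : E N → E N), HasW1 Ω q v G →
        ∫ x in Ω, ‖v x‖ ^ q ≤ C * ∑ B ∈ T, ‖∫ y in B, v y‖ ^ q + ε * ∫ x in Ω, ‖G x‖ ^ q := by
  have hq0 : 0 < q := by linarith
  have := hΩ.isFiniteMeasure
  obtain ⟨T, C, hC, hT, h⟩ := ehrling_lintegral hq hΩ hε
  refine ⟨T, C.toReal, ENNReal.toReal_nonneg, hT, fun v G hw => ?_⟩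
  set v' := hw.memLp.1.mk v
  have hvv : v =ᵐ[volume.restrict Ω] v' := hw.memLp.1.ae_eq_mk
  have hw' : HasW1 Ω q v' G := hw.congr hvv (EventuallyEq.refl _ _)
  have key := h v' G hw.memLp.1.stronglyMeasurable_mk.measurable hw'.grad
    (hw'.memLp.integrable (one_le_ofReal_of_one_lt hq))
  have e1 : ∫ x in Ω, ‖v x‖ ^ q = ∫ x in Ω, ‖v' x‖ ^ q :=
    integral_congr_ae (by filter_upwards [hvv] with x hx; rw [hx])
  have e2 : ∀ B ∈ T, ∫ x in B, v x = ∫ x in B, v' x := fun B hB =>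
    integral_congr_ae (ae_restrict_of_ae_restrict_of_subset (hT B hB) hvv)
  rw [e1, Finset.sum_congr rfl fun B hB => by rw [e2 B hB]]
  rw [lintegral_enorm_rpow_eq hq hw'.memLp, lintegral_enorm_rpow_eq hq hw'.memLp_grad] at key
  have e3 : ∑ B ∈ T, ‖∫ y in B, v' y‖ₑ ^ q =
      ENNReal.ofReal (∑ B ∈ T, ‖∫ y in B, v' y‖ ^ q) := by
    rw [ENNReal.ofReal_sum_of_nonneg fun _ _ => Real.rpow_nonneg (norm_nonneg _) _]
    refine Finset.sum_congr rfl fun B _ => ?_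
    rw [← ofReal_norm, ENNReal.ofReal_rpow_of_nonneg (norm_nonneg _) hq0.le]
  have hs : 0 ≤ ∑ B ∈ T, ‖∫ y in B, v' y‖ ^ q :=
    Finset.sum_nonneg fun _ _ => Real.rpow_nonneg (norm_nonneg _) _
  rw [e3, ← ENNReal.ofReal_toReal hC, ← ENNReal.ofReal_mul ENNReal.toReal_nonneg,
    ← ENNReal.ofReal_mul hε.le, ← ENNReal.ofReal_add (by positivity)
      (mul_nonneg hε.le (integral_rpow_nonneg _))] at key
  exact (ENNReal.ofReal_le_ofReal_iff (add_nonneg (by positivity)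
    (mul_nonneg hε.le (integral_rpow_nonneg _)))).1 key

/-- Rellich's compactness theorem. -/
theorem rellich (hq : 1 < q) (hΩ : IsSmoothBoundedDomain Ω) {f : ℕ → E N → ℝ} {g : ℕ → E N → E N}
    (hf : ∀ n, HasW1 Ω q (f n) (g n)) {M : ℝ} (hfM : ∀ n, ∫ x in Ω, ‖f n x‖ ^ q ≤ M)
    (hgM : ∀ n, ∫ x in Ω, ‖g n x‖ ^ q ≤ M) :
    ∃ (ns : ℕ → ℕ) (v : E N → ℝ), StrictMono ns ∧ MemLp v (ENNReal.ofReal q) (volume.restrict Ω) ∧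
      Tendsto (fun n => eLpNorm (fun x => f (ns n) x - v x) (ENNReal.ofReal q) (volume.restrict Ω))
        atTop (𝓝 0) := by
  have hq0 : 0 < q := by linarith
  have := hΩ.isFiniteMeasure
  have hε : ∀ k : ℕ, (0 : ℝ) < 1 / (k + 1) := fun k => by positivity
  choose T C hC hT hE using fun k : ℕ => ehrling hq hΩ (hε k)
  have hfi : ∀ n, Integrable (f n) (volume.restrict Ω) := fun n =>
    (hf n).memLp.integrable (one_le_ofReal_of_one_lt hq)
  set M' := volume.real Ω + M
  have hM' : ∀ n, ∀ B ⊆ Ω, ‖∫ x in B, f n x‖ ≤ M' := fun n B hB => by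
    calc ‖∫ x in B, f n x‖ ≤ ∫ x in B, ‖f n x‖ := norm_integral_le_integral_norm _
      _ ≤ ∫ x in Ω, ‖f n x‖ := setIntegral_mono_set (hfi n).norm
          (Eventually.of_forall fun _ => norm_nonneg _) (LE.le.eventuallyLE hB)
      _ ≤ ∫ x in Ω, (1 + ‖f n x‖ ^ q) := by
          refine integral_mono (hfi n).norm ((integrable_const _).add
            ((hf n).memLp.integrable_rpow hq)) fun x => ?_
          rcases le_total (‖f n x‖) 1 with h | h
          · have := Real.rpow_nonneg (norm_nonneg (f n x)) q
            simp only; linarith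
          · have := Real.self_le_rpow_of_one_le h hq.le
            simp only; linarith
      _ ≤ M' := by
          rw [integral_add (integrable_const _) ((hf n).memLp.integrable_rpow hq)]
          simpa [M'] using hfM n
  -- The integrals over all test sets, for every ε = 1/(k+1), form one bounded sequence in a
  -- countable product of intervals; a single subsequence makes all of them converge.
  set a : ℕ → (Σ k, ↥(T k)) → ℝ := fun n i => ∫ x in (i.2 : Set (E N)), f n x with ha
  obtain ⟨b, -, ns, hns, hlim⟩ := (isCompact_univ_pi fun _ : (Σ k, ↥(T k)) =>
    isCompact_Icc (a := -M') (b := M')).tendsto_subseq (x := a) fun n i _ =>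
      abs_le.1 (hM' n _ (hT _ _ i.2.2))
  rw [tendsto_pi_nhds] at hlim
  obtain ⟨v, hv, hv'⟩ := exists_tendsto_of_cauchy hq (fun n => (hf (ns n)).memLp) (by
    rw [Metric.tendsto_nhds]
    intro δ hδ
    set K := 2 ^ (q - 1) * (M + M) with hK
    have hgK : ∀ n m, ∫ x in Ω, ‖g n x - g m x‖ ^ q ≤ K := fun n m => by
      calc ∫ x in Ω, ‖g n x - g m x‖ ^ q
          ≤ ∫ x in Ω, 2 ^ (q - 1) * (‖g n x‖ ^ q + ‖g m x‖ ^ q) := by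
            refine integral_mono (((hf n).memLp_grad.sub (hf m).memLp_grad).integrable_rpow hq)
              ((((hf n).memLp_grad.integrable_rpow hq).add
                ((hf m).memLp_grad.integrable_rpow hq)).const_mul _) fun x => norm_sub_rpow_le hq
        _ = 2 ^ (q - 1) * ((∫ x in Ω, ‖g n x‖ ^ q) + ∫ x in Ω, ‖g m x‖ ^ q) := by
            rw [integral_const_mul, integral_add ((hf n).memLp_grad.integrable_rpow hq)
              ((hf m).memLp_grad.integrable_rpow hq)]
        _ ≤ K := by rw [hK]; gcongr <;> exact hgM _
    have hK0 : 0 ≤ K := (integral_rpow_nonneg _).trans (hgK 0 0)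
    -- This k makes the gradient term of Ehrling's inequality less than δ/2; the finitely many
    -- integrals belonging to k are then Cauchy.
    obtain ⟨k, hk⟩ : ∃ k : ℕ, 1 / ((k : ℝ) + 1) * K < δ / 2 := by
      have := (tendsto_one_div_add_atTop_nhds_zero_nat (𝕜 := ℝ)).mul_const K
      rw [zero_mul] at this
      exact (this.eventually (gt_mem_nhds (half_pos hδ))).exists
    have hsum : Tendsto (fun n : ℕ × ℕ => C k * ∑ B ∈ T k,
        ‖(∫ y in B, f (ns n.1) y) - ∫ y in B, f (ns n.2) y‖ ^ q) atTop (𝓝 0) := by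
      rw [← prod_atTop_atTop_eq]
      have : Tendsto (fun n : ℕ × ℕ => C k * ∑ B ∈ (T k).attach,
        ‖(∫ y in (B : Set (E N)), f (ns n.1) y) - ∫ y in (B : Set (E N)), f (ns n.2) y‖ ^ q)
          (atTop ×ˢ atTop) (𝓝 (C k * ∑ B ∈ (T k).attach, ‖b ⟨k, B⟩ - b ⟨k, B⟩‖ ^ q)) := by
        refine (tendsto_finsetSum _ fun B _ => ?_).const_mul _
        refine Tendsto.rpow_const (Tendsto.norm (Tendsto.sub ?_ ?_)) (Or.inr hq0.le)
        · exact (hlim ⟨k, B⟩).comp tendsto_fst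
        · exact (hlim ⟨k, B⟩).comp tendsto_snd
      simp only [sub_self, norm_zero, Real.zero_rpow hq0.ne', Finset.sum_const_zero,
        mul_zero] at this
      refine this.congr fun n => ?_
      rw [Finset.sum_attach (T k) fun B =>
        ‖(∫ y in B, f (ns n.1) y) - ∫ y in B, f (ns n.2) y‖ ^ q]
    filter_upwards [hsum.eventually (gt_mem_nhds (half_pos hδ))] with n hn
    rw [Real.dist_0_eq_abs, abs_of_nonneg (integral_rpow_nonneg _)]
    have h1 := hE k _ _ ((hf (ns n.1)).sub (hf (ns n.2)))
    have h2 : ∑ B ∈ T k, ‖∫ y in B, (f (ns n.1) y - f (ns n.2) y)‖ ^ q = ∑ B ∈ T k,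
        ‖(∫ y in B, f (ns n.1) y) - ∫ y in B, f (ns n.2) y‖ ^ q := by
      refine Finset.sum_congr rfl fun B hB => ?_
      rw [integral_sub (IntegrableOn.mono_set (hfi _) (hT k B hB))
        (IntegrableOn.mono_set (hfi _) (hT k B hB))]
    rw [h2] at h1
    have h3 := mul_le_mul_of_nonneg_left (hgK (ns n.1) (ns n.2)) (hε k).le
    linarith)
  exact ⟨ns, v, hns, hv, hv'⟩

end Rellich

/-! ### Poincaré inequalities -/

section Poincare

variable {Ω : Set (E N)} {u : E N → ℝ} {G : E N → E N} {p q : ℝ}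

/-- If x + h is outside Ω then φ(x + h) = 0, so the translation estimate on the whole space already
bounds φ itself by its gradient. -/
theorem IsTestFunction.poincare (hp : 1 < p) {φ : E N → ℝ} (hφ : IsTestFunction Ω φ)
    (hΩ : MeasurableSet Ω) {h : E N} (hh : ∀ x ∈ Ω, x + h ∉ Ω) :
    ∫⁻ x in Ω, ‖φ x‖ₑ ^ p ≤ ‖h‖ₑ ^ p * ∫⁻ x in Ω, ‖gradient φ x‖ₑ ^ p := by
  have hp0 : 0 < p := by linarith
  have h1 := (isWeakGradient_of_contDiff (Ω := Set.univ) hφ.1).lintegral_translate_le isOpen_univ hp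
    h (A := Ω) (fun x _ σ _ => Set.mem_univ _)
  have h2 : ∫⁻ x in Set.univ, ‖gradient φ x‖ₑ ^ p = ∫⁻ x in Ω, ‖gradient φ x‖ₑ ^ p := by
    rw [Measure.restrict_univ, ← lintegral_indicator hΩ]
    refine lintegral_congr fun x => ?_
    by_cases hx : x ∈ Ω
    · simp [hx]
    · simp [hx, hφ.gradient_eq_zero_of_notMem hx, hp0]
  rw [h2] at h1
  refine le_trans (le_of_eq (setLIntegral_congr_fun hΩ fun x hx => ?_)) h1
  simp [hφ.eq_zero_of_notMem (hh x hx)]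

theorem exists_translate_disjoint (hN : 1 ≤ N) (hb : Bornology.IsBounded Ω) :
    ∃ h : E N, ∀ x ∈ Ω, x + h ∉ Ω := by
  obtain ⟨R, hR⟩ := hb.subset_ball 0
  refine ⟨(2 * |R|) • EuclideanSpace.single ⟨0, hN⟩ (1 : ℝ), fun x hx hx' => ?_⟩
  have h1 := hR hx
  have h2 := hR hx'
  rw [mem_ball_zero_iff] at h1 h2
  have h3 : ‖(2 * |R|) • EuclideanSpace.single (⟨0, hN⟩ : Fin N) (1 : ℝ)‖ = 2 * |R| := by
    simp [norm_smul]
  have h4 := norm_sub_le (x + (2 * |R|) • EuclideanSpace.single (⟨0, hN⟩ : Fin N) (1 : ℝ)) x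
  rw [add_sub_cancel_left, h3] at h4
  have := le_abs_self R
  linarith

/-- Poincaré's inequality in `W_0^{1,p}`. -/
theorem poincare_zero (hN : 1 ≤ N) (hp : 1 < p) (hΩ : IsSmoothBoundedDomain Ω) :
    ∃ C : ℝ, 0 ≤ C ∧ ∀ (u : E N → ℝ) (G : E N → E N), HasW0 Ω p u G →
      ∫ x in Ω, ‖u x‖ ^ p ≤ C * ∫ x in Ω, ‖G x‖ ^ p := by
  have hp0 : 0 < p := by linarith
  have := hΩ.isFiniteMeasure
  obtain ⟨h, hh⟩ := exists_translate_disjoint hN hΩ.isBounded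
  refine ⟨‖h‖ ^ p, by positivity, fun u G hu => ?_⟩
  obtain ⟨φ, hφ, hφu, hφG⟩ := hu.approx
  have he : ∀ {F : Type} [NormedAddCommGroup F] (f : E N → F), eLpNorm f (ENNReal.ofReal p)
      (volume.restrict Ω) = (∫⁻ x in Ω, ‖f x‖ₑ ^ p) ^ (1 / p) := fun f => by
    rw [eLpNorm_eq_lintegral_rpow_enorm_toReal (ofReal_ne_zero_of_one_lt hp) ENNReal.ofReal_ne_top,
      ENNReal.toReal_ofReal hp0.le]
  have key : ∀ n, eLpNorm u (ENNReal.ofReal p) (volume.restrict Ω) ≤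
      eLpNorm (fun x => u x - φ n x) (ENNReal.ofReal p) (volume.restrict Ω) + ‖h‖ₑ *
        (eLpNorm (fun x => G x - gradient (φ n) x) (ENNReal.ofReal p) (volume.restrict Ω) +
          eLpNorm G (ENNReal.ofReal p) (volume.restrict Ω)) := fun n => by
    have hw : HasW1 Ω p (φ n) (gradient (φ n)) := (hφ n).hasW1
    have h1 : eLpNorm (φ n) (ENNReal.ofReal p) (volume.restrict Ω) ≤
        ‖h‖ₑ * eLpNorm (gradient (φ n)) (ENNReal.ofReal p) (volume.restrict Ω) := by
      rw [he, he]
      calc _ ≤ (‖h‖ₑ ^ p * ∫⁻ x in Ω, ‖gradient (φ n) x‖ₑ ^ p) ^ (1 / p) :=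
            ENNReal.rpow_le_rpow ((hφ n).poincare hp hΩ.isOpen.measurableSet hh) (by positivity)
        _ = _ := by
            rw [ENNReal.mul_rpow_of_nonneg _ _ (by positivity), ← ENNReal.rpow_mul,
              mul_one_div_cancel hp0.ne', ENNReal.rpow_one]
    have h2 : eLpNorm u (ENNReal.ofReal p) (volume.restrict Ω) ≤ _ :=
      le_trans (le_of_eq (by congr 1; ext x; simp))
        (eLpNorm_add_le (hu.memLp.1.sub hw.memLp.1) hw.memLp.1 (one_le_ofReal_of_one_lt hp))
    have h3 : eLpNorm (gradient (φ n)) (ENNReal.ofReal p) (volume.restrict Ω) ≤ _ :=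
      le_trans (le_of_eq (by congr 1; ext1 x; simp))
        (eLpNorm_add_le (hw.memLp_grad.1.sub hu.memLp_grad.1) hu.memLp_grad.1
          (one_le_ofReal_of_one_lt hp))
    rw [eLpNorm_sub_comm] at h3
    exact h2.trans (add_le_add_right (h1.trans (mul_le_mul_right h3 _)) _)
  have hlim : Tendsto (fun n => eLpNorm (fun x => u x - φ n x) (ENNReal.ofReal p)
      (volume.restrict Ω) + ‖h‖ₑ *
        (eLpNorm (fun x => G x - gradient (φ n) x) (ENNReal.ofReal p) (volume.restrict Ω) +
          eLpNorm G (ENNReal.ofReal p) (volume.restrict Ω))) atTop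
      (𝓝 (0 + ‖h‖ₑ * (0 + eLpNorm G (ENNReal.ofReal p) (volume.restrict Ω)))) :=
    hφu.add (ENNReal.Tendsto.const_mul (hφG.add tendsto_const_nhds) (Or.inr enorm_ne_top))
  have hfin := ge_of_tendsto' hlim key
  rw [zero_add, zero_add, he, he] at hfin
  have hfin2 := ENNReal.rpow_le_rpow hfin hp0.le
  rw [ENNReal.mul_rpow_of_nonneg _ _ hp0.le, ← ENNReal.rpow_mul, ← ENNReal.rpow_mul,
    one_div_mul_cancel hp0.ne', ENNReal.rpow_one, ENNReal.rpow_one,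
    lintegral_enorm_rpow_eq hp hu.memLp, lintegral_enorm_rpow_eq hp hu.memLp_grad, ← ofReal_norm,
    ENNReal.ofReal_rpow_of_nonneg (norm_nonneg _) hp0.le,
    ← ENNReal.ofReal_mul (by positivity)] at hfin2
  exact (ENNReal.ofReal_le_ofReal_iff (mul_nonneg (by positivity) (integral_rpow_nonneg _))).1 hfin2

/-- Normalization of a counterexample with constant n + 1: subtract the mean and divide by the `L^q`
norm of the remainder. -/
theorem exists_seq_of_not_poincare [IsFiniteMeasure (volume.restrict Ω)] (hq : 1 < q)
    (hv0 : volume.real Ω ≠ 0)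
    (hcon : ∀ C : ℝ, 0 ≤ C → ∃ (v : E N → ℝ) (G : E N → E N), HasW1 Ω q v G ∧
      ∀ c : ℝ, C * ∫ x in Ω, ‖G x‖ ^ q < ∫ x in Ω, ‖v x - c‖ ^ q) :
    ∀ n : ℕ, ∃ (w : E N → ℝ) (H : E N → E N), HasW1 Ω q w H ∧ ∫ x in Ω, ‖w x‖ ^ q = 1 ∧
      ∫ x in Ω, w x = 0 ∧ ∫ x in Ω, ‖H x‖ ^ q ≤ 1 / ((n : ℝ) + 1) := by
  intro n
  have hq0 : 0 < q := by linarith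
  obtain ⟨v, G, hv, hvc⟩ := hcon (n + 1) (by positivity)
  set c := (∫ x in Ω, v x) / volume.real Ω with hc
  set t := ∫ x in Ω, ‖v x - c‖ ^ q with ht
  have hlt := hvc c
  have hG0 : 0 ≤ ∫ x in Ω, ‖G x‖ ^ q := integral_rpow_nonneg _
  have ht0 : 0 < t := lt_of_le_of_lt (by positivity) hlt
  set s := t⁻¹ ^ q⁻¹ with hs
  have hs0 : 0 < s := by positivity
  have hsq : s ^ q = t⁻¹ := by
    rw [hs, ← Real.rpow_mul (by positivity), inv_mul_cancel₀ hq0.ne', Real.rpow_one]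
  have hvi : Integrable v (volume.restrict Ω) := hv.memLp.integrable (one_le_ofReal_of_one_lt hq)
  have hscale : ∀ {F : Type} [NormedAddCommGroup F] [NormedSpace ℝ F] (f : E N → F),
      ∫ x in Ω, ‖s • f x‖ ^ q = t⁻¹ * ∫ x in Ω, ‖f x‖ ^ q := fun f => by
    rw [← integral_const_mul]
    congr 1; ext x
    rw [norm_smul, Real.norm_of_nonneg hs0.le, Real.mul_rpow hs0.le (norm_nonneg _), hsq]
  refine ⟨fun x => s * (v x + -c), fun x => s • G x, (hv.add_const (-c)).const_mul s, ?_, ?_, ?_⟩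
  · have := hscale fun x => v x - c
    simp only [smul_eq_mul] at this
    simp only [← sub_eq_add_neg]
    rw [this, ← ht, inv_mul_cancel₀ ht0.ne']
  · rw [integral_const_mul, integral_add hvi (integrable_const _)]
    simp only [integral_const, measureReal_restrict_apply_univ, smul_eq_mul, hc]
    rw [mul_eq_zero]; right
    field_simp
    ring
  · rw [hscale]
    rw [inv_mul_le_iff₀ ht0, mul_one_div, le_div_iff₀ (by positivity)]
    linarith

/-- The Poincaré–Wirtinger inequality. -/
theorem poincare_wirtinger (hq : 1 < q) (hΩ : IsSmoothBoundedDomain Ω) :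
    ∃ C : ℝ, 0 ≤ C ∧ ∀ (v : E N → ℝ) (G : E N → E N), HasW1 Ω q v G →
      ∃ c : ℝ, ∫ x in Ω, ‖v x - c‖ ^ q ≤ C * ∫ x in Ω, ‖G x‖ ^ q := by
  have hq0 : 0 < q := by linarith
  have := hΩ.isFiniteMeasure
  by_contra! hcon
  have hvol : volume Ω ≠ 0 := (hΩ.isOpen.measure_pos _ hΩ.isConnected.nonempty).ne'
  have hvol' : volume.real Ω ≠ 0 := by
    simp [Measure.real, ENNReal.toReal_eq_zero_iff, hvol, hΩ.isBounded.measure_lt_top.ne]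
  choose w H hw h1 h0 hH using exists_seq_of_not_poincare hq hvol' hcon
  -- The Rellich limit has zero gradient, so it is constant; its mean is 0, so it vanishes, against
  -- the unit norms of the sequence.
  obtain ⟨ns, v, hns, hv, hlim⟩ := rellich hq hΩ hw (M := 1) (fun n => (h1 n).le)
    (fun n => (hH n).trans (by
      rw [div_le_one (by positivity)]; have : (0 : ℝ) ≤ n := by positivity
      linarith))
  have hHlim : Tendsto (fun n => eLpNorm (fun x => H (ns n) x - (fun _ => (0 : E N)) x)
      (ENNReal.ofReal q) (volume.restrict Ω)) atTop (𝓝 0) := by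
    simp only [sub_zero]
    rw [tendsto_eLpNorm_zero_iff hq fun n => (hw (ns n)).memLp_grad]
    exact squeeze_zero (fun n => integral_rpow_nonneg _) (fun n => hH (ns n))
      (tendsto_one_div_add_atTop_nhds_zero_nat.comp hns.tendsto_atTop)
  have hvW := hasW1_of_tendsto hq (fun n => hw (ns n)) hv (memLp_const 0) hlim hHlim
  obtain ⟨c, hc⟩ := hvW.grad.ae_const hΩ.isOpen hΩ.isConnected.isPreconnected
  have hint : ∫ x in Ω, v x = 0 := by
    have l1 := tendsto_integral_bilin_of_tendsto (ContinuousLinearMap.lsmul ℝ ℝ) hq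
      (h := fun _ => (1 : ℝ)) (C := 1)
      (fun n => (hw (ns n)).memLp) hv aestronglyMeasurable_const (by simp) hlim
    simp only [ContinuousLinearMap.lsmul_apply, smul_eq_mul, mul_one, h0] at l1
    exact tendsto_nhds_unique l1 tendsto_const_nhds
  have hc0 : c = 0 := by
    rw [integral_congr_ae hc] at hint
    simpa [hvol'] using hint
  have hz : Tendsto (fun n => eLpNorm (w (ns n)) (ENNReal.ofReal q) (volume.restrict Ω)) atTop
      (𝓝 0) := by
    refine hlim.congr fun n => eLpNorm_congr_ae ?_
    filter_upwards [hc] with x hx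
    rw [hx, hc0, sub_zero]
  rw [tendsto_eLpNorm_zero_iff hq fun n => (hw (ns n)).memLp] at hz
  simp only [h1] at hz
  exact one_ne_zero (tendsto_nhds_unique tendsto_const_nhds hz)

end Poincare

/-! ### Chain and product rules for `W_0^{1,p}` -/

section ChainRule

theorem tendsto_eLpNorm_of_le_mul {X F F' ι : Type*} [MeasurableSpace X] [NormedAddCommGroup F]
    [NormedAddCommGroup F'] {μ : Measure X} {p : ℝ≥0∞} {l : Filter ι} {a : ι → X → F}
    {b : ι → X → F'} (C : ℝ) (h : ∀ i x, ‖b i x‖ ≤ C * ‖a i x‖)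
    (ha : Tendsto (fun i => eLpNorm (a i) p μ) l (𝓝 0)) :
    Tendsto (fun i => eLpNorm (b i) p μ) l (𝓝 0) := by
  have := ENNReal.Tendsto.const_mul (a := ENNReal.ofReal C) ha (Or.inr ENNReal.ofReal_ne_top)
  rw [mul_zero] at this
  exact tendsto_of_tendsto_of_tendsto_of_le_of_le tendsto_const_nhds this (fun _ => zero_le)
    fun i => eLpNorm_le_mul_eLpNorm_of_ae_le_mul (Eventually.of_forall (h i)) p

theorem tendsto_eLpNorm_add {X F ι : Type*} [MeasurableSpace X] [NormedAddCommGroup F]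
    {μ : Measure X} {p : ℝ≥0∞} (hp : 1 ≤ p) {l : Filter ι} {a b : ι → X → F}
    (ma : ∀ i, AEStronglyMeasurable (a i) μ) (mb : ∀ i, AEStronglyMeasurable (b i) μ)
    (ha : Tendsto (fun i => eLpNorm (a i) p μ) l (𝓝 0))
    (hb : Tendsto (fun i => eLpNorm (b i) p μ) l (𝓝 0)) :
    Tendsto (fun i => eLpNorm (fun x => a i x + b i x) p μ) l (𝓝 0) :=
  tendsto_zero_of_le_add ha hb fun i => eLpNorm_add_le (ma i) (mb i) hp

theorem tendsto_eLpNorm_sub_comm {X F ι : Type*} [MeasurableSpace X] [NormedAddCommGroup F]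
    {μ : Measure X} {p : ℝ≥0∞} {l : Filter ι} {a b : ι → X → F}
    (h : Tendsto (fun i => eLpNorm (fun x => a i x - b i x) p μ) l (𝓝 0)) :
    Tendsto (fun i => eLpNorm (fun x => b i x - a i x) p μ) l (𝓝 0) :=
  h.congr fun i => eLpNorm_sub_comm (a i) (b i) p μ

/-- An `L^p` convergent sequence has an almost everywhere convergent subsequence. -/
theorem exists_subseq_tendsto_ae {X F : Type*} [MeasurableSpace X] [NormedAddCommGroup F]
    {μ : Measure X} {p : ℝ} (hp : 1 < p) {f : ℕ → X → F} {g : X → F}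
    (hf : ∀ n, AEStronglyMeasurable (f n) μ) (hg : AEStronglyMeasurable g μ)
    (h : Tendsto (fun n => eLpNorm (fun x => f n x - g x) (ENNReal.ofReal p) μ) atTop (𝓝 0)) :
    ∃ ns : ℕ → ℕ, StrictMono ns ∧ ∀ᵐ x ∂μ, Tendsto (fun n => f (ns n) x) atTop (𝓝 (g x)) :=
  (tendstoInMeasure_of_tendsto_eLpNorm (ofReal_ne_zero_of_one_lt hp) hf hg h).exists_seq_tendsto_ae

variable {Ω : Set (E N)} [IsFiniteMeasure (volume.restrict Ω)] {u : E N → ℝ} {G : E N → E N} {p : ℝ}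

theorem abs_sub_le_of_deriv_le {F : ℝ → ℝ} (hF : Differentiable ℝ F) {L : ℝ}
    (hL : ∀ t, |deriv F t| ≤ L) (a b : ℝ) : ‖F a - F b‖ ≤ L * ‖a - b‖ :=
  Convex.norm_image_sub_le_of_norm_deriv_le (fun x _ => hF x) (fun x _ => hL x) convex_univ
    (Set.mem_univ b) (Set.mem_univ a)

/-- Chain rule in `W_0^{1,p}` for smooth functions with bounded derivative. -/
theorem HasW0.comp_smooth (hp : 1 < p) (hu : HasW0 Ω p u G) {F : ℝ → ℝ} (hF : ContDiff ℝ ∞ F)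
    (hF0 : F 0 = 0) {L : ℝ} (hL : ∀ t, |deriv F t| ≤ L) :
    HasW0 Ω p (fun x => F (u x)) (fun x => deriv F (u x) • G x) := by
  have hL0 : 0 ≤ L := (abs_nonneg _).trans (hL 0)
  have hFd : Differentiable ℝ F := hF.differentiable (by simp)
  have hFc : Continuous (deriv F) := hF.continuous_deriv (by simp)
  have hlip := abs_sub_le_of_deriv_le hFd hL
  obtain ⟨φ, hφ, hφu, hφG⟩ := hu.approx
  have hφu' := tendsto_eLpNorm_sub_comm hφu
  -- F′ is only continuous and bounded here, so F′(φ_n) G → F′(u) G is obtained by dominated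
  -- convergence along an a.e. convergent subsequence.
  obtain ⟨ns, hns, hae⟩ := exists_subseq_tendsto_ae hp
    (fun n => (hφ n).continuous.aestronglyMeasurable) hu.memLp.1 hφu'
  have mFu : MemLp (fun x => F (u x)) (ENNReal.ofReal p) (volume.restrict Ω) :=
    (hu.memLp.const_mul L).mono (hF.continuous.comp_aestronglyMeasurable hu.memLp.1)
      (Eventually.of_forall fun x => by
        have := hlip (u x) 0
        simpa [hF0, abs_of_nonneg hL0] using this)
  have mFG : MemLp (fun x => deriv F (u x) • G x) (ENNReal.ofReal p) (volume.restrict Ω) :=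
    (hu.memLp_grad.const_smul L).mono
      ((hFc.comp_aestronglyMeasurable hu.memLp.1).smul hu.memLp_grad.1)
      (Eventually.of_forall fun x => by
        simp only [Pi.smul_apply, norm_smul, Real.norm_eq_abs, abs_of_nonneg hL0]
        exact mul_le_mul_of_nonneg_right (hL _) (norm_nonneg _))
  refine hasW0_of_tendsto hp (f := fun n x => F (φ (ns n) x))
    (g := fun n x => deriv F (φ (ns n) x) • gradient (φ (ns n)) x) (fun n => ?_) mFu mFG ?_ ?_
  · have := ((hφ (ns n)).comp hF hF0).hasW0 (p := p)
    rwa [show gradient (fun x => F (φ (ns n) x)) = fun x => deriv F (φ (ns n) x) •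
      gradient (φ (ns n)) x from funext (gradient_comp_apply (hφ (ns n)).differentiable hFd)] at this
  · exact tendsto_eLpNorm_of_le_mul L (fun n x => hlip _ _) (hφu'.comp hns.tendsto_atTop)
  · have h1 : Tendsto (fun n => eLpNorm (fun x => deriv F (φ (ns n) x) •
        (gradient (φ (ns n)) x - G x)) (ENNReal.ofReal p) (volume.restrict Ω)) atTop (𝓝 0) := by
      refine tendsto_eLpNorm_of_le_mul L (fun n x => ?_)
        ((tendsto_eLpNorm_sub_comm hφG).comp hns.tendsto_atTop)
      rw [norm_smul]
      exact mul_le_mul_of_nonneg_right (hL _) (norm_nonneg _)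
    have h2 : Tendsto (fun n => eLpNorm (fun x => (deriv F (φ (ns n) x) - deriv F (u x)) • G x)
        (ENNReal.ofReal p) (volume.restrict Ω)) atTop (𝓝 0) := by
      refine tendsto_eLpNorm_of_dominated hp (g := fun x => 2 * L * ‖G x‖) (fun n => ?_)
        (hu.memLp_grad.norm.const_mul _) (fun n => Eventually.of_forall fun x => ?_) ?_
      · exact ((hFc.comp (hφ _).continuous).aestronglyMeasurable.sub
          (hFc.comp_aestronglyMeasurable hu.memLp.1)).smul hu.memLp_grad.1
      · rw [norm_smul]
        refine mul_le_mul_of_nonneg_right ((norm_sub_le _ _).trans ?_) (norm_nonneg _)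
        have := hL (φ (ns n) x)
        have := hL (u x)
        simp only [Real.norm_eq_abs]; linarith
      · filter_upwards [hae] with x hx
        have := (((hFc.tendsto _).comp hx).sub_const (deriv F (u x))).smul_const (G x)
        simpa using this
    refine (tendsto_eLpNorm_add (one_le_ofReal_of_one_lt hp) (fun n => ?_) (fun n => ?_) h1
      h2).congr fun n => ?_
    · exact (hFc.comp (hφ _).continuous).aestronglyMeasurable.smul
        ((hφ _).continuous_gradient.aestronglyMeasurable.sub hu.memLp_grad.1)
    · exact ((hFc.comp (hφ _).continuous).aestronglyMeasurable.sub
          (hFc.comp_aestronglyMeasurable hu.memLp.1)).smul hu.memLp_grad.1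
    · congr 1; ext1 x
      rw [smul_sub, sub_smul]; abel

/-- Chain rule in `W_0^{1,p}` for limits of smooth functions with bounded derivatives. -/
theorem HasW0.comp_limit (hp : 1 < p) (hu : HasW0 Ω p u G) {F : ℕ → ℝ → ℝ} {F₀ f₀ : ℝ → ℝ}
    (hF : ∀ k, ContDiff ℝ ∞ (F k)) (hF0 : ∀ k, F k 0 = 0) {L : ℝ} (hL : ∀ k t, |deriv (F k) t| ≤ L)
    (hlim : ∀ t, Tendsto (fun k => F k t) atTop (𝓝 (F₀ t)))
    (hlim' : ∀ t, Tendsto (fun k => deriv (F k) t) atTop (𝓝 (f₀ t))) :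
    HasW0 Ω p (fun x => F₀ (u x)) (fun x => f₀ (u x) • G x) := by
  have hL0 : 0 ≤ L := (abs_nonneg _).trans (hL 0 0)
  have hk := fun k => hu.comp_smooth hp (hF k) (hF0 k) (hL k)
  have hb : ∀ k t, |F k t| ≤ L * |t| := fun k t => by
    have := abs_sub_le_of_deriv_le ((hF k).differentiable (by simp)) (hL k) t 0
    simpa [hF0 k] using this
  have hb0 : ∀ t, |F₀ t| ≤ L * |t| := fun t =>
    le_of_tendsto' (hlim t).abs fun k => hb k t
  have hb0' : ∀ t, |f₀ t| ≤ L := fun t => le_of_tendsto' (hlim' t).abs fun k => hL k t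
  have m1 : AEStronglyMeasurable (fun x => F₀ (u x)) (volume.restrict Ω) :=
    aestronglyMeasurable_of_tendsto_ae atTop (fun k => (hk k).memLp.1)
      (Eventually.of_forall fun x => hlim (u x))
  have m2 : AEStronglyMeasurable (fun x => f₀ (u x) • G x) (volume.restrict Ω) :=
    aestronglyMeasurable_of_tendsto_ae atTop (fun k => (hk k).memLp_grad.1)
      (Eventually.of_forall fun x => (hlim' (u x)).smul_const _)
  have n1 : MemLp (fun x => F₀ (u x)) (ENNReal.ofReal p) (volume.restrict Ω) :=
    (hu.memLp.const_mul L).mono m1 (Eventually.of_forall fun x => by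
      simpa [abs_of_nonneg hL0] using hb0 (u x))
  have n2 : MemLp (fun x => f₀ (u x) • G x) (ENNReal.ofReal p) (volume.restrict Ω) :=
    (hu.memLp_grad.const_smul L).mono m2 (Eventually.of_forall fun x => by
      simp only [Pi.smul_apply, norm_smul, Real.norm_eq_abs, abs_of_nonneg hL0]
      exact mul_le_mul_of_nonneg_right (hb0' _) (norm_nonneg _))
  refine hasW0_of_tendsto hp hk n1 n2 ?_ ?_
  · refine tendsto_eLpNorm_of_dominated hp (g := fun x => 2 * L * ‖u x‖)
      (fun k => (hk k).memLp.1.sub m1) (hu.memLp.norm.const_mul _)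
      (fun k => Eventually.of_forall fun x => ?_) (Eventually.of_forall fun x => ?_)
    · refine (norm_sub_le _ _).trans ?_
      have := hb k (u x)
      have := hb0 (u x)
      simp only [Real.norm_eq_abs]; linarith
    · simpa using (hlim (u x)).sub_const (F₀ (u x))
  · refine tendsto_eLpNorm_of_dominated hp (g := fun x => 2 * L * ‖G x‖)
      (fun k => (hk k).memLp_grad.1.sub m2) (hu.memLp_grad.norm.const_mul _)
      (fun k => Eventually.of_forall fun x => ?_) (Eventually.of_forall fun x => ?_)
    · rw [← sub_smul, norm_smul]
      refine mul_le_mul_of_nonneg_right ((norm_sub_le _ _).trans ?_) (norm_nonneg _)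
      have := hL k (u x)
      have := hb0' (u x)
      simp only [Real.norm_eq_abs]; linarith
    · simpa using ((hlim' (u x)).smul_const (G x)).sub_const (f₀ (u x) • G x)

/-- Products of test functions with functions in `W_0^{1,p}`. -/
theorem HasW0.testFunction_mul (hp : 1 < p) (hu : HasW0 Ω p u G) {η : E N → ℝ}
    (hη : IsTestFunction Ω η) :
    HasW0 Ω p (fun x => η x * u x) (fun x => η x • G x + u x • gradient η x) := by
  obtain ⟨C, hC⟩ := hη.exists_bound
  obtain ⟨D, hD⟩ := hη.exists_bound_gradient
  obtain ⟨φ, hφ, hφu, hφG⟩ := hu.approx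
  have hC0 : 0 ≤ C := (norm_nonneg _).trans (hC 0)
  have hD0 : 0 ≤ D := (norm_nonneg _).trans (hD 0)
  have mη := hη.continuous.aestronglyMeasurable (μ := volume.restrict Ω)
  have mη' := hη.continuous_gradient.aestronglyMeasurable (μ := volume.restrict Ω)
  have m1 : MemLp (fun x => η x * u x) (ENNReal.ofReal p) (volume.restrict Ω) :=
    (hu.memLp.const_mul C).mono (mη.mul hu.memLp.1) (Eventually.of_forall fun x => by
      rw [norm_mul, norm_mul, Real.norm_of_nonneg hC0]
      exact mul_le_mul_of_nonneg_right (hC x) (norm_nonneg _))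
  have m2 : MemLp (fun x => η x • G x) (ENNReal.ofReal p) (volume.restrict Ω) :=
    (hu.memLp_grad.const_smul C).mono (mη.smul hu.memLp_grad.1) (Eventually.of_forall fun x => by
      simp only [Pi.smul_apply]
      rw [norm_smul, norm_smul, Real.norm_of_nonneg hC0]
      exact mul_le_mul_of_nonneg_right (hC x) (norm_nonneg _))
  have m3 : MemLp (fun x => u x • gradient η x) (ENNReal.ofReal p) (volume.restrict Ω) :=
    (hu.memLp.const_mul D).mono (hu.memLp.1.smul mη') (Eventually.of_forall fun x => by
      rw [norm_smul, norm_mul, Real.norm_of_nonneg hD0, mul_comm]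
      exact mul_le_mul_of_nonneg_right (hD x) (norm_nonneg _))
  refine hasW0_of_tendsto hp (f := fun n x => η x * φ n x)
    (g := fun n x => η x • gradient (φ n) x + φ n x • gradient η x) (fun n => ?_) m1 (m2.add m3)
    ?_ ?_
  · have := ((hφ n).mul_left hη.1).hasW0 (p := p)
    rwa [show gradient (fun x => η x * φ n x) = fun x => η x • gradient (φ n) x +
      φ n x • gradient η x from
      funext (gradient_mul_apply hη.differentiable (hφ n).differentiable)] at this
  · refine tendsto_eLpNorm_of_le_mul C (fun n x => ?_) (tendsto_eLpNorm_sub_comm hφu)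
    rw [← mul_sub, norm_mul]
    exact mul_le_mul_of_nonneg_right (hC x) (norm_nonneg _)
  · have h1 : Tendsto (fun n => eLpNorm (fun x => η x • (gradient (φ n) x - G x))
        (ENNReal.ofReal p) (volume.restrict Ω)) atTop (𝓝 0) := by
      refine tendsto_eLpNorm_of_le_mul C (fun n x => ?_) (tendsto_eLpNorm_sub_comm hφG)
      rw [norm_smul]
      exact mul_le_mul_of_nonneg_right (hC x) (norm_nonneg _)
    have h2 : Tendsto (fun n => eLpNorm (fun x => (φ n x - u x) • gradient η x)
        (ENNReal.ofReal p) (volume.restrict Ω)) atTop (𝓝 0) := by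
      refine tendsto_eLpNorm_of_le_mul D (fun n x => ?_) (tendsto_eLpNorm_sub_comm hφu)
      rw [norm_smul, mul_comm]
      exact mul_le_mul_of_nonneg_right (hD x) (norm_nonneg _)
    refine (tendsto_eLpNorm_add (one_le_ofReal_of_one_lt hp) (fun n => ?_) (fun n => ?_) h1
      h2).congr fun n => ?_
    · exact mη.smul ((hφ n).continuous_gradient.aestronglyMeasurable.sub hu.memLp_grad.1)
    · exact ((hφ n).continuous.aestronglyMeasurable.sub hu.memLp.1).smul mη'
    · congr 1; ext1 x
      rw [smul_sub, sub_smul]; abel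

end ChainRule

/-! ### Absolute values, positive parts and zero sets -/

section AbsChainRule

theorem contDiff_sqrt_sq_add {δ : ℝ} (hδ : 0 < δ) : ContDiff ℝ ∞ fun t : ℝ => √(t ^ 2 + δ ^ 2) :=
  ContDiff.sqrt (by fun_prop) fun t => by positivity

theorem hasDerivAt_sqrt_sq_add {δ : ℝ} (hδ : 0 < δ) (t : ℝ) :
    HasDerivAt (fun t : ℝ => √(t ^ 2 + δ ^ 2)) (t / √(t ^ 2 + δ ^ 2)) t := by
  have h1 : HasDerivAt (fun t : ℝ => t ^ 2 + δ ^ 2) (2 * t) t := by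
    simpa using (hasDerivAt_pow 2 t).add_const (δ ^ 2)
  have := h1.sqrt (by positivity)
  convert this using 1
  field_simp

theorem abs_div_sqrt_sq_add_le (δ t : ℝ) : |t / √(t ^ 2 + δ ^ 2)| ≤ 1 := by
  rw [abs_div, abs_of_nonneg (Real.sqrt_nonneg _)]
  refine div_le_one_of_le₀ ?_ (Real.sqrt_nonneg _)
  rw [← Real.sqrt_sq_eq_abs]
  exact Real.sqrt_le_sqrt (by nlinarith [sq_nonneg δ])

theorem tendsto_sqrt_sq_add (t : ℝ) {δ : ℕ → ℝ} (hδ : Tendsto δ atTop (𝓝 0)) :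
    Tendsto (fun k => √(t ^ 2 + δ k ^ 2)) atTop (𝓝 |t|) := by
  have h := ((hδ.pow 2).const_add (t ^ 2)).sqrt
  simpa [Real.sqrt_sq_eq_abs] using h

theorem tendsto_div_sqrt_sq_add (t : ℝ) {δ : ℕ → ℝ} (hδ : Tendsto δ atTop (𝓝 0)) :
    Tendsto (fun k => t / √(t ^ 2 + δ k ^ 2)) atTop (𝓝 (Real.sign t)) := by
  rcases lt_trichotomy t 0 with ht | rfl | ht
  · have := (tendsto_const_nhds (x := t)).div (tendsto_sqrt_sq_add t hδ) (by simpa using ht.ne)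
    rwa [abs_of_neg ht, div_neg, div_self ht.ne, ← Real.sign_of_neg ht] at this
  · simp
  · have := (tendsto_const_nhds (x := t)).div (tendsto_sqrt_sq_add t hδ) (by simpa using ht.ne')
    rwa [abs_of_pos ht, div_self ht.ne', ← Real.sign_of_pos ht] at this

variable {Ω : Set (E N)} [IsFiniteMeasure (volume.restrict Ω)] {u : E N → ℝ} {G : E N → E N} {p : ℝ}

/-- Chain rule in `W_0^{1,p}` for `h ∘ |·|`, with `h` smooth on a neighbourhood of `[0, ∞)`. -/
theorem HasW0.comp_abs (hp : 1 < p) (hu : HasW0 Ω p u G) {h : ℝ → ℝ} {ε L : ℝ} (hε : 0 < ε)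
    (hh : ContDiffOn ℝ ∞ h (Set.Ioi (-ε))) (h0 : h 0 = 0)
    (hL : ∀ t ∈ Set.Ici (0 : ℝ), |deriv h t| ≤ L) :
    HasW0 Ω p (fun x => h |u x|) (fun x => (deriv h |u x| * Real.sign (u x)) • G x) := by
  set δ : ℕ → ℝ := fun k => 1 / ((k : ℝ) + 1) with hδ
  have hδ0 : ∀ k, 0 < δ k := fun k => by simp only [hδ]; positivity
  have hδl : Tendsto δ atTop (𝓝 0) := tendsto_one_div_add_atTop_nhds_zero_nat
  -- Smooth approximations of |t|. Subtracting δ_k makes them vanish at 0, so h ∘ s_k does too,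
  -- while they stay nonnegative, where the bound on h′ applies.
  set s : ℕ → ℝ → ℝ := fun k t => √(t ^ 2 + δ k ^ 2) - δ k with hs
  have hs0 : ∀ k t, 0 ≤ s k t := fun k t => by
    simp only [hs, sub_nonneg]
    exact Real.le_sqrt_of_sq_le (by nlinarith [sq_nonneg t])
  have hsm : ∀ k t, s k t ∈ Set.Ioi (-ε) := fun k t => by
    have := hs0 k t
    simp only [Set.mem_Ioi]; linarith
  have hsl : ∀ t, Tendsto (fun k => s k t) atTop (𝓝 |t|) := fun t => by
    simpa using (tendsto_sqrt_sq_add t hδl).sub hδl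
  have hd : ∀ t ∈ Set.Ioi (-ε), HasDerivAt h (deriv h t) t := fun t ht =>
    ((hh.contDiffAt (isOpen_Ioi.mem_nhds ht)).differentiableAt (by simp)).hasDerivAt
  have hder : ∀ k t, HasDerivAt (fun t => h (s k t))
      (deriv h (s k t) * (t / √(t ^ 2 + δ k ^ 2))) t := fun k t =>
    (hd _ (hsm k t)).comp t ((hasDerivAt_sqrt_sq_add (hδ0 k) t).sub_const _)
  have hdc : ContinuousOn (deriv h) (Set.Ioi (-ε)) :=
    hh.continuousOn_deriv_of_isOpen isOpen_Ioi (by simp)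
  have habs : ∀ t : ℝ, |t| ∈ Set.Ioi (-ε) := fun t => by
    have := abs_nonneg t
    simp only [Set.mem_Ioi]; linarith
  refine hu.comp_limit hp (F := fun k t => h (s k t)) (F₀ := fun t => h |t|)
    (f₀ := fun t => deriv h |t| * Real.sign t) (L := L)
    (fun k => ?_) (fun k => ?_) (fun k t => ?_) (fun t => ?_) (fun t => ?_)
  · exact hh.comp_contDiff ((contDiff_sqrt_sq_add (hδ0 k)).sub contDiff_const) (hsm k)
  · simp [hs, Real.sqrt_sq (hδ0 k).le, h0]
  · rw [(hder k t).deriv, abs_mul]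
    have := mul_le_mul (hL _ (hs0 k t)) (abs_div_sqrt_sq_add_le (δ k) t) (abs_nonneg _)
      ((abs_nonneg _).trans (hL 0 (by simp)))
    linarith
  · exact ((hd _ (habs t)).continuousAt.tendsto).comp (hsl t)
  · simp only [(hder _ t).deriv]
    exact (((hdc.continuousAt (isOpen_Ioi.mem_nhds (habs t))).tendsto).comp (hsl t)).mul
      (tendsto_div_sqrt_sq_add t hδl)

theorem HasW0.abs (hp : 1 < p) (hu : HasW0 Ω p u G) :
    HasW0 Ω p (fun x => |u x|) (fun x => Real.sign (u x) • G x) := by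
  simpa using hu.comp_abs hp (h := fun t => t) (L := 1) one_pos contDiffOn_id rfl (by simp)

/-- The weak gradient vanishes almost everywhere on the zero set. -/
theorem HasW0.grad_eq_zero (hp : 1 < p) (hΩ : IsOpen Ω) (hu : HasW0 Ω p u G) :
    ∀ᵐ x ∂(volume.restrict Ω), u x = 0 → G x = 0 := by
  classical
  -- The functions arctan((k+1)t)/(k+1) tend to 0 while their derivatives tend to the indicator of
  -- {0}. In the limit, the indicator of {u = 0} times G is a weak gradient of 0.
  have hder : ∀ (k : ℕ) (t : ℝ), HasDerivAt (fun t : ℝ => Real.arctan ((k + 1) * t) / (k + 1))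
      (1 / (1 + ((k + 1) * t) ^ 2)) t := fun k t => by
    have h1 : HasDerivAt (fun t : ℝ => ((k : ℝ) + 1) * t) (k + 1) t := by
      simpa using (hasDerivAt_id t).const_mul ((k : ℝ) + 1)
    have := h1.arctan.div_const ((k : ℝ) + 1)
    rwa [mul_div_cancel_right₀ _ (by positivity)] at this
  have hk : Tendsto (fun k : ℕ => (k : ℝ) + 1) atTop atTop :=
    tendsto_atTop_add_const_right _ _ tendsto_natCast_atTop_atTop
  have h := hu.comp_limit hp (F := fun k t => Real.arctan ((k + 1) * t) / (k + 1))
    (F₀ := fun _ => 0) (f₀ := fun t => if t = 0 then 1 else 0) (L := 1) (fun k => ?_) (by simp)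
    (fun k t => ?_) (fun t => ?_) (fun t => ?_)
  · have := h.grad.ae_eq hΩ (isWeakGradient_const 0)
    filter_upwards [this] with x hx hux
    simpa [hux] using hx
  · exact (Real.contDiff_arctan.comp (contDiff_const.mul contDiff_id)).div_const _
  · rw [(hder k t).deriv, abs_of_nonneg (by positivity)]
    exact div_le_one_of_le₀ (by nlinarith [sq_nonneg (((k : ℝ) + 1) * t)]) (by positivity)
  · refine squeeze_zero_norm (a := fun k : ℕ => (Real.pi / 2) / ((k : ℝ) + 1)) (fun k => ?_)
      (tendsto_const_nhds.div_atTop hk)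
    rw [norm_div, Real.norm_of_nonneg (by positivity : (0 : ℝ) ≤ (k : ℝ) + 1)]
    gcongr
    rw [Real.norm_eq_abs, abs_le]
    exact ⟨(Real.neg_pi_div_two_lt_arctan _).le, (Real.arctan_lt_pi_div_two _).le⟩
  · simp only [(hder _ t).deriv]
    by_cases ht : t = 0
    · simp [ht]
    · simp only [ht, if_false]
      refine tendsto_const_nhds.div_atTop (tendsto_atTop_add_const_left _ _ ?_)
      have h2 : Tendsto (fun k : ℕ => ((k : ℝ) + 1) ^ 2 * t ^ 2) atTop atTop :=
        ((tendsto_pow_atTop two_ne_zero).comp hk).atTop_mul_const (by positivity)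
      refine h2.congr fun k => by ring

/-- Positive parts in `W_0^{1,p}`. -/
theorem HasW0.posPart (hp : 1 < p) (hu : HasW0 Ω p u G) :
    HasW0 Ω p (fun x => max (u x) 0) (fun x => ((1 + Real.sign (u x)) / 2) • G x) := by
  refine ((hu.add hp (hu.abs hp)).const_mul (1 / 2)).congr (Eventually.of_forall fun x => ?_)
    (Eventually.of_forall fun x => ?_)
  · simp only
    rcases le_total (u x) 0 with h | h
    · rw [max_eq_right h, abs_of_nonpos h]; ring
    · rw [max_eq_left h, abs_of_nonneg h]; ring
  · simp only
    module

end AbsChainRule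

/-! ### Convexity of the power of the norm -/

section NormPow

variable {F : Type*} [NormedAddCommGroup F] [InnerProductSpace ℝ F] {p : ℝ}

theorem convexOn_norm_rpow (hp : 1 < p) : ConvexOn ℝ Set.univ fun x : F => ‖x‖ ^ p := by
  refine ⟨convex_univ, fun x _ y _ a b ha hb hab => ?_⟩
  have h1 : ‖a • x + b • y‖ ≤ a * ‖x‖ + b * ‖y‖ := by
    refine (norm_add_le _ _).trans ?_
    rw [norm_smul, norm_smul, Real.norm_of_nonneg ha, Real.norm_of_nonneg hb]
  refine (Real.rpow_le_rpow (norm_nonneg _) h1 (by linarith)).trans ?_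
  exact (convexOn_rpow hp.le).2 (norm_nonneg x) (norm_nonneg y) ha hb hab

/-- For equal norms strictness comes from strict convexity of the norm ball, for different norms
from strict convexity of t ↦ t^p. -/
theorem norm_midpoint_rpow_lt (hp : 1 < p) {a b : F} (hab : a ≠ b) :
    ‖(1 / 2 : ℝ) • (a + b)‖ ^ p < (‖a‖ ^ p + ‖b‖ ^ p) / 2 := by
  have hp0 : 0 < p := by linarith
  by_cases h : ‖a‖ = ‖b‖
  · have h1 : ‖(1 / 2 : ℝ) • a + (1 / 2 : ℝ) • b‖ < ‖b‖ :=
      norm_combo_lt_of_ne h.le le_rfl hab (by norm_num) (by norm_num) (by norm_num)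
    rw [← smul_add] at h1
    have := Real.rpow_lt_rpow (norm_nonneg _) h1 hp0
    rw [h]; linarith
  · have h1 := (strictConvexOn_rpow hp).2 (norm_nonneg a) (norm_nonneg b) h
      (by norm_num : (0 : ℝ) < 1 / 2) (by norm_num : (0 : ℝ) < 1 / 2) (by norm_num)
    simp only [smul_eq_mul] at h1
    have h2 : ‖(1 / 2 : ℝ) • (a + b)‖ ≤ 1 / 2 * ‖a‖ + 1 / 2 * ‖b‖ := by
      rw [smul_add]
      refine (norm_add_le _ _).trans ?_
      rw [norm_smul, norm_smul]; norm_num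
    have := Real.rpow_le_rpow (norm_nonneg _) h2 hp0.le
    linarith

theorem hasDerivAt_norm_rpow_line (hp : 1 < p) (a b : F) (t : ℝ) :
    HasDerivAt (fun t : ℝ => ‖a + t • b‖ ^ p)
      (p * ‖a + t • b‖ ^ (p - 2) * inner ℝ (a + t • b) b) t := by
  have h1 : HasDerivAt (fun t : ℝ => a + t • b) b t := by
    simpa using ((hasDerivAt_id t).smul_const b).const_add a
  have h2 := (hasFDerivAt_norm_rpow (a + t • b) hp).comp_hasDerivAt t h1
  simpa only [Function.comp_def, smul_apply, innerSL_apply_apply, smul_eq_mul]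
    using h2

/-- The tangent inequality for `‖·‖^p`. -/
theorem norm_rpow_tangent_le (hp : 1 < p) (a b : F) :
    ‖a‖ ^ p + p * ‖a‖ ^ (p - 2) * inner ℝ a b ≤ ‖a + b‖ ^ p := by
  have hc : ConvexOn ℝ Set.univ fun t : ℝ => ‖a + t • b‖ ^ p := by
    have := (convexOn_norm_rpow (F := F) hp).comp_affineMap (AffineMap.lineMap a (a + b))
    refine this.congr fun t _ => ?_
    simp [AffineMap.lineMap_apply, add_comm]
  have hd := hasDerivAt_norm_rpow_line hp a b 0
  simp only [zero_smul, add_zero] at hd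
  have := hc.le_slope_of_hasDerivAt (Set.mem_univ 0) (Set.mem_univ 1) one_pos hd
  simp [slope_def_field] at this
  linarith

theorem norm_rpow_mul_inner_self (hp : 1 < p) (a : F) :
    ‖a‖ ^ (p - 2) * inner ℝ a a = ‖a‖ ^ p := by
  rcases eq_or_ne a 0 with rfl | h
  · simp [Real.zero_rpow (by linarith : p ≠ 0)]
  · rw [real_inner_self_eq_norm_sq, ← Real.rpow_natCast, ← Real.rpow_add (norm_pos_iff.2 h)]
    norm_num

theorem abs_norm_rpow_mul_inner_le (hp : 1 < p) (a b : F) :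
    |‖a‖ ^ (p - 2) * inner ℝ a b| ≤ ‖a‖ ^ (p - 1) * ‖b‖ := by
  rcases eq_or_ne a 0 with rfl | h
  · simp [Real.zero_rpow (by linarith : p - 1 ≠ 0)]
  · rw [abs_mul, abs_of_nonneg (Real.rpow_nonneg (norm_nonneg _) _)]
    calc ‖a‖ ^ (p - 2) * |inner ℝ a b| ≤ ‖a‖ ^ (p - 2) * (‖a‖ * ‖b‖) := by
          gcongr; exact abs_real_inner_le_norm a b
      _ = ‖a‖ ^ (p - 1) * ‖b‖ := by
          rw [← mul_assoc, ← Real.rpow_add_one (norm_ne_zero_iff.2 h)]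
          congr 2; ring

theorem rpow_sub_one_mul_le (hp : 1 < p) {s t : ℝ} (hs : 0 ≤ s) (ht : 0 ≤ t) :
    s ^ (p - 1) * t ≤ s ^ p + t ^ p := by
  have hp0 : 0 < p := by linarith
  rcases le_total s t with h | h
  · calc s ^ (p - 1) * t ≤ t ^ (p - 1) * t := by
          refine mul_le_mul_of_nonneg_right (Real.rpow_le_rpow hs h (by linarith)) ht
      _ = t ^ p := by
          rw [← Real.rpow_add_one' ht (by linarith)]; congr 1; ring
      _ ≤ _ := by linarith [Real.rpow_nonneg hs p]
  · calc s ^ (p - 1) * t ≤ s ^ (p - 1) * s := by gcongr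
      _ = s ^ p := by
          rw [← Real.rpow_add_one' hs (by linarith)]; congr 1; ring
      _ ≤ _ := by linarith [Real.rpow_nonneg ht p]

/-- A quantitative form of uniform convexity of `‖·‖^p`. -/
theorem exists_uniform_convexity [FiniteDimensional ℝ F] (hp : 1 < p) {ε : ℝ} (hε : 0 < ε) :
    ∃ C : ℝ, 0 ≤ C ∧ ∀ a b : F, ‖a - b‖ ^ p ≤ ε * (‖a‖ ^ p + ‖b‖ ^ p) +
      C * ((‖a‖ ^ p + ‖b‖ ^ p) / 2 - ‖(1 / 2 : ℝ) • (a + b)‖ ^ p) := by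
  have hp0 : 0 < p := by linarith
  have hcn : ∀ {f : F × F → F}, Continuous f → Continuous fun z => ‖f z‖ ^ p := fun hf =>
    hf.norm.rpow_const fun _ => Or.inr hp0.le
  set d : F × F → ℝ := fun z => (‖z.1‖ ^ p + ‖z.2‖ ^ p) / 2 - ‖(1 / 2 : ℝ) • (z.1 + z.2)‖ ^ p with hd
  have hdc : Continuous d := (((hcn continuous_fst).add (hcn continuous_snd)).div_const _).sub
    (hcn (by fun_prop))
  have hd0 : ∀ z, 0 ≤ d z := fun z => by
    rcases eq_or_ne z.1 z.2 with h | h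
    · simp only [hd, h]
      rw [← two_smul ℝ z.2, smul_smul]; norm_num
    · exact sub_nonneg.2 (norm_midpoint_rpow_lt hp h).le
  -- By homogeneity it suffices to treat the unit sphere. S is the compact part where the ε-term
  -- alone may not suffice; it avoids the diagonal, so the deficit has a positive minimum m there.
  set S : Set (F × F) := Metric.sphere 0 1 ∩
    {z | ε * (‖z.1‖ ^ p + ‖z.2‖ ^ p) ≤ ‖z.1 - z.2‖ ^ p} with hS
  have hSc : IsCompact S := (isCompact_sphere 0 1).inter_right (isClosed_le
    (continuous_const.mul ((hcn continuous_fst).add (hcn continuous_snd)))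
    (hcn (continuous_fst.sub continuous_snd)))
  obtain ⟨m, hm0, hm⟩ : ∃ m : ℝ, 0 < m ∧ ∀ z ∈ S, m ≤ d z := by
    rcases S.eq_empty_or_nonempty with h | h
    · exact ⟨1, one_pos, by simp [h]⟩
    · obtain ⟨z, hz, hmin⟩ := hSc.exists_isMinOn h hdc.continuousOn
      refine ⟨d z, ?_, fun y hy => hmin hy⟩
      have hne : z.1 ≠ z.2 := by
        intro heq
        have h1 : ‖z‖ = 1 := by simpa using hz.1
        have h2 := hz.2
        simp only [Set.mem_ofPred_eq, heq, sub_self, norm_zero, Real.zero_rpow hp0.ne'] at h2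
        have h3 : ‖z.2‖ = 1 := by
          rw [Prod.norm_def, heq, max_self] at h1; exact h1
        rw [h3, Real.one_rpow] at h2
        linarith
      exact sub_pos.2 (norm_midpoint_rpow_lt hp hne)
  -- K bounds ‖a − b‖^p on the unit sphere, so K/m times the deficit dominates it on S.
  set K : ℝ := 2 ^ (p - 1) * 2 with hK
  refine ⟨K / m, by positivity, fun a b => ?_⟩
  by_cases hz : (a, b) = (0 : F × F)
  · obtain ⟨rfl, rfl⟩ := Prod.mk_eq_zero.1 hz
    simp [Real.zero_rpow hp0.ne']
  set s := ‖(a, b)‖ with hs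
  have hs0 : 0 < s := norm_pos_iff.2 hz
  have hnorm : ‖s⁻¹ • (a, b)‖ = 1 := by
    rw [norm_smul, norm_inv, Real.norm_of_nonneg hs0.le, ← hs, inv_mul_cancel₀ hs0.ne']
  have hsc : ∀ x : F, ‖s⁻¹ • x‖ ^ p = (s⁻¹) ^ p * ‖x‖ ^ p := fun x => by
    rw [norm_smul, Real.norm_of_nonneg (inv_nonneg.2 hs0.le),
      Real.mul_rpow (inv_nonneg.2 hs0.le) (norm_nonneg _)]
  have key : ‖s⁻¹ • a - s⁻¹ • b‖ ^ p ≤ ε * (‖s⁻¹ • a‖ ^ p + ‖s⁻¹ • b‖ ^ p) +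
      K / m * d (s⁻¹ • a, s⁻¹ • b) := by
    by_cases hmem : ((s⁻¹ • a, s⁻¹ • b) : F × F) ∈ S
    · have h1 := hm _ hmem
      have hle : ‖s⁻¹ • a - s⁻¹ • b‖ ^ p ≤ K := by
        refine (norm_sub_rpow_le hp).trans ?_
        have ha : ‖s⁻¹ • a‖ ≤ 1 := hnorm ▸ norm_fst_le (s⁻¹ • (a, b))
        have hb : ‖s⁻¹ • b‖ ≤ 1 := hnorm ▸ norm_snd_le (s⁻¹ • (a, b))
        have := Real.rpow_le_one (norm_nonneg _) ha hp0.le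
        have := Real.rpow_le_one (norm_nonneg _) hb hp0.le
        rw [hK]; gcongr; linarith
      have h2 : K ≤ K / m * d (s⁻¹ • a, s⁻¹ • b) := by
        rw [div_mul_eq_mul_div, le_div_iff₀ hm0]
        gcongr
      have : 0 ≤ ε * (‖s⁻¹ • a‖ ^ p + ‖s⁻¹ • b‖ ^ p) := by positivity
      linarith
    · have h1 : ¬ (ε * (‖s⁻¹ • a‖ ^ p + ‖s⁻¹ • b‖ ^ p) ≤ ‖s⁻¹ • a - s⁻¹ • b‖ ^ p) :=
        fun h => hmem ⟨by simpa using hnorm, h⟩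
      have : 0 ≤ K / m * d (s⁻¹ • a, s⁻¹ • b) := mul_nonneg (by positivity) (hd0 _)
      linarith
  simp only [hd] at key
  rw [← smul_sub, ← smul_add, smul_comm (1 / 2 : ℝ), hsc, hsc, hsc, hsc] at key
  have hsp : 0 < s⁻¹ ^ p := by positivity
  refine le_of_mul_le_mul_left ?_ hsp
  calc _ ≤ _ := key
    _ = _ := by ring

end NormPow

/-! ### Differentiability of the energy -/

section Energy

theorem _root_.MeasureTheory.MemLp.integrable_norm_add_norm_rpow {X F : Type*}
    [MeasurableSpace X] {μ : Measure X} [NormedAddCommGroup F] {p : ℝ} (hp : 1 < p) {a b : X → F}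
    (ha : MemLp a (ENNReal.ofReal p) μ) (hb : MemLp b (ENNReal.ofReal p) μ) :
    Integrable (fun x => (‖a x‖ + ‖b x‖) ^ p) μ := by
  have := (ha.norm.add hb.norm).integrable_rpow hp
  refine this.congr (Eventually.of_forall fun x => ?_)
  simp only [Pi.add_apply]
  rw [Real.norm_of_nonneg (by positivity)]

variable {X F : Type*} [MeasurableSpace X] {μ : Measure X} [NormedAddCommGroup F]
  [InnerProductSpace ℝ F] {p : ℝ}

theorem integrable_norm_rpow_mul_inner (hp : 1 < p) {a b : X → F}
    (ha : MemLp a (ENNReal.ofReal p) μ) (hb : MemLp b (ENNReal.ofReal p) μ) :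
    Integrable (fun x => ‖a x‖ ^ (p - 2) * inner ℝ (a x) (b x)) μ := by
  refine ((ha.integrable_rpow hp).add (hb.integrable_rpow hp)).mono'
    ((ha.1.norm.aemeasurable.pow_const _).aestronglyMeasurable.mul (ha.1.inner hb.1))
    (Eventually.of_forall fun x => ?_)
  exact (abs_norm_rpow_mul_inner_le hp _ _).trans
    (rpow_sub_one_mul_le hp (norm_nonneg _) (norm_nonneg _))

/-- Derivative of the energy along a line. -/
theorem hasDerivAt_energy (hp : 1 < p) {a b : X → F}
    (ha : MemLp a (ENNReal.ofReal p) μ) (hb : MemLp b (ENNReal.ofReal p) μ) :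
    HasDerivAt (fun t : ℝ => ∫ x, ‖a x + t • b x‖ ^ p / p ∂μ)
      (∫ x, ‖a x‖ ^ (p - 2) * inner ℝ (a x) (b x) ∂μ) 0 := by
  have hp0 : 0 < p := by linarith
  have hmem : ∀ t : ℝ, MemLp (fun x => a x + t • b x) (ENNReal.ofReal p) μ := fun t =>
    ha.add (hb.const_smul t)
  have h := hasDerivAt_integral_of_dominated_loc_of_deriv_le (μ := μ)
    (F := fun (t : ℝ) x => ‖a x + t • b x‖ ^ p / p) (x₀ := 0) (s := Set.Ioo (-1) 1)
    (F' := fun t x => ‖a x + t • b x‖ ^ (p - 2) * inner ℝ (a x + t • b x) (b x))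
    (bound := fun x => (‖a x‖ + ‖b x‖) ^ p + ‖b x‖ ^ p)
    (Ioo_mem_nhds (by norm_num) (by norm_num))
    (Eventually.of_forall fun t => (((hmem t).integrable_rpow hp).div_const p).1)
    (((hmem 0).integrable_rpow hp).div_const p)
    (integrable_norm_rpow_mul_inner hp (hmem 0) hb).1 ?_
    ((ha.integrable_norm_add_norm_rpow hp hb).add (hb.integrable_rpow hp)) ?_
  · simpa using h.2
  · refine Eventually.of_forall fun x t ht => ?_
    refine (abs_norm_rpow_mul_inner_le hp _ _).trans
      ((rpow_sub_one_mul_le hp (norm_nonneg _) (norm_nonneg _)).trans ?_)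
    gcongr
    refine (norm_add_le _ _).trans ?_
    rw [norm_smul]
    have h1 : ‖t‖ ≤ 1 := abs_le.2 ⟨ht.1.le, ht.2.le⟩
    nlinarith [norm_nonneg (b x)]
  · refine Eventually.of_forall fun x t _ => ?_
    have := (hasDerivAt_norm_rpow_line hp (a x) (b x) t).div_const p
    rwa [mul_assoc, mul_div_cancel_left₀ _ hp0.ne'] at this

end Energy

/-! ### Exponents, growth conditions and continuity of integrals -/

section Growth

/-- The standing assumptions on the exponents. -/
structure Exponents (p q α β : ℝ) : Prop where
  one_lt_p : 1 < p
  one_lt_q : 1 < q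
  α_pos : 0 < α
  one_lt_β : 1 < β
  sum_eq : α / p + β / q = 1

variable {p q α β : ℝ}

theorem abs_rpow_sub_two_mul (hβ : 1 < β) (x : ℝ) : |(|x| ^ (β - 2) * x)| = |x| ^ (β - 1) := by
  rcases eq_or_ne x 0 with rfl | h
  · simp [Real.zero_rpow (by linarith : β - 1 ≠ 0)]
  · rw [abs_mul, abs_of_nonneg (Real.rpow_nonneg (abs_nonneg _) _),
      ← Real.rpow_add_one (abs_ne_zero.2 h)]
    congr 1; ring

theorem abs_rpow_sub_two_mul_mul (hβ : 0 < β) (x : ℝ) : |x| ^ (β - 2) * x * x = |x| ^ β := by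
  rcases eq_or_ne x 0 with rfl | h
  · simp [Real.zero_rpow hβ.ne']
  · rw [mul_assoc, ← pow_two, ← sq_abs, ← Real.rpow_natCast, ← Real.rpow_add (abs_pos.2 h)]
    norm_num

/-- For 1 < β < 2 the factor |x|^(β−2) is unbounded near 0, but the product has modulus |x|^(β−1),
which tends to 0. -/
theorem continuous_abs_rpow_sub_two_mul (hβ : 1 < β) :
    Continuous fun x : ℝ => |x| ^ (β - 2) * x := by
  rw [continuous_iff_continuousAt]
  intro x
  rcases eq_or_ne x 0 with rfl | h
  · have h0 : Tendsto (fun x : ℝ => |x| ^ (β - 1)) (𝓝 0) (𝓝 0) := by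
      have := (continuous_abs.rpow_const (p := β - 1)
        fun _ => Or.inr (by linarith)).tendsto (0 : ℝ)
      simpa [Real.zero_rpow (by linarith : β - 1 ≠ 0)] using this
    rw [ContinuousAt, mul_zero]
    exact squeeze_zero_norm (fun x => (abs_rpow_sub_two_mul hβ x).le) h0
  · exact (continuousAt_id.abs.rpow_const (Or.inl (by simpa using h))).mul continuousAt_id

theorem abs_rpow_sub_two_mul_smul {t : ℝ} (ht : 0 < t) (x : ℝ) :
    |t * x| ^ (β - 2) * (t * x) = t ^ (β - 1) * (|x| ^ (β - 2) * x) := by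
  rw [abs_mul, abs_of_pos ht, Real.mul_rpow ht.le (abs_nonneg _)]
  have : t ^ (β - 1) = t ^ (β - 2) * t := by
    rw [← Real.rpow_add_one ht.ne']; congr 1; ring
  rw [this]; ring

/-- The tangent inequality for `|·|^β`. -/
theorem abs_rpow_tangent_le (hβ : 1 < β) (x h : ℝ) :
    |x| ^ β + β * (|x| ^ (β - 2) * x) * h ≤ |x + h| ^ β := by
  have := norm_rpow_tangent_le (F := ℝ) hβ x h
  simp only [Real.norm_eq_abs, RCLike.inner_apply, conj_trivial] at this
  linarith

/-- The tangent inequality at the half step h/2 combined with strict midpoint convexity between x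
and x + h. -/
theorem abs_rpow_tangent_lt (hβ : 1 < β) (x : ℝ) {h : ℝ} (hh : h ≠ 0) :
    |x| ^ β + β * (|x| ^ (β - 2) * x) * h < |x + h| ^ β := by
  have h1 := abs_rpow_tangent_le hβ x (h / 2)
  have h2 := norm_midpoint_rpow_lt (F := ℝ) hβ (a := x) (b := x + h) (by simpa using hh)
  have h3 : (1 / 2 : ℝ) • (x + (x + h)) = x + h / 2 := by simp only [smul_eq_mul]; ring
  rw [h3] at h2
  simp only [Real.norm_eq_abs] at h2
  linarith

namespace Exponents

theorem p_pos (h : Exponents p q α β) : 0 < p := by linarith [h.one_lt_p]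
theorem q_pos (h : Exponents p q α β) : 0 < q := by linarith [h.one_lt_q]
theorem β_pos (h : Exponents p q α β) : 0 < β := by linarith [h.one_lt_β]

theorem α_le_p (h : Exponents p q α β) : α ≤ p := by
  have h1 : 0 < β / q := div_pos h.β_pos h.q_pos
  have h2 : α / p ≤ 1 := by linarith [h.sum_eq]
  rwa [div_le_one h.p_pos] at h2

/-- Weighted AM-GM for |a|^p and |b|^q with weights α/p and β/q, which sum to 1. -/
theorem rpow_mul_rpow_le (h : Exponents p q α β) (a b : ℝ) :
    |a| ^ α * |b| ^ β ≤ |a| ^ p + |b| ^ q := by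
  have hp := h.p_pos
  have hq := h.q_pos
  have hα := h.α_pos
  have hβ := h.β_pos
  have ha : 0 ≤ |a| ^ p := by positivity
  have hb : 0 ≤ |b| ^ q := by positivity
  have h1 : 0 ≤ α / p := by positivity
  have h2 : 0 ≤ β / q := by positivity
  have key := Real.geom_mean_le_arith_mean2_weighted h1 h2 ha hb h.sum_eq
  rw [← Real.rpow_mul (abs_nonneg _), ← Real.rpow_mul (abs_nonneg _), mul_div_cancel₀ _ hp.ne',
    mul_div_cancel₀ _ hq.ne'] at key
  have h3 : α / p ≤ 1 := by linarith [h.sum_eq]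
  have h4 : β / q ≤ 1 := by linarith [h.sum_eq]
  nlinarith

/-- Three-term AM-GM with weights α/p, (β−1)/q, 1/q. It makes the source of the second equation
integrable against every z in `L^q`. -/
theorem rpow_mul_rpow_mul_le (h : Exponents p q α β) (a b z : ℝ) :
    |a| ^ α * |b| ^ (β - 1) * |z| ≤ |a| ^ p + |b| ^ q + |z| ^ q := by
  have hp := h.p_pos
  have hq := h.q_pos
  have hα := h.α_pos
  have hβ := h.one_lt_β
  have ha : 0 ≤ |a| ^ p := by positivity
  have hb : 0 ≤ |b| ^ q := by positivity
  have hz : 0 ≤ |z| ^ q := by positivity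
  have h1 : 0 ≤ α / p := by positivity
  have h2 : 0 ≤ (β - 1) / q := div_nonneg (by linarith) hq.le
  have h3 : 0 ≤ 1 / q := by positivity
  have hs : α / p + (β - 1) / q + 1 / q = 1 := by
    rw [← h.sum_eq]; ring
  have key := Real.geom_mean_le_arith_mean3_weighted h1 h2 h3 ha hb hz hs
  rw [← Real.rpow_mul (abs_nonneg _), ← Real.rpow_mul (abs_nonneg _),
    ← Real.rpow_mul (abs_nonneg _), mul_div_cancel₀ _ hp.ne',
    mul_div_cancel₀ _ hq.ne', mul_div_cancel₀ _ hq.ne', Real.rpow_one] at key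
  have h4 : α / p ≤ 1 := by linarith
  have h5 : (β - 1) / q ≤ 1 := by linarith
  have h6 : 1 / q ≤ 1 := by linarith
  nlinarith

theorem rpow_le_one_add (h : Exponents p q α β) (a : ℝ) : |a| ^ α ≤ 1 + |a| ^ p := by
  rcases le_total |a| 1 with h1 | h1
  · have := Real.rpow_le_one (abs_nonneg a) h1 h.α_pos.le
    have : 0 ≤ |a| ^ p := by positivity
    linarith
  · have := Real.rpow_le_rpow_of_exponent_le h1 h.α_le_p
    linarith

end Exponents

variable {X : Type*} [MeasurableSpace X] {μ : Measure X} [IsFiniteMeasure μ]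

theorem integrable_of_growth (hp : 1 < p) (hq : 1 < q) {F : ℝ → ℝ → ℝ}
    (hF : Continuous fun z : ℝ × ℝ => F z.1 z.2) {C : ℝ}
    (hC : ∀ a b, |F a b| ≤ C * (1 + |a| ^ p + |b| ^ q)) {u v : X → ℝ}
    (hu : MemLp u (ENNReal.ofReal p) μ) (hv : MemLp v (ENNReal.ofReal q) μ) :
    Integrable (fun x => F (u x) (v x)) μ :=
  ((((integrable_const 1).add (hu.integrable_rpow hp)).add (hv.integrable_rpow hq)).const_mul
    C).mono' (hF.comp_aestronglyMeasurable (hu.1.prodMk hv.1))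
    (Eventually.of_forall fun _ => hC _ _)

/-- Generalized dominated convergence. The difference is not dominated by a fixed function, but
after subtracting r_n, a multiple of |f_n − u|^p and |g_n − v|^q with vanishing integral, its
positive part is. -/
theorem tendsto_integral_of_growth_ae (hp : 1 < p) (hq : 1 < q) {F : ℝ → ℝ → ℝ}
    (hF : Continuous fun z : ℝ × ℝ => F z.1 z.2) {C : ℝ} (hC0 : 0 ≤ C)
    (hC : ∀ a b, |F a b| ≤ C * (1 + |a| ^ p + |b| ^ q)) {f g : ℕ → X → ℝ} {u v : X → ℝ}
    (hf : ∀ n, MemLp (f n) (ENNReal.ofReal p) μ) (hg : ∀ n, MemLp (g n) (ENNReal.ofReal q) μ)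
    (hu : MemLp u (ENNReal.ofReal p) μ) (hv : MemLp v (ENNReal.ofReal q) μ)
    (hfu : Tendsto (fun n => eLpNorm (fun x => f n x - u x) (ENNReal.ofReal p) μ) atTop (𝓝 0))
    (hgv : Tendsto (fun n => eLpNorm (fun x => g n x - v x) (ENNReal.ofReal q) μ) atTop (𝓝 0))
    (hfa : ∀ᵐ x ∂μ, Tendsto (fun n => f n x) atTop (𝓝 (u x)))
    (hga : ∀ᵐ x ∂μ, Tendsto (fun n => g n x) atTop (𝓝 (v x))) :
    Tendsto (fun n => ∫ x, F (f n x) (g n x) ∂μ) atTop (𝓝 (∫ x, F (u x) (v x) ∂μ)) := by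
  have hfu' := (tendsto_eLpNorm_zero_iff hp fun n => (hf n).sub hu).1 hfu
  have hgv' := (tendsto_eLpNorm_zero_iff hq fun n => (hg n).sub hv).1 hgv
  have iF := fun n => integrable_of_growth hp hq hF hC (hf n) (hg n)
  have iF0 := integrable_of_growth hp hq hF hC hu hv
  set A : ℝ := 2 ^ (p - 1)
  set B : ℝ := 2 ^ (q - 1)
  have hA0 : 0 < A := by positivity
  have hB0 : 0 < B := by positivity
  set r : ℕ → X → ℝ := fun n x => C * (A * ‖f n x - u x‖ ^ p + B * ‖g n x - v x‖ ^ q) with hr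
  set D : ℕ → X → ℝ := fun n x => |F (f n x) (g n x) - F (u x) (v x)| with hD
  have ir1 : ∀ n, Integrable (fun x => ‖f n x - u x‖ ^ p) μ := fun n =>
    ((hf n).sub hu).integrable_rpow hp
  have ir2 : ∀ n, Integrable (fun x => ‖g n x - v x‖ ^ q) μ := fun n =>
    ((hg n).sub hv).integrable_rpow hq
  have ir : ∀ n, Integrable (r n) μ := fun n =>
    (((ir1 n).const_mul A).add ((ir2 n).const_mul B)).const_mul C
  have hr0 : ∀ n x, 0 ≤ r n x := fun n x => by simp only [hr]; positivity
  have iD : ∀ n, Integrable (D n) μ := fun n => ((iF n).sub iF0).abs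
  have hrlim : Tendsto (fun n => ∫ x, r n x ∂μ) atTop (𝓝 0) := by
    have := ((hfu'.const_mul A).add (hgv'.const_mul B)).const_mul C
    simp only [mul_zero, add_zero] at this
    refine this.congr fun n => ?_
    rw [integral_const_mul, integral_add ((ir1 n).const_mul A) ((ir2 n).const_mul B),
      integral_const_mul, integral_const_mul]
    rfl
  have hm : Tendsto (fun n => ∫ x, max (D n x - r n x) 0 ∂μ) atTop (𝓝 (∫ _x, (0 : ℝ) ∂μ)) := by
    refine tendsto_integral_of_dominated_convergence
      (fun x => C * (2 + (A + 1) * ‖u x‖ ^ p + (B + 1) * ‖v x‖ ^ q))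
      (fun n => (((iD n).sub (ir n)).sup (integrable_zero X ℝ μ)).1)
      ((((integrable_const 2).add ((hu.integrable_rpow hp).const_mul _)).add
        ((hv.integrable_rpow hq).const_mul _)).const_mul C)
      (fun n => Eventually.of_forall fun x => ?_) ?_
    · rw [Real.norm_of_nonneg (le_max_right _ _)]
      have e1 : |f n x| ^ p ≤ A * (‖f n x - u x‖ ^ p + ‖u x‖ ^ p) := by
        refine (Real.rpow_le_rpow (abs_nonneg _) ?_ (by linarith)).trans
          (add_rpow_le_mul_rpow_add_rpow (norm_nonneg _) (norm_nonneg _) hp.le)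
        simpa using norm_add_le (f n x - u x) (u x)
      have e2 : |g n x| ^ q ≤ B * (‖g n x - v x‖ ^ q + ‖v x‖ ^ q) := by
        refine (Real.rpow_le_rpow (abs_nonneg _) ?_ (by linarith)).trans
          (add_rpow_le_mul_rpow_add_rpow (norm_nonneg _) (norm_nonneg _) hq.le)
        simpa using norm_add_le (g n x - v x) (v x)
      refine max_le ?_ (by positivity)
      have e3 : D n x ≤ C * (1 + |f n x| ^ p + |g n x| ^ q) + C * (1 + |u x| ^ p + |v x| ^ q) :=
        (abs_sub _ _).trans (add_le_add (hC _ _) (hC _ _))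
      have e4 := mul_le_mul_of_nonneg_left (add_le_add e1 e2) hC0
      simp only [hr, Real.norm_eq_abs] at e4 ⊢
      linarith
    · filter_upwards [hfa, hga] with x h1 h2
      have h3 : Tendsto (fun n => D n x) atTop (𝓝 0) := by
        have := ((hF.tendsto (u x, v x)).comp (h1.prodMk_nhds h2)).sub_const (F (u x) (v x))
        simpa using this.abs
      refine squeeze_zero (fun n => le_max_right _ _) (fun n => max_le ?_ (abs_nonneg _)) h3
      linarith [hr0 n x]
  have hlim : Tendsto (fun n => ∫ x, D n x ∂μ) atTop (𝓝 0) := by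
    have := hm.add hrlim
    simp only [integral_zero, add_zero] at this
    refine squeeze_zero (fun n => integral_nonneg fun x => abs_nonneg _) (fun n => ?_) this
    have im := ((iD n).sub (ir n)).sup (integrable_zero X ℝ μ)
    have e := integral_add im (ir n)
    refine le_trans (integral_mono (iD n) (im.add (ir n)) fun x => ?_) (le_of_eq e)
    have := le_max_left (D n x - r n x) 0
    simp only [Pi.add_apply, Pi.sup_apply, Pi.sub_apply, Pi.zero_apply]
    linarith
  rw [tendsto_iff_norm_sub_tendsto_zero]
  refine squeeze_zero (fun n => norm_nonneg _) (fun n => ?_) hlim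
  rw [← integral_sub (iF n) iF0]
  exact norm_integral_le_integral_norm _

/-- Continuity of integral functionals with `(p, q)`-growth. -/
theorem tendsto_integral_of_growth {ι : Type*} {l : Filter ι} [l.IsCountablyGenerated]
    (hp : 1 < p) (hq : 1 < q) {F : ℝ → ℝ → ℝ}
    (hF : Continuous fun z : ℝ × ℝ => F z.1 z.2) {C : ℝ} (hC0 : 0 ≤ C)
    (hC : ∀ a b, |F a b| ≤ C * (1 + |a| ^ p + |b| ^ q)) {f g : ι → X → ℝ} {u v : X → ℝ}
    (hf : ∀ n, MemLp (f n) (ENNReal.ofReal p) μ) (hg : ∀ n, MemLp (g n) (ENNReal.ofReal q) μ)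
    (hu : MemLp u (ENNReal.ofReal p) μ) (hv : MemLp v (ENNReal.ofReal q) μ)
    (hfu : Tendsto (fun n => eLpNorm (fun x => f n x - u x) (ENNReal.ofReal p) μ) l (𝓝 0))
    (hgv : Tendsto (fun n => eLpNorm (fun x => g n x - v x) (ENNReal.ofReal q) μ) l (𝓝 0)) :
    Tendsto (fun n => ∫ x, F (f n x) (g n x) ∂μ) l (𝓝 (∫ x, F (u x) (v x) ∂μ)) := by
  refine tendsto_of_subseq_tendsto fun ns hns => ?_
  obtain ⟨a, ha, hae⟩ := exists_subseq_tendsto_ae hp (fun n => (hf (ns n)).1) hu.1 (hfu.comp hns)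
  have hns' := hns.comp ha.tendsto_atTop
  obtain ⟨b, hb, hbe⟩ := exists_subseq_tendsto_ae hq (fun n => (hg (ns (a n))).1) hv.1
    (hgv.comp hns')
  have hns'' := hns'.comp hb.tendsto_atTop
  refine ⟨a ∘ b, tendsto_integral_of_growth_ae hp hq hF hC0 hC (fun n => hf _) (fun n => hg _)
    hu hv (hfu.comp hns'') (hgv.comp hns'') ?_ hbe⟩
  filter_upwards [hae] with x hx using hx.comp hb.tendsto_atTop

end Growth

/-! ### Coupling and constraint under shifts of v -/

section Coupling

variable {X : Type*} [MeasurableSpace X]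

/-- The coupling term `∫ |u|^α |v|^β`. -/
def coupling (μ : Measure X) (α β : ℝ) (u v : X → ℝ) : ℝ := ∫ x, |u x| ^ α * |v x| ^ β ∂μ

/-- The constraint term `∫ |u|^α |v|^{β-2} v`. -/
def constraint (μ : Measure X) (α β : ℝ) (u v : X → ℝ) : ℝ :=
  ∫ x, |u x| ^ α * (|v x| ^ (β - 2) * v x) ∂μ

variable {μ : Measure X} {p q α β : ℝ} {u v z : X → ℝ}

theorem Exponents.continuous_coupling (h : Exponents p q α β) :
    Continuous fun z : ℝ × ℝ => |z.1| ^ α * |z.2| ^ β :=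
  (continuous_fst.abs.rpow_const fun _ => Or.inr h.α_pos.le).mul
    (continuous_snd.abs.rpow_const fun _ => Or.inr h.β_pos.le)

theorem Exponents.continuous_constraint (h : Exponents p q α β) :
    Continuous fun z : ℝ × ℝ => |z.1| ^ α * (|z.2| ^ (β - 2) * z.2) :=
  (continuous_fst.abs.rpow_const fun _ => Or.inr h.α_pos.le).mul
    ((continuous_abs_rpow_sub_two_mul h.one_lt_β).comp continuous_snd)

theorem Exponents.coupling_growth (h : Exponents p q α β) (a b : ℝ) :
    |(|a| ^ α * |b| ^ β)| ≤ 1 * (1 + |a| ^ p + |b| ^ q) := by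
  rw [abs_of_nonneg (by positivity)]
  linarith [h.rpow_mul_rpow_le a b]

theorem Exponents.constraint_growth (h : Exponents p q α β) (a b : ℝ) :
    |(|a| ^ α * (|b| ^ (β - 2) * b))| ≤ 1 * (1 + |a| ^ p + |b| ^ q) := by
  rw [abs_mul, abs_rpow_sub_two_mul h.one_lt_β, abs_of_nonneg (by positivity)]
  have := h.rpow_mul_rpow_mul_le a b 1
  simp only [abs_one, mul_one, Real.one_rpow] at this
  linarith

theorem Exponents.rpow_growth (h : Exponents p q α β) (a b : ℝ) :
    |(|a| ^ α)| ≤ 1 * (1 + |a| ^ p + |b| ^ q) := by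
  rw [abs_of_nonneg (by positivity)]
  have : 0 ≤ |b| ^ q := by positivity
  linarith [h.rpow_le_one_add a]

theorem coupling_nonneg (u v : X → ℝ) : 0 ≤ coupling μ α β u v :=
  integral_nonneg fun x => by positivity

theorem coupling_scale {s t : ℝ} (hs : 0 < s) (ht : 0 < t) (u v : X → ℝ) :
    coupling μ α β (fun x => s * u x) (fun x => t * v x) = s ^ α * t ^ β * coupling μ α β u v := by
  rw [coupling, coupling, ← integral_const_mul]
  congr 1; ext x
  rw [abs_mul, abs_mul, abs_of_pos hs, abs_of_pos ht, Real.mul_rpow hs.le (abs_nonneg _),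
    Real.mul_rpow ht.le (abs_nonneg _)]
  ring

theorem constraint_scale {s t : ℝ} (hs : 0 < s) (ht : 0 < t) (u v : X → ℝ) :
    constraint μ α β (fun x => s * u x) (fun x => t * v x) =
      s ^ α * t ^ (β - 1) * constraint μ α β u v := by
  rw [constraint, constraint, ← integral_const_mul]
  congr 1; ext x
  rw [abs_rpow_sub_two_mul_smul ht, abs_mul, abs_of_pos hs, Real.mul_rpow hs.le (abs_nonneg _)]
  ring

variable [IsFiniteMeasure μ]

theorem Exponents.integrable_coupling (h : Exponents p q α β) (hu : MemLp u (ENNReal.ofReal p) μ)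
    (hv : MemLp v (ENNReal.ofReal q) μ) : Integrable (fun x => |u x| ^ α * |v x| ^ β) μ :=
  integrable_of_growth (F := fun a b => |a| ^ α * |b| ^ β) h.one_lt_p h.one_lt_q
    h.continuous_coupling h.coupling_growth hu hv

theorem Exponents.integrable_constraint (h : Exponents p q α β)
    (hu : MemLp u (ENNReal.ofReal p) μ) (hv : MemLp v (ENNReal.ofReal q) μ) :
    Integrable (fun x => |u x| ^ α * (|v x| ^ (β - 2) * v x)) μ :=
  integrable_of_growth (F := fun a b => |a| ^ α * (|b| ^ (β - 2) * b)) h.one_lt_p h.one_lt_q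
    h.continuous_constraint h.constraint_growth hu hv

theorem Exponents.integrable_rpow (h : Exponents p q α β)
    (hu : MemLp u (ENNReal.ofReal p) μ) : Integrable (fun x => |u x| ^ α) μ :=
  integrable_of_growth (q := q) (F := fun a _ => |a| ^ α) h.one_lt_p h.one_lt_q
    (continuous_fst.abs.rpow_const fun _ => Or.inr h.α_pos.le) h.rpow_growth hu (memLp_const 0)

theorem Exponents.integrable_constraint_mul (h : Exponents p q α β)
    (hu : MemLp u (ENNReal.ofReal p) μ) (hv : MemLp v (ENNReal.ofReal q) μ)
    (hz : MemLp z (ENNReal.ofReal q) μ) :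
    Integrable (fun x => |u x| ^ α * (|v x| ^ (β - 2) * v x) * z x) μ := by
  refine (((hu.integrable_rpow h.one_lt_p).add (hv.integrable_rpow h.one_lt_q)).add
    (hz.integrable_rpow h.one_lt_q)).mono'
    ((h.integrable_constraint hu hv).1.mul hz.1) (Eventually.of_forall fun x => ?_)
  rw [norm_mul, Real.norm_eq_abs, abs_mul, abs_rpow_sub_two_mul h.one_lt_β,
    abs_of_nonneg (by positivity : 0 ≤ |u x| ^ α)]
  exact h.rpow_mul_rpow_mul_le _ _ _

theorem Exponents.tendsto_coupling (h : Exponents p q α β) {ι : Type*} {l : Filter ι}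
    [l.IsCountablyGenerated] {f g : ι → X → ℝ}
    (hf : ∀ n, MemLp (f n) (ENNReal.ofReal p) μ) (hg : ∀ n, MemLp (g n) (ENNReal.ofReal q) μ)
    (hu : MemLp u (ENNReal.ofReal p) μ) (hv : MemLp v (ENNReal.ofReal q) μ)
    (hfu : Tendsto (fun n => eLpNorm (fun x => f n x - u x) (ENNReal.ofReal p) μ) l (𝓝 0))
    (hgv : Tendsto (fun n => eLpNorm (fun x => g n x - v x) (ENNReal.ofReal q) μ) l (𝓝 0)) :
    Tendsto (fun n => coupling μ α β (f n) (g n)) l (𝓝 (coupling μ α β u v)) :=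
  tendsto_integral_of_growth (F := fun a b => |a| ^ α * |b| ^ β) h.one_lt_p h.one_lt_q
    h.continuous_coupling zero_le_one h.coupling_growth hf hg hu hv hfu hgv

theorem Exponents.tendsto_constraint (h : Exponents p q α β) {ι : Type*} {l : Filter ι}
    [l.IsCountablyGenerated] {f g : ι → X → ℝ}
    (hf : ∀ n, MemLp (f n) (ENNReal.ofReal p) μ) (hg : ∀ n, MemLp (g n) (ENNReal.ofReal q) μ)
    (hu : MemLp u (ENNReal.ofReal p) μ) (hv : MemLp v (ENNReal.ofReal q) μ)
    (hfu : Tendsto (fun n => eLpNorm (fun x => f n x - u x) (ENNReal.ofReal p) μ) l (𝓝 0))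
    (hgv : Tendsto (fun n => eLpNorm (fun x => g n x - v x) (ENNReal.ofReal q) μ) l (𝓝 0)) :
    Tendsto (fun n => constraint μ α β (f n) (g n)) l (𝓝 (constraint μ α β u v)) :=
  tendsto_integral_of_growth (F := fun a b => |a| ^ α * (|b| ^ (β - 2) * b)) h.one_lt_p h.one_lt_q
    h.continuous_constraint zero_le_one h.constraint_growth hf hg hu hv hfu hgv

theorem Exponents.tendsto_integral_rpow (h : Exponents p q α β) {ι : Type*} {l : Filter ι}
    [l.IsCountablyGenerated] {f : ι → X → ℝ} (hf : ∀ n, MemLp (f n) (ENNReal.ofReal p) μ)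
    (hu : MemLp u (ENNReal.ofReal p) μ)
    (hfu : Tendsto (fun n => eLpNorm (fun x => f n x - u x) (ENNReal.ofReal p) μ) l (𝓝 0)) :
    Tendsto (fun n => ∫ x, |f n x| ^ α ∂μ) l (𝓝 (∫ x, |u x| ^ α ∂μ)) :=
  tendsto_integral_of_growth (q := q) (F := fun a _ => |a| ^ α) (g := fun _ _ => 0)
    (v := fun _ => 0) h.one_lt_p h.one_lt_q
    (continuous_fst.abs.rpow_const fun _ => Or.inr h.α_pos.le) zero_le_one h.rpow_growth hf
    (fun _ => memLp_const 0) hu (memLp_const 0) hfu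
    (by simpa using tendsto_const_nhds)

theorem Exponents.integral_rpow_eq_zero_iff (h : Exponents p q α β)
    (hu : MemLp u (ENNReal.ofReal p) μ) : ∫ x, |u x| ^ α ∂μ = 0 ↔ ∀ᵐ x ∂μ, u x = 0 := by
  rw [integral_eq_zero_iff_of_nonneg (fun x => by positivity) (h.integrable_rpow hu)]
  refine eventually_congr (Eventually.of_forall fun x => ?_)
  simp [Real.rpow_eq_zero (abs_nonneg (u x)) h.α_pos.ne']

theorem Exponents.coupling_eq_zero_iff (h : Exponents p q α β)
    (hu : MemLp u (ENNReal.ofReal p) μ) (hv : MemLp v (ENNReal.ofReal q) μ) :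
    coupling μ α β u v = 0 ↔ ∀ᵐ x ∂μ, u x * v x = 0 := by
  rw [coupling, integral_eq_zero_iff_of_nonneg (fun x => by positivity)
    (h.integrable_coupling hu hv)]
  refine eventually_congr (Eventually.of_forall fun x => ?_)
  simp [Real.rpow_eq_zero (abs_nonneg _) h.α_pos.ne', Real.rpow_eq_zero (abs_nonneg _) h.β_pos.ne']

theorem Exponents.coupling_tangent_le (h : Exponents p q α β)
    (hu : MemLp u (ENNReal.ofReal p) μ) (hv : MemLp v (ENNReal.ofReal q) μ)
    (hz : MemLp z (ENNReal.ofReal q) μ) :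
    coupling μ α β u v + β * ∫ x, |u x| ^ α * (|v x| ^ (β - 2) * v x) * z x ∂μ ≤
      coupling μ α β u (fun x => v x + z x) := by
  rw [coupling, coupling, ← integral_const_mul, ← integral_add (h.integrable_coupling hu hv)
    ((h.integrable_constraint_mul hu hv hz).const_mul β)]
  refine integral_mono ((h.integrable_coupling hu hv).add
    ((h.integrable_constraint_mul hu hv hz).const_mul β))
    (h.integrable_coupling hu (hv.add hz)) fun x => ?_
  have := mul_le_mul_of_nonneg_left (abs_rpow_tangent_le h.one_lt_β (v x) (z x))
    (by positivity : 0 ≤ |u x| ^ α)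
  simp only
  linarith

/-- The slope in the shift c at 0 is β times the constraint. So a pair satisfying the constraint
minimizes the coupling among the shifts of v. -/
theorem Exponents.coupling_tangent_const_le (h : Exponents p q α β)
    (hu : MemLp u (ENNReal.ofReal p) μ) (hv : MemLp v (ENNReal.ofReal q) μ) (c : ℝ) :
    coupling μ α β u v + β * (constraint μ α β u v * c) ≤
      coupling μ α β u (fun x => v x + c) := by
  have := h.coupling_tangent_le hu hv (memLp_const c)
  rwa [integral_mul_const] at this

/-- Among the shifts of `v`, the coupling is strictly minimal where the constraint holds. -/
theorem Exponents.coupling_lt_of_constraint (h : Exponents p q α β)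
    (hu : MemLp u (ENNReal.ofReal p) μ) (hv : MemLp v (ENNReal.ofReal q) μ)
    (hc : constraint μ α β u v = 0) (hu0 : ¬ ∀ᵐ x ∂μ, u x = 0) {c : ℝ} (hc0 : c ≠ 0) :
    coupling μ α β u v < coupling μ α β u (fun x => v x + c) := by
  have hle := h.coupling_tangent_const_le hu hv c
  rw [hc, zero_mul, mul_zero, add_zero] at hle
  refine lt_of_le_of_ne hle fun heq => hu0 ?_
  have i1 := h.integrable_coupling hu hv
  have i2 : Integrable (fun x => |u x| ^ α * |v x + c| ^ β) μ :=
    h.integrable_coupling hu (hv.add (memLp_const c))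
  have i3 := (h.integrable_constraint hu hv).const_mul (β * c)
  have i13 : Integrable (fun x => |u x| ^ α * |v x| ^ β +
      β * c * (|u x| ^ α * (|v x| ^ (β - 2) * v x))) μ := i1.add i3
  have i : Integrable (fun x => |u x| ^ α * |v x + c| ^ β - (|u x| ^ α * |v x| ^ β +
      β * c * (|u x| ^ α * (|v x| ^ (β - 2) * v x)))) μ := i2.sub i13
  have hz : ∫ x, (|u x| ^ α * |v x + c| ^ β -
      (|u x| ^ α * |v x| ^ β + β * c * (|u x| ^ α * (|v x| ^ (β - 2) * v x)))) ∂μ = 0 := by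
    rw [integral_sub i2 i13, integral_add i1 i3, integral_const_mul]
    have e1 : ∫ x, |u x| ^ α * |v x| ^ β ∂μ = coupling μ α β u v := rfl
    have e2 : ∫ x, |u x| ^ α * |v x + c| ^ β ∂μ = coupling μ α β u (fun x => v x + c) := rfl
    have e3 : ∫ x, |u x| ^ α * (|v x| ^ (β - 2) * v x) ∂μ = constraint μ α β u v := rfl
    rw [e1, e2, e3, hc, heq]; ring
  have e : ∀ x, |u x| ^ α * |v x + c| ^ β -
      (|u x| ^ α * |v x| ^ β + β * c * (|u x| ^ α * (|v x| ^ (β - 2) * v x))) =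
      |u x| ^ α * (|v x + c| ^ β - (|v x| ^ β + β * (|v x| ^ (β - 2) * v x) * c)) := fun x => by ring
  rw [integral_eq_zero_iff_of_nonneg (fun x => ?_) i] at hz
  · filter_upwards [hz] with x hx
    simp only [Pi.zero_apply, e] at hx
    have hpos := sub_pos.2 (abs_rpow_tangent_lt h.one_lt_β (v x) hc0)
    have := (mul_eq_zero.1 hx).resolve_right hpos.ne'
    simpa [Real.rpow_eq_zero (abs_nonneg (u x)) h.α_pos.ne'] using this
  · simp only [e, Pi.zero_apply]
    exact mul_nonneg (by positivity)
      (sub_nonneg.2 (abs_rpow_tangent_le h.one_lt_β (v x) c))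

/-- Integration of |c|^β ≤ 2^(β−1) (|v + c|^β + |v|^β) against |u|^α. It serves to discard large
shifts uniformly along a sequence. -/
theorem Exponents.coupling_coercive (h : Exponents p q α β)
    (hu : MemLp u (ENNReal.ofReal p) μ) (hv : MemLp v (ENNReal.ofReal q) μ) (c : ℝ) :
    |c| ^ β * ∫ x, |u x| ^ α ∂μ ≤ 2 ^ (β - 1) *
      (coupling μ α β u (fun x => v x + c) + coupling μ α β u v) := by
  have i1 := h.integrable_coupling hu hv
  have i2 : Integrable (fun x => |u x| ^ α * |v x + c| ^ β) μ :=
    h.integrable_coupling hu (hv.add (memLp_const c))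
  rw [coupling, coupling, ← integral_const_mul, ← integral_add i2 i1, ← integral_const_mul]
  refine integral_mono ((h.integrable_rpow hu).const_mul _) ((i2.add i1).const_mul _) fun x => ?_
  have h1 : |c| ^ β ≤ 2 ^ (β - 1) * (|v x + c| ^ β + |v x| ^ β) := by
    have := norm_sub_rpow_le (a := v x + c) (b := v x) h.one_lt_β
    simpa using this
  have := mul_le_mul_of_nonneg_left h1 (by positivity : 0 ≤ |u x| ^ α)
  simp only
  linarith

theorem constraint_add_const_continuous (h : Exponents p q α β)
    (hu : MemLp u (ENNReal.ofReal p) μ) (hv : MemLp v (ENNReal.ofReal q) μ) :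
    Continuous fun c : ℝ => constraint μ α β u (fun x => v x + c) := by
  rw [continuous_iff_continuousAt]
  intro c
  refine h.tendsto_constraint (f := fun _ => u) (fun _ => hu) (fun c => hv.add (memLp_const c)) hu
    (hv.add (memLp_const c)) (by simp) ?_
  have hq0 := h.q_pos
  refine (tendsto_eLpNorm_zero_iff h.one_lt_q fun b =>
    (hv.add (memLp_const b)).sub (hv.add (memLp_const c))).2 ?_
  have h1 : Tendsto (fun b : ℝ => ‖b - c‖ ^ q * μ.real Set.univ) (𝓝 c) (𝓝 0) := by
    have hc : Continuous fun b : ℝ => ‖b - c‖ ^ q * μ.real Set.univ :=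
      ((continuous_id.sub continuous_const).norm.rpow_const fun _ => Or.inr hq0.le).mul_const _
    simpa [Real.zero_rpow hq0.ne'] using hc.tendsto c
  refine h1.congr fun b => ?_
  simp [mul_comm]

/-- Every `v` can be shifted by a constant so as to satisfy the constraint. -/
theorem Exponents.exists_constraint_eq_zero (h : Exponents p q α β)
    (hu : MemLp u (ENNReal.ofReal p) μ) (hv : MemLp v (ENNReal.ofReal q) μ) :
    ∃ c : ℝ, constraint μ α β u (fun x => v x + c) = 0 := by
  by_cases hu0 : ∀ᵐ x ∂μ, u x = 0
  · refine ⟨0, ?_⟩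
    rw [constraint, integral_eq_zero_of_ae]
    filter_upwards [hu0] with x hx
    simp [hx, Real.zero_rpow h.α_pos.ne']
  have ha : 0 < ∫ x, |u x| ^ α ∂μ :=
    lt_of_le_of_ne (integral_nonneg fun x => by positivity)
      fun e => hu0 ((h.integral_rpow_eq_zero_iff hu).1 e.symm)
  -- By homogeneity, the constraint at v + (n+1)σ has the sign of the constraint at v/(n+1) + σ,
  -- which for σ = ±1 tends to ±∫ |u|^α. This gives the sign change for the intermediate value
  -- theorem.
  have hs : ∀ σ : ℝ, Tendsto (fun n : ℕ => constraint μ α β u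
      (fun x => 1 / ((n : ℝ) + 1) * v x + σ)) atTop (𝓝 (constraint μ α β u (fun _ => σ))) :=
    fun σ => by
    refine h.tendsto_constraint (fun _ => hu) (fun n => (hv.const_mul _).add (memLp_const σ)) hu
      (memLp_const σ) (by simp) ?_
    have := ENNReal.Tendsto.mul_const (b := eLpNorm v (ENNReal.ofReal q) μ)
      (ENNReal.tendsto_ofReal (tendsto_one_div_add_atTop_nhds_zero_nat (𝕜 := ℝ)))
      (Or.inr hv.eLpNorm_ne_top)
    rw [ENNReal.ofReal_zero, zero_mul] at this
    refine this.congr fun n => ?_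
    have e : (fun x => 1 / ((n : ℝ) + 1) * v x + σ - σ) = (1 / ((n : ℝ) + 1)) • v := by
      ext x; simp
    rw [e, eLpNorm_const_smul, Real.enorm_of_nonneg (by positivity)]
  have hscale : ∀ (σ : ℝ) (n : ℕ), constraint μ α β u (fun x => v x + ((n : ℝ) + 1) * σ) =
      ((n : ℝ) + 1) ^ (β - 1) * constraint μ α β u (fun x => 1 / ((n : ℝ) + 1) * v x + σ) :=
    fun σ n => by
    rw [constraint, constraint, ← integral_const_mul]
    congr 1; ext x
    have hn : (0 : ℝ) < (n : ℝ) + 1 := by positivity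
    have e : v x + ((n : ℝ) + 1) * σ = ((n : ℝ) + 1) * (1 / ((n : ℝ) + 1) * v x + σ) := by
      field_simp
    rw [e, abs_rpow_sub_two_mul_smul hn]; ring
  have hc1 : constraint μ α β u (fun _ => (1 : ℝ)) = ∫ x, |u x| ^ α ∂μ := by simp [constraint]
  have hc2 : constraint μ α β u (fun _ => (-1 : ℝ)) = -∫ x, |u x| ^ α ∂μ := by
    simp [constraint, integral_neg]
  obtain ⟨n, hn⟩ := ((hs 1).eventually (lt_mem_nhds (a := 0) (by rw [hc1]; exact ha))).exists
  obtain ⟨m, hm⟩ := ((hs (-1)).eventually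
    (gt_mem_nhds (show constraint μ α β u (fun _ => (-1 : ℝ)) < 0 by rw [hc2]; linarith))).exists
  have h1 : 0 ≤ constraint μ α β u (fun x => v x + ((n : ℝ) + 1) * 1) := by
    rw [hscale]; exact mul_nonneg (by positivity) hn.le
  have h2 : constraint μ α β u (fun x => v x + ((m : ℝ) + 1) * (-1)) ≤ 0 := by
    rw [hscale]; exact mul_nonpos_of_nonneg_of_nonpos (by positivity) hm.le
  exact mem_range_of_exists_le_of_exists_ge (constraint_add_const_continuous h hu hv)
    ⟨_, h2⟩ ⟨_, h1⟩

/-- Lower semicontinuity of `min_c ∫ |u|^α |v + c|^β`. -/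
theorem Exponents.eventually_le_coupling (h : Exponents p q α β) {ι : Type*} {l : Filter ι}
    [l.IsCountablyGenerated] {f g : ι → X → ℝ}
    (hf : ∀ n, MemLp (f n) (ENNReal.ofReal p) μ) (hg : ∀ n, MemLp (g n) (ENNReal.ofReal q) μ)
    (hu : MemLp u (ENNReal.ofReal p) μ) (hv : MemLp v (ENNReal.ofReal q) μ)
    (hfu : Tendsto (fun n => eLpNorm (fun x => f n x - u x) (ENNReal.ofReal p) μ) l (𝓝 0))
    (hgv : Tendsto (fun n => eLpNorm (fun x => g n x - v x) (ENNReal.ofReal q) μ) l (𝓝 0))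
    (hu0 : ¬ ∀ᵐ x ∂μ, u x = 0) {m : ℝ} (hm : ∀ c : ℝ, m ≤ coupling μ α β u (fun x => v x + c))
    {ε : ℝ} (hε : 0 < ε) :
    ∀ᶠ n in l, ∀ c : ℝ, m - ε ≤ coupling μ α β (f n) (fun x => g n x + c) := by
  have hβ := h.β_pos
  obtain ⟨c₀, hc₀⟩ := h.exists_constraint_eq_zero hu hv
  have hgc : Tendsto (fun n => eLpNorm (fun x => (g n x + c₀) - (v x + c₀))
      (ENNReal.ofReal q) μ) l (𝓝 0) := by simpa using hgv
  have hg' : ∀ n, MemLp (fun x => g n x + c₀) (ENNReal.ofReal q) μ := fun n =>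
    (hg n).add (memLp_const c₀)
  have hv' : MemLp (fun x => v x + c₀) (ENNReal.ofReal q) μ := hv.add (memLp_const c₀)
  have la := h.tendsto_integral_rpow hf hu hfu
  have lb := h.tendsto_coupling hf hg hu hv hfu hgv
  have ld := h.tendsto_constraint hf hg' hu hv' hfu hgc
  have le := h.tendsto_coupling hf hg' hu hv' hfu hgc
  rw [hc₀] at ld
  set a := ∫ x, |u x| ^ α ∂μ
  set b := coupling μ α β u v
  have ha : 0 < a := lt_of_le_of_ne (integral_nonneg fun x => by positivity)
      fun e => hu0 ((h.integral_rpow_eq_zero_iff hu).1 e.symm)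
  -- Threshold for large shifts: once ∫ |f_n|^α > a/2 and the unshifted coupling is below b + 1,
  -- coercivity makes the coupling at least |m| for |c| ≥ R.
  set R : ℝ := (2 ^ (β - 1) * (|m| + b + 1) / (a / 2)) ^ β⁻¹ with hR
  have hb : 0 ≤ b := coupling_nonneg u v
  have hR0 : 0 ≤ R := by positivity
  have hRβ : R ^ β * (a / 2) = 2 ^ (β - 1) * (|m| + b + 1) := by
    rw [hR, ← Real.rpow_mul (by positivity), inv_mul_cancel₀ hβ.ne', Real.rpow_one]
    field_simp
  have ld' : Tendsto (fun n => β * ((R + |c₀|) * |constraint μ α β (f n) (fun x => g n x + c₀)|)) l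
      (𝓝 0) := by
    simpa using (ld.abs.const_mul (R + |c₀|)).const_mul β
  filter_upwards [la.eventually (lt_mem_nhds (half_lt_self ha)),
    lb.eventually (gt_mem_nhds (lt_add_one b)), ld'.eventually (gt_mem_nhds (half_pos hε)),
    le.eventually (lt_mem_nhds (sub_lt_self (coupling μ α β u fun x => v x + c₀) (half_pos hε)))]
    with n ha' hb' hd' he' c
  rcases le_total R |c| with hc | hc
  · have h1 := h.coupling_coercive (hf n) (hg n) c
    have h2 : R ^ β * (a / 2) ≤ |c| ^ β * ∫ x, |f n x| ^ α ∂μ :=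
      mul_le_mul (Real.rpow_le_rpow hR0 hc hβ.le) ha'.le (by positivity) (by positivity)
    rw [hRβ] at h2
    have h3 := le_of_mul_le_mul_left (h2.trans h1) (by positivity)
    have := le_abs_self m
    linarith
  -- For |c| ≤ R the tangent at the shift c₀ is used: its slope is β times a constraint that tends
  -- to 0, so the error is small uniformly in c.
  · have h1 := h.coupling_tangent_const_le (hf n) (hg' n) (c - c₀)
    simp only [add_add_sub_cancel] at h1
    set d := constraint μ α β (f n) (fun x => g n x + c₀)
    have h2 : -((R + |c₀|) * |d|) ≤ d * (c - c₀) := by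
      have h3 : |d * (c - c₀)| ≤ (R + |c₀|) * |d| := by
        rw [abs_mul, mul_comm]
        gcongr
        exact (abs_sub _ _).trans (by linarith)
      exact (abs_le.1 h3).1
    have h4 := mul_le_mul_of_nonneg_left h2 hβ.le
    have h5 := hm c₀
    linarith

end Coupling

/-! ### The energy functional -/

section Energy

variable {X F : Type*} [MeasurableSpace X] {μ : Measure X} [NormedAddCommGroup F] {p : ℝ}

/-- The energy `∫ ‖G‖^p / p`. -/
def energy (μ : Measure X) (p : ℝ) (G : X → F) : ℝ := ∫ x, ‖G x‖ ^ p / p ∂μ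

theorem energy_eq (μ : Measure X) (p : ℝ) (G : X → F) :
    energy μ p G = (∫ x, ‖G x‖ ^ p ∂μ) / p := integral_div _ _

theorem integral_rpow_eq_mul_energy (hp : 1 < p) (G : X → F) :
    ∫ x, ‖G x‖ ^ p ∂μ = p * energy μ p G := by
  rw [energy_eq, mul_div_cancel₀ _ (by linarith)]

theorem energy_nonneg (hp : 1 < p) (G : X → F) : 0 ≤ energy μ p G :=
  integral_nonneg fun x => by have := hp; positivity

theorem energy_congr {G H : X → F} (h : G =ᵐ[μ] H) : energy μ p G = energy μ p H :=
  integral_congr_ae (by filter_upwards [h] with x hx; rw [hx])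

theorem energy_smul [NormedSpace ℝ F] {s : ℝ} (hs : 0 < s) (G : X → F) :
    energy μ p (fun x => s • G x) = s ^ p * energy μ p G := by
  rw [energy, energy, ← integral_const_mul]
  congr 1; ext x
  rw [norm_smul, Real.norm_of_nonneg hs.le, Real.mul_rpow hs.le (norm_nonneg _), mul_div_assoc]

theorem tendsto_energy [IsFiniteMeasure μ] (hp : 1 < p) {ι : Type*} {l : Filter ι}
    [l.IsCountablyGenerated] {f : ι → X → F} {g : X → F}
    (hf : ∀ n, MemLp (f n) (ENNReal.ofReal p) μ) (hg : MemLp g (ENNReal.ofReal p) μ)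
    (h : Tendsto (fun n => eLpNorm (fun x => f n x - g x) (ENNReal.ofReal p) μ) l (𝓝 0)) :
    Tendsto (fun n => energy μ p (f n)) l (𝓝 (energy μ p g)) := by
  have h1 : Tendsto (fun n => eLpNorm (fun x => ‖f n x‖ - ‖g x‖) (ENNReal.ofReal p) μ) l (𝓝 0) :=
    tendsto_eLpNorm_of_le_mul 1 (fun n x => by
      rw [one_mul]; exact abs_norm_sub_norm_le _ _) h
  have := tendsto_integral_of_growth (q := p) (C := 1) (F := fun a _ => |a| ^ p)
    (f := fun n x => ‖f n x‖) (u := fun x => ‖g x‖) (g := fun _ _ => 0)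
    (v := fun _ => 0) hp hp (continuous_fst.abs.rpow_const fun _ => Or.inr (by linarith))
    zero_le_one (fun a b => by
      rw [abs_of_nonneg (by positivity)]
      have : 0 ≤ |b| ^ p := by positivity
      linarith)
    (fun n => (hf n).norm) (fun _ => memLp_const 0) hg.norm (memLp_const 0) h1
    (by simpa using tendsto_const_nhds)
  simp only [abs_norm] at this
  simpa only [energy_eq] using this.div_const p

end Energy

/-! ### Uniform convexity of the energy -/

section Convexity

variable {X F : Type*} [MeasurableSpace X] {μ : Measure X} [NormedAddCommGroup F]
  [InnerProductSpace ℝ F] {p : ℝ}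

theorem energy_midpoint_le (hp : 1 < p) {a b : X → F} (ha : MemLp a (ENNReal.ofReal p) μ)
    (hb : MemLp b (ENNReal.ofReal p) μ) :
    energy μ p (fun x => (1 / 2 : ℝ) • (a x + b x)) ≤ (energy μ p a + energy μ p b) / 2 := by
  have ia := ha.integrable_rpow hp
  have ib := hb.integrable_rpow hp
  have im := ((ha.add hb).const_smul (1 / 2 : ℝ)).integrable_rpow hp
  have hp0 : 0 < p := by linarith
  rw [energy_eq, energy_eq, energy_eq, ← add_div, div_right_comm]
  refine div_le_div_of_nonneg_right ?_ hp0.le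
  rw [← integral_add ia ib, ← integral_div]
  refine integral_mono im ((ia.add ib).div_const 2) fun x => ?_
  have := (convexOn_norm_rpow (F := F) hp).2 (Set.mem_univ (a x)) (Set.mem_univ (b x))
    (by norm_num : (0 : ℝ) ≤ 1 / 2) (by norm_num : (0 : ℝ) ≤ 1 / 2) (by norm_num)
  simp only [smul_eq_mul, ← smul_add] at this
  simp only
  linarith

theorem integral_sub_rpow_le [FiniteDimensional ℝ F] (hp : 1 < p) {ε : ℝ} (hε : 0 < ε) :
    ∃ C, 0 ≤ C ∧ ∀ a b : X → F, MemLp a (ENNReal.ofReal p) μ → MemLp b (ENNReal.ofReal p) μ →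
      ∫ x, ‖a x - b x‖ ^ p ∂μ ≤ ε * (energy μ p a + energy μ p b) +
        C * ((energy μ p a + energy μ p b) / 2 -
          energy μ p (fun x => (1 / 2 : ℝ) • (a x + b x))) := by
  have hp0 : 0 < p := by linarith
  obtain ⟨C, hC, h⟩ := exists_uniform_convexity (F := F) hp (div_pos hε hp0)
  refine ⟨C * p, by positivity, fun a b ha hb => ?_⟩
  have ia := ha.integrable_rpow hp
  have ib := hb.integrable_rpow hp
  have im : Integrable (fun x => ‖(1 / 2 : ℝ) • (a x + b x)‖ ^ p) μ :=
    ((ha.add hb).const_smul (1 / 2 : ℝ)).integrable_rpow hp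
  have iab : Integrable (fun x => ‖a x‖ ^ p + ‖b x‖ ^ p) μ := ia.add ib
  have id : Integrable (fun x => (‖a x‖ ^ p + ‖b x‖ ^ p) / 2 - ‖(1 / 2 : ℝ) • (a x + b x)‖ ^ p) μ :=
    (iab.div_const 2).sub im
  have key : ∫ x, ‖a x - b x‖ ^ p ∂μ ≤ ∫ x, (ε / p * (‖a x‖ ^ p + ‖b x‖ ^ p) +
      C * ((‖a x‖ ^ p + ‖b x‖ ^ p) / 2 - ‖(1 / 2 : ℝ) • (a x + b x)‖ ^ p)) ∂μ :=
    integral_mono ((ha.sub hb).integrable_rpow hp)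
      ((iab.const_mul _).add (id.const_mul _)) fun x => h (a x) (b x)
  rw [integral_add (iab.const_mul _) (id.const_mul _), integral_const_mul, integral_const_mul,
    integral_sub (iab.div_const 2) im, integral_div, integral_add ia ib,
    integral_rpow_eq_mul_energy hp a, integral_rpow_eq_mul_energy hp b,
    integral_rpow_eq_mul_energy hp (fun x => (1 / 2 : ℝ) • (a x + b x))] at key
  refine key.trans (le_of_eq ?_)
  field_simp

/-- Sequences of bounded energy whose midpoint deficit tends to zero are Cauchy. -/
theorem tendsto_integral_sub_rpow [FiniteDimensional ℝ F] (hp : 1 < p) {ι : Type*} {l : Filter ι}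
    {a b : ι → X → F} (ha : ∀ n, MemLp (a n) (ENNReal.ofReal p) μ)
    (hb : ∀ n, MemLp (b n) (ENNReal.ofReal p) μ) {M : ℝ} (hM : 0 ≤ M)
    (haM : ∀ n, energy μ p (a n) ≤ M)
    (hbM : ∀ n, energy μ p (b n) ≤ M)
    (h : Tendsto (fun n => (energy μ p (a n) + energy μ p (b n)) / 2 -
      energy μ p (fun x => (1 / 2 : ℝ) • (a n x + b n x))) l (𝓝 0)) :
    Tendsto (fun n => ∫ x, ‖a n x - b n x‖ ^ p ∂μ) l (𝓝 0) := by
  rw [Metric.tendsto_nhds]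
  intro ε hε
  obtain ⟨C, hC, hle⟩ := integral_sub_rpow_le (μ := μ) (F := F) hp
    (show 0 < ε / (4 * (M + 1)) by positivity)
  have h' := h.const_mul C
  rw [mul_zero] at h'
  filter_upwards [h'.eventually (gt_mem_nhds (half_pos hε))] with n hn
  have h1 := hle _ _ (ha n) (hb n)
  have h2 : ε / (4 * (M + 1)) * (energy μ p (a n) + energy μ p (b n)) ≤ ε / 2 := by
    calc _ ≤ ε / (4 * (M + 1)) * (2 * (M + 1)) := by
          gcongr; linarith [haM n, hbM n]
      _ = ε / 2 := by field_simp; ring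
  rw [Real.dist_eq, sub_zero, abs_of_nonneg (integral_nonneg fun x => by positivity)]
  linarith

end Convexity

/-! ### The variational inequality and normalization -/

section Variational

variable {Ω : Set (E N)} {p q α β : ℝ} {u v : E N → ℝ} {G H : E N → E N}

theorem rayleigh_eq (hΩ : IsOpen Ω) (hu : HasW0 Ω p u G) (hv : HasW1 Ω q v H) :
    rayleigh Ω p q α β u v = (energy (volume.restrict Ω) p G + energy (volume.restrict Ω) q H) /
      coupling (volume.restrict Ω) α β u v := by
  rw [← energy_congr (weakGradient_ae_eq hΩ hu.grad), ← energy_congr (weakGradient_ae_eq hΩ hv.grad)]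
  rfl

theorem coupling_pos_iff [IsFiniteMeasure (volume.restrict Ω)] (h : Exponents p q α β)
    (hu : HasW0 Ω p u G) (hv : HasW1 Ω q v H) :
    0 < coupling (volume.restrict Ω) α β u v ↔ ProdNontrivial Ω u v := by
  rw [ProdNontrivial, ← h.coupling_eq_zero_iff hu.memLp hv.memLp,
    (coupling_nonneg u v).lt_iff_ne, ne_comm]

theorem rayleigh_nonneg (hp : 1 < p) (hq : 1 < q) (u v : E N → ℝ) :
    0 ≤ rayleigh Ω p q α β u v :=
  div_nonneg (add_nonneg (energy_nonneg hp _) (energy_nonneg hq _)) (coupling_nonneg u v)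

theorem bddBelow_rayleighValues (hp : 1 < p) (hq : 1 < q) :
    BddBelow (rayleighValues Ω p q α β) :=
  ⟨0, by rintro r ⟨u, v, -, rfl⟩; exact rayleigh_nonneg hp hq u v⟩

theorem lambdaInf_nonneg (hp : 1 < p) (hq : 1 < q) : 0 ≤ lambdaInf Ω p q α β :=
  Real.sInf_nonneg (by rintro r ⟨u, v, -, rfl⟩; exact rayleigh_nonneg hp hq u v)

/-- If b(b + c) vanished a.e. in Ω, it would vanish everywhere there by continuity. The value b = 1
at the centre forces c = −1, but b also takes the value 1/2: N ≥ 1 provides a point of the bounding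
sphere, where b = 0, and Ω is connected. -/
theorem exists_testFunction (hN : 1 ≤ N) (hΩ : IsSmoothBoundedDomain Ω) :
    ∃ b : E N → ℝ, IsTestFunction Ω b ∧ ∀ c : ℝ, ProdNontrivial Ω b (fun x => b x + c) := by
  obtain ⟨x₀, hx₀⟩ := hΩ.isConnected.nonempty
  obtain ⟨r, hr, hball⟩ := Metric.nhds_basis_closedBall.mem_iff.1 (hΩ.isOpen.mem_nhds hx₀)
  let b : ContDiffBump x₀ := ⟨r / 2, r, by positivity, by linarith⟩
  have hb : IsTestFunction Ω b := ⟨b.contDiff, b.hasCompactSupport, by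
    rw [b.tsupport_eq]; exact hball⟩
  refine ⟨b, hb, fun c hae => ?_⟩
  have hz : ∀ x ∈ Ω, b x * (b x + c) = 0 :=
    Measure.eqOn_open_of_ae_eq (g := fun _ => (0 : ℝ)) hae hΩ.isOpen
      (b.continuous.mul (b.continuous.add continuous_const)).continuousOn continuousOn_const
  have h1 : b x₀ = 1 := b.one_of_mem_closedBall (by simp [b.rIn_pos.le])
  have hc := hz x₀ hx₀
  rw [h1] at hc
  have hc' : c = -1 := by linarith
  let y : E N := x₀ + EuclideanSpace.single ⟨0, hN⟩ r
  have hy : dist y x₀ = r := by simp [y, dist_eq_norm, abs_of_pos hr]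
  have h0 : b y = 0 := b.zero_of_le_dist hy.ge
  have hyΩ : y ∈ Ω := hball (by simp [hy])
  obtain ⟨z, hzΩ, hz'⟩ := hΩ.isConnected.isPreconnected.intermediate_value hyΩ hx₀
    b.continuous.continuousOn (show (1 / 2 : ℝ) ∈ Set.Icc (b y) (b x₀) by
      rw [h0, h1]; norm_num)
  have := hz z hzΩ
  rw [hz', hc'] at this
  norm_num at this

variable [IsFiniteMeasure (volume.restrict Ω)]

theorem lambdaInf_mul_coupling_le (h : Exponents p q α β) (hΩ : IsOpen Ω) (hu : HasW0 Ω p u G)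
    (hv : HasW1 Ω q v H) (hc : constraint (volume.restrict Ω) α β u v = 0) :
    lambdaInf Ω p q α β * coupling (volume.restrict Ω) α β u v ≤
      energy (volume.restrict Ω) p G + energy (volume.restrict Ω) q H := by
  rcases (coupling_nonneg (μ := volume.restrict Ω) (α := α) (β := β) u v).eq_or_lt with h0 | h0
  · rw [← h0, mul_zero]
    exact add_nonneg (energy_nonneg h.one_lt_p _) (energy_nonneg h.one_lt_q _)
  · rw [← le_div_iff₀ h0, ← rayleigh_eq hΩ hu hv]
    exact csInf_le (bddBelow_rayleighValues h.one_lt_p h.one_lt_q)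
      ⟨u, v, ⟨hu.memW1Zero hΩ, hv.memW1, (coupling_pos_iff h hu hv).1 h0, hc⟩, rfl⟩

/-- The variational inequality without the constraint. -/
theorem lambdaInf_mul_le (h : Exponents p q α β) (hΩ : IsOpen Ω) (hu : HasW0 Ω p u G)
    (hv : HasW1 Ω q v H) {m : ℝ}
    (hm : ∀ c : ℝ, m ≤ coupling (volume.restrict Ω) α β u (fun x => v x + c)) :
    lambdaInf Ω p q α β * m ≤
      energy (volume.restrict Ω) p G + energy (volume.restrict Ω) q H := by
  -- The shift that restores the constraint changes neither the gradient nor the lower bound m,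
  -- which holds for all shifts.
  obtain ⟨c, hc⟩ := h.exists_constraint_eq_zero hu.memLp hv.memLp
  exact (mul_le_mul_of_nonneg_left (hm c) (lambdaInf_nonneg h.one_lt_p h.one_lt_q)).trans
    (lambdaInf_mul_coupling_le h hΩ hu (hv.add_const c) hc)

theorem rayleighValues_nonempty (hN : 1 ≤ N) (hΩ : IsSmoothBoundedDomain Ω)
    (h : Exponents p q α β) : (rayleighValues Ω p q α β).Nonempty := by
  obtain ⟨b, hb, hnt⟩ := exists_testFunction hN hΩ
  obtain ⟨c, hc⟩ := h.exists_constraint_eq_zero (hb.hasW1 (p := p)).memLp (hb.hasW1 (p := q)).memLp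
  exact ⟨_, b, fun x => b x + c, ⟨hb.hasW0.memW1Zero hΩ.isOpen, (hb.hasW1.add_const c).memW1,
    hnt c, hc⟩, rfl⟩

theorem Exponents.rpow_normalize (h : Exponents p q α β) {I : ℝ} (hI : 0 < I) :
    (I ^ (-(1 / p))) ^ α * (I ^ (-(1 / q))) ^ β = I⁻¹ := by
  rw [← Real.rpow_mul hI.le, ← Real.rpow_mul hI.le, ← Real.rpow_add hI, ← Real.rpow_neg_one]
  congr 1
  linear_combination -h.sum_eq

/-- Admissible pairs can be normalized so that the coupling is `1`. -/
theorem exists_normalized (h : Exponents p q α β) (hΩ : IsOpen Ω) {r : ℝ}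
    (hr : r ∈ rayleighValues Ω p q α β) :
    ∃ u v G H, HasW0 Ω p u G ∧ HasW1 Ω q v H ∧ constraint (volume.restrict Ω) α β u v = 0 ∧
      coupling (volume.restrict Ω) α β u v = 1 ∧
      energy (volume.restrict Ω) p G + energy (volume.restrict Ω) q H = r := by
  obtain ⟨u, v, ⟨hu, hv, hnt, hc⟩, rfl⟩ := hr
  have hu' := hu.hasW0 hΩ
  have hv' := hv.hasW1 hΩ
  rw [rayleigh_eq hΩ hu' hv']
  have hI := (coupling_pos_iff h hu' hv').2 hnt
  set I := coupling (volume.restrict Ω) α β u v with hIdef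
  have hs : 0 < I ^ (-(1 / p)) := Real.rpow_pos_of_pos hI _
  have ht : 0 < I ^ (-(1 / q)) := Real.rpow_pos_of_pos hI _
  -- With these two scalings both energies and the coupling are multiplied by I⁻¹, the last because
  -- α/p + β/q = 1.
  refine ⟨_, _, _, _, hu'.const_mul (I ^ (-(1 / p))), hv'.const_mul (I ^ (-(1 / q))), ?_, ?_, ?_⟩
  · rw [constraint_scale hs ht]
    have : constraint (volume.restrict Ω) α β u v = 0 := hc
    rw [this, mul_zero]
  · rw [coupling_scale hs ht, ← hIdef, h.rpow_normalize hI, inv_mul_cancel₀ hI.ne']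
  · have e : ∀ {s : ℝ}, 0 < s → (I ^ (-(1 / s))) ^ s = I⁻¹ := fun hs => by
      rw [← Real.rpow_mul hI.le, ← Real.rpow_neg_one]
      congr 1; field_simp
    rw [energy_smul hs, energy_smul ht, e h.p_pos, e h.q_pos]
    field_simp

end Variational

/-! ### Existence of a minimizer -/

section Existence

variable {Ω : Set (E N)} {p q α β : ℝ}

theorem tendsto_eLpNorm_midpoint {X : Type*} [MeasurableSpace X] {μ : Measure X} (hp : 1 < p)
    {f : ℕ → X → ℝ} {u : X → ℝ} (hf : ∀ n, MemLp (f n) (ENNReal.ofReal p) μ)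
    (hu : MemLp u (ENNReal.ofReal p) μ)
    (h : Tendsto (fun n => eLpNorm (fun x => f n x - u x) (ENNReal.ofReal p) μ) atTop (𝓝 0)) :
    Tendsto (fun n : ℕ × ℕ => eLpNorm (fun x => 1 / 2 * (f n.1 x + f n.2 x) - u x)
      (ENNReal.ofReal p) μ) atTop (𝓝 0) := by
  rw [← prod_atTop_atTop_eq]
  have h1 := tendsto_eLpNorm_add (one_le_ofReal_of_one_lt hp)
    (fun n : ℕ × ℕ => ((hf n.1).sub hu).1) (fun n : ℕ × ℕ => ((hf n.2).sub hu).1)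
    (h.comp tendsto_fst) (h.comp tendsto_snd)
  refine tendsto_eLpNorm_of_le_mul (1 / 2) (fun n x => ?_) h1
  have e : 1 / 2 * (f n.1 x + f n.2 x) - u x = 1 / 2 * ((f n.1 x - u x) + (f n.2 x - u x)) := by
    ring
  simp only [Pi.sub_apply]
  rw [e, norm_mul]
  norm_num

/-- A normalized minimizing sequence with `L^p × L^q` convergence has a minimizer as limit. -/
theorem exists_minimizer_of_tendsto [IsFiniteMeasure (volume.restrict Ω)] (h : Exponents p q α β)
    (hΩ : IsOpen Ω) {f g : ℕ → E N → ℝ} {G H : ℕ → E N → E N} {u v : E N → ℝ}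
    (hf : ∀ n, HasW0 Ω p (f n) (G n)) (hg : ∀ n, HasW1 Ω q (g n) (H n))
    (hu : MemLp u (ENNReal.ofReal p) (volume.restrict Ω))
    (hv : MemLp v (ENNReal.ofReal q) (volume.restrict Ω))
    (hfu : Tendsto (fun n => eLpNorm (fun x => f n x - u x) (ENNReal.ofReal p)
      (volume.restrict Ω)) atTop (𝓝 0))
    (hgv : Tendsto (fun n => eLpNorm (fun x => g n x - v x) (ENNReal.ofReal q)
      (volume.restrict Ω)) atTop (𝓝 0))
    (hc : ∀ n (c : ℝ), 1 ≤ coupling (volume.restrict Ω) α β (f n) (fun x => g n x + c)) {M : ℝ}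
    (hM : ∀ n, energy (volume.restrict Ω) p (G n) + energy (volume.restrict Ω) q (H n) ≤ M)
    (hlim : Tendsto (fun n => energy (volume.restrict Ω) p (G n) +
      energy (volume.restrict Ω) q (H n)) atTop (𝓝 (lambdaInf Ω p q α β))) :
    lambdaInf Ω p q α β ∈ rayleighValues Ω p q α β := by
  set μ := volume.restrict Ω
  set lam := lambdaInf Ω p q α β with hlam
  have hlam0 : 0 ≤ lam := lambdaInf_nonneg h.one_lt_p h.one_lt_q
  have hcl : ∀ c : ℝ, 1 ≤ coupling μ α β u (fun x => v x + c) := fun c =>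
    ge_of_tendsto' (h.tendsto_coupling (fun n => (hf n).memLp)
      (fun n => ((hg n).add_const c).memLp) hu (hv.add (memLp_const c)) hfu (by simpa using hgv))
      fun n => hc n c
  have hu0 : ¬ ∀ᵐ x ∂μ, u x = 0 := fun h0 => by
    have h1 := hcl 0
    have h2 : coupling μ α β u (fun x => v x + 0) = 0 := by
      simp only [add_zero]
      rw [h.coupling_eq_zero_iff hu hv]
      filter_upwards [h0] with x hx
      rw [hx, zero_mul]
    linarith
  have e0p := fun n => energy_nonneg (μ := μ) h.one_lt_p (G n)
  have e0q := fun n => energy_nonneg (μ := μ) h.one_lt_q (H n)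
  have hMp : ∀ n, energy μ p (G n) ≤ M := fun n => by linarith [hM n, e0q n]
  have hMq : ∀ n, energy μ q (H n) ≤ M := fun n => by linarith [hM n, e0p n]
  have hM0 : 0 ≤ M := (e0p 0).trans (hMp 0)
  have hmidp := fun n : ℕ × ℕ => energy_midpoint_le h.one_lt_p (hf n.1).memLp_grad
    (hf n.2).memLp_grad
  have hmidq := fun n : ℕ × ℕ => energy_midpoint_le h.one_lt_q (hg n.1).memLp_grad
    (hg n.2).memLp_grad
  -- The midpoints converge to the same limit, so all their shifts eventually have coupling at least
  -- 1 − ε/(2(λ+1)), and the variational inequality bounds their energy below. The two terms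
  -- themselves have energy below λ + ε/2, so the total midpoint deficit is below ε.
  have hsum : Tendsto (fun n : ℕ × ℕ =>
      ((energy μ p (G n.1) + energy μ p (G n.2)) / 2 -
        energy μ p (fun x => (1 / 2 : ℝ) • (G n.1 x + G n.2 x))) +
      ((energy μ q (H n.1) + energy μ q (H n.2)) / 2 -
        energy μ q (fun x => (1 / 2 : ℝ) • (H n.1 x + H n.2 x)))) atTop (𝓝 0) := by
    rw [Metric.tendsto_nhds]
    intro ε hε
    have hev := h.eventually_le_coupling
      (fun n : ℕ × ℕ => (((hf n.1).add h.one_lt_p (hf n.2)).const_mul (1 / 2)).memLp)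
      (fun n : ℕ × ℕ => (((hg n.1).add (hg n.2)).const_mul (1 / 2)).memLp) hu hv
      (tendsto_eLpNorm_midpoint h.one_lt_p (fun n => (hf n).memLp) hu hfu)
      (tendsto_eLpNorm_midpoint h.one_lt_q (fun n => (hg n).memLp) hv hgv) hu0 hcl
      (ε := ε / (2 * (lam + 1))) (by positivity)
    have hl2 := hlim.eventually (gt_mem_nhds (show lam < lam + ε / 2 by linarith))
    have hl3 : ∀ᶠ n : ℕ × ℕ in atTop, energy μ p (G n.1) + energy μ q (H n.1) < lam + ε / 2 ∧
        energy μ p (G n.2) + energy μ q (H n.2) < lam + ε / 2 := by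
      rw [← prod_atTop_atTop_eq]
      exact (tendsto_fst.eventually hl2).and (tendsto_snd.eventually hl2)
    filter_upwards [hev, hl3] with n hn hn'
    have h1 := lambdaInf_mul_le h hΩ (((hf n.1).add h.one_lt_p (hf n.2)).const_mul (1 / 2))
      (((hg n.1).add (hg n.2)).const_mul (1 / 2)) hn
    have h2 : lam * (ε / (2 * (lam + 1))) < ε / 2 := by
      rw [← mul_div_assoc, div_lt_div_iff₀ (by positivity) (by positivity)]
      nlinarith
    rw [Real.dist_eq, sub_zero, abs_of_nonneg (by linarith [hmidp n, hmidq n])]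
    have h3 : lam - ε / 2 < lam * (1 - ε / (2 * (lam + 1))) := by linarith
    linarith [hn'.1, hn'.2]
  have hdp := squeeze_zero (fun n => sub_nonneg.2 (hmidp n))
    (fun n => le_add_of_nonneg_right (sub_nonneg.2 (hmidq n))) hsum
  have hdq := squeeze_zero (fun n => sub_nonneg.2 (hmidq n))
    (fun n => le_add_of_nonneg_left (sub_nonneg.2 (hmidp n))) hsum
  obtain ⟨G₀, hG₀, hG⟩ := exists_tendsto_of_cauchy h.one_lt_p (fun n => (hf n).memLp_grad)
    (tendsto_integral_sub_rpow h.one_lt_p (fun n => (hf n.1).memLp_grad)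
      (fun n => (hf n.2).memLp_grad) hM0 (fun n => hMp n.1) (fun n => hMp n.2) hdp)
  obtain ⟨H₀, hH₀, hH⟩ := exists_tendsto_of_cauchy h.one_lt_q (fun n => (hg n).memLp_grad)
    (tendsto_integral_sub_rpow h.one_lt_q (fun n => (hg n.1).memLp_grad)
      (fun n => (hg n.2).memLp_grad) hM0 (fun n => hMq n.1) (fun n => hMq n.2) hdq)
  have hu' := hasW0_of_tendsto h.one_lt_p hf hu hG₀ hfu hG
  have hv' := hasW1_of_tendsto h.one_lt_q hg hv hH₀ hgv hH
  have hE : energy μ p G₀ + energy μ q H₀ = lam :=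
    tendsto_nhds_unique ((tendsto_energy h.one_lt_p (fun n => (hf n).memLp_grad) hG₀ hG).add
      (tendsto_energy h.one_lt_q (fun n => (hg n).memLp_grad) hH₀ hH)) hlim
  -- The sequence was only required to have coupling at least 1 for all shifts, so the limit need
  -- not satisfy the constraint; shifting it costs no energy and keeps the coupling at least 1.
  obtain ⟨c, hc0⟩ := h.exists_constraint_eq_zero hu hv
  have hv'' := hv'.add_const c
  have hpos : 0 < coupling μ α β u (fun x => v x + c) := one_pos.trans_le (hcl c)
  have hadm : Admissible Ω p q α β u (fun x => v x + c) :=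
    ⟨hu'.memW1Zero hΩ, hv''.memW1, (coupling_pos_iff h hu' hv'').1 hpos, hc0⟩
  refine ⟨u, fun x => v x + c, hadm, le_antisymm ?_ (csInf_le
    (bddBelow_rayleighValues h.one_lt_p h.one_lt_q) ⟨_, _, hadm, rfl⟩)⟩
  rw [rayleigh_eq hΩ hu' hv'', hE, div_le_iff₀ hpos]
  exact le_mul_of_one_le_right hlam0 (hcl c)

/-- Bounded energy alone does not bound v_n in `L^q`, because shifts cost nothing; the
Poincaré–Wirtinger constants are therefore subtracted before compactness is applied. -/
theorem lambdaInf_mem_rayleighValues (hN : 1 ≤ N) (hΩ : IsSmoothBoundedDomain Ω)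
    (h : Exponents p q α β) : lambdaInf Ω p q α β ∈ rayleighValues Ω p q α β := by
  have := hΩ.isFiniteMeasure
  obtain ⟨r, hanti, hr, hmem⟩ := exists_seq_tendsto_sInf
    (rayleighValues_nonempty hN hΩ h) (bddBelow_rayleighValues h.one_lt_p h.one_lt_q)
  choose u v G H hu hv hc hI hE using fun n => exists_normalized h hΩ.isOpen (hmem n)
  obtain ⟨Cp, hCp, hPp⟩ := poincare_zero hN h.one_lt_p hΩ
  obtain ⟨Cq, hCq, hPq⟩ := poincare_wirtinger h.one_lt_q hΩ
  choose c hcq using fun n => hPq (v n) (H n) (hv n)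
  have e0p := fun n => energy_nonneg (μ := volume.restrict Ω) h.one_lt_p (G n)
  have e0q := fun n => energy_nonneg (μ := volume.restrict Ω) h.one_lt_q (H n)
  have hr0 : ∀ n, r n ≤ r 0 := fun n => hanti (Nat.zero_le n)
  have hp0 := h.p_pos
  have hq0 := h.q_pos
  have hGp : ∀ n, ∫ x in Ω, ‖G n x‖ ^ p ≤ p * r 0 := fun n => by
    rw [integral_rpow_eq_mul_energy h.one_lt_p]
    exact mul_le_mul_of_nonneg_left (by linarith [hE n, hr0 n, e0q n]) hp0.le
  have hHq : ∀ n, ∫ x in Ω, ‖H n x‖ ^ q ≤ q * r 0 := fun n => by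
    rw [integral_rpow_eq_mul_energy h.one_lt_q]
    exact mul_le_mul_of_nonneg_left (by linarith [hE n, hr0 n, e0p n]) hq0.le
  obtain ⟨ns, u₀, hns, hu₀, hlu⟩ := rellich h.one_lt_p hΩ (fun n => (hu n).toHasW1)
    (M := max (Cp * (p * r 0)) (p * r 0)) (fun n => ((hPp _ _ (hu n)).trans
      (mul_le_mul_of_nonneg_left (hGp n) hCp)).trans (le_max_left _ _))
    (fun n => (hGp n).trans (le_max_right _ _))
  have hv' : ∀ n, HasW1 Ω q (fun x => v (ns n) x - c (ns n)) (H (ns n)) := fun n => by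
    simpa [sub_eq_add_neg] using (hv (ns n)).add_const (-c (ns n))
  obtain ⟨ms, v₀, hms, hv₀, hlv⟩ := rellich h.one_lt_q hΩ hv'
    (M := max (Cq * (q * r 0)) (q * r 0)) (fun n => ((hcq (ns n)).trans
      (mul_le_mul_of_nonneg_left (hHq (ns n)) hCq)).trans (le_max_left _ _))
    (fun n => (hHq (ns n)).trans (le_max_right _ _))
  refine exists_minimizer_of_tendsto h hΩ.isOpen (fun n => hu (ns (ms n))) (fun n => hv' (ms n))
    hu₀ hv₀ (hlu.comp hms.tendsto_atTop) hlv (fun n a => ?_) (M := r 0) (fun n => ?_) ?_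
  -- The normalized v_n satisfies the constraint, so its coupling 1 is the minimum over all shifts,
  -- including those of the recentred sequence.
  · have := h.coupling_tangent_const_le (hu (ns (ms n))).memLp (hv (ns (ms n))).memLp
      (-c (ns (ms n)) + a)
    rw [hc, hI, zero_mul, mul_zero, add_zero] at this
    simpa only [sub_eq_add_neg, add_assoc] using this
  · rw [hE]; exact hr0 _
  · simp only [hE]
    exact hr.comp (hns.tendsto_atTop.comp hms.tendsto_atTop)

end Existence

/-! ### The equation for v and the scaling identity for u -/

section EulerLagrange

variable {Ω : Set (E N)} {p q α β : ℝ} {u v w z : E N → ℝ} {G H W Z : E N → E N}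

/-- `(u, v)`, with weak gradients `G` and `H`, minimizes the Rayleigh quotient. -/
structure IsMinimizer (Ω : Set (E N)) (p q α β : ℝ) (u v : E N → ℝ) (G H : E N → E N) : Prop where
  left : HasW0 Ω p u G
  right : HasW1 Ω q v H
  constraint_eq : constraint (volume.restrict Ω) α β u v = 0
  coupling_pos : 0 < coupling (volume.restrict Ω) α β u v
  energy_eq : energy (volume.restrict Ω) p G + energy (volume.restrict Ω) q H =
    lambdaInf Ω p q α β * coupling (volume.restrict Ω) α β u v

theorem ae_zero_of_energy_eq_zero (hN : 1 ≤ N) (hp : 1 < p) (hΩ : IsSmoothBoundedDomain Ω)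
    (hu : HasW0 Ω p u G) (hG : energy (volume.restrict Ω) p G = 0) :
    ∀ᵐ x ∂(volume.restrict Ω), u x = 0 := by
  obtain ⟨C, -, hC⟩ := poincare_zero hN hp hΩ
  have h1 := hC u G hu
  rw [integral_rpow_eq_mul_energy hp G, hG, mul_zero, mul_zero] at h1
  have h2 := h1.antisymm (integral_nonneg fun x => by positivity)
  rw [integral_eq_zero_iff_of_nonneg (fun x => by positivity) (hu.memLp.integrable_rpow hp)] at h2
  filter_upwards [h2] with x hx
  simpa [Real.rpow_eq_zero (abs_nonneg (u x)) (by linarith : p ≠ 0)] using hx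

variable [IsFiniteMeasure (volume.restrict Ω)]

theorem isMinimizer_of_rayleigh_eq (h : Exponents p q α β) (hΩ : IsOpen Ω)
    (hadm : Admissible Ω p q α β u v) (hr : rayleigh Ω p q α β u v = lambdaInf Ω p q α β) :
    IsMinimizer Ω p q α β u v (weakGradient Ω u) (weakGradient Ω v) := by
  obtain ⟨hu, hv, hnt, hc⟩ := hadm
  have hI := (coupling_pos_iff h (hu.hasW0 hΩ) (hv.hasW1 hΩ)).2 hnt
  refine ⟨hu.hasW0 hΩ, hv.hasW1 hΩ, hc, hI, ?_⟩
  rw [← hr, rayleigh_eq hΩ (hu.hasW0 hΩ) (hv.hasW1 hΩ), div_mul_cancel₀ _ hI.ne']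

theorem IsMinimizer.not_ae_zero (h : Exponents p q α β) (hm : IsMinimizer Ω p q α β u v G H) :
    ¬ ∀ᵐ x ∂(volume.restrict Ω), u x = 0 := fun h0 => hm.coupling_pos.ne' <| by
  rw [h.coupling_eq_zero_iff hm.left.memLp hm.right.memLp]
  filter_upwards [h0] with x hx
  rw [hx, zero_mul]

/-- If λ = 0 both energies vanish, and Poincaré forces u = 0, which contradicts a positive coupling.
-/
theorem IsMinimizer.lambdaInf_pos (h : Exponents p q α β) (hN : 1 ≤ N)
    (hΩ : IsSmoothBoundedDomain Ω) (hm : IsMinimizer Ω p q α β u v G H) :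
    0 < lambdaInf Ω p q α β := by
  refine lt_of_le_of_ne (lambdaInf_nonneg h.one_lt_p h.one_lt_q) fun h0 => hm.not_ae_zero h ?_
  have h1 := hm.energy_eq
  rw [← h0, zero_mul] at h1
  refine ae_zero_of_energy_eq_zero hN h.one_lt_p hΩ hm.left ?_
  linarith [energy_nonneg (μ := volume.restrict Ω) h.one_lt_p G,
    energy_nonneg (μ := volume.restrict Ω) h.one_lt_q H]

/-- The Euler-Lagrange equation for `v`. -/
theorem IsMinimizer.right_equation (h : Exponents p q α β) (hΩ : IsOpen Ω)
    (hm : IsMinimizer Ω p q α β u v G H) (hz : HasW1 Ω q z Z) :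
    ∫ x in Ω, ‖H x‖ ^ (q - 2) * inner ℝ (H x) (Z x) = lambdaInf Ω p q α β * β *
      ∫ x in Ω, |u x| ^ α * (|v x| ^ (β - 2) * v x) * z x := by
  set B := ∫ x in Ω, |u x| ^ α * (|v x| ^ (β - 2) * v x) * z x with hB
  set lam := lambdaInf Ω p q α β
  have hmin : ∀ t : ℝ, energy (volume.restrict Ω) q H ≤
      energy (volume.restrict Ω) q (fun x => H x + t • Z x) - lam * β * B * t := fun t => by
    have hvt := hm.right.add (hz.const_mul t)
    -- The tangent inequality at v bounds the coupling of v + tz + c below by the same number for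
    -- every c, so the constraint need not be tracked along the perturbation.
    have h1 := lambdaInf_mul_le h hΩ hm.left hvt
      (m := coupling (volume.restrict Ω) α β u v + β * (t * B)) (fun c => by
        have h2 := h.coupling_tangent_le hm.left.memLp hm.right.memLp
          ((hz.const_mul t).add_const c).memLp
        -- The constant c contributes c times the constraint integral, which is 0.
        have e : ∫ x in Ω, |u x| ^ α * (|v x| ^ (β - 2) * v x) * (t * z x + c) = t * B := by
          have i1 := (h.integrable_constraint_mul hm.left.memLp hm.right.memLp hz.memLp).const_mul t
          have i2 := (h.integrable_constraint hm.left.memLp hm.right.memLp).mul_const c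
          have hc := hm.constraint_eq
          rw [constraint] at hc
          rw [hB, ← integral_const_mul, ← add_zero (∫ x in Ω, t * _), ← zero_mul c, ← hc,
            ← integral_mul_const, ← integral_add i1 i2]
          congr 1; ext x; ring
        rw [e] at h2
        simpa only [add_assoc] using h2)
    have h3 := hm.energy_eq
    linarith
  have hd := (hasDerivAt_energy h.one_lt_q hm.right.memLp_grad hz.memLp_grad).sub
    ((hasDerivAt_id (0 : ℝ)).const_mul (lam * β * B))
  have hloc : IsLocalMin ((fun t : ℝ => ∫ x in Ω, ‖H x + t • Z x‖ ^ q / q) -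
      fun t => lam * β * B * id t) 0 := Eventually.of_forall fun t => by
    simpa [energy] using hmin t
  have := hloc.hasDerivAt_eq_zero hd
  linarith

/-- Coupling and constraint see only |u|. The energy is preserved since |sign u| = 1 off {u = 0},
while on {u = 0} the gradient vanishes a.e. -/
theorem IsMinimizer.congr_abs (h : Exponents p q α β) (hΩ : IsOpen Ω)
    (hm : IsMinimizer Ω p q α β u v G H) :
    IsMinimizer Ω p q α β (fun x => |u x|) v (fun x => Real.sign (u x) • G x) H := by
  have hI : coupling (volume.restrict Ω) α β (fun x => |u x|) v =
      coupling (volume.restrict Ω) α β u v := by simp only [coupling, abs_abs]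
  have hE : energy (volume.restrict Ω) p (fun x => Real.sign (u x) • G x) =
      energy (volume.restrict Ω) p G := by
    refine integral_congr_ae ?_
    filter_upwards [hm.left.grad_eq_zero h.one_lt_p hΩ] with x hx
    rcases lt_trichotomy (u x) 0 with hx' | hx' | hx'
    · simp [Real.sign_of_neg hx']
    · simp [hx hx']
    · simp [Real.sign_of_pos hx']
  refine ⟨hm.left.abs h.one_lt_p, hm.right, ?_, by rw [hI]; exact hm.coupling_pos, by
    rw [hI, hE, hm.energy_eq]⟩
  simpa only [constraint, abs_abs] using hm.constraint_eq

/-- Testing the first equation with the minimizer itself. -/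
theorem IsMinimizer.left_equation_self (h : Exponents p q α β) (hΩ : IsOpen Ω)
    (hm : IsMinimizer Ω p q α β u v G H) :
    p * energy (volume.restrict Ω) p G = lambdaInf Ω p q α β * α *
      coupling (volume.restrict Ω) α β u v := by
  set lam := lambdaInf Ω p q α β
  set I := coupling (volume.restrict Ω) α β u v
  set Ep := energy (volume.restrict Ω) p G
  -- The pair (su, v) still satisfies the constraint. Both powers of s are differentiable at s = 1
  -- for every α > 0, so no regularity of |·|^α at 0 is needed.
  have hmin : ∀ s : ℝ, 0 < s → Ep - lam * I ≤ s ^ p * Ep - lam * (s ^ α * I) := fun s hs => by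
    have hsc : constraint (volume.restrict Ω) α β (fun x => s * u x) v = 0 := by
      have := constraint_scale (μ := volume.restrict Ω) (α := α) (β := β) hs one_pos u v
      simpa [hm.constraint_eq] using this
    have hsI : coupling (volume.restrict Ω) α β (fun x => s * u x) v = s ^ α * I := by
      have := coupling_scale (μ := volume.restrict Ω) (α := α) (β := β) hs one_pos u v
      simpa using this
    have h1 := lambdaInf_mul_coupling_le h hΩ (hm.left.const_mul s) hm.right hsc
    rw [hsI, energy_smul hs] at h1
    have h2 := hm.energy_eq
    linarith
  have hd := ((Real.hasDerivAt_rpow_const (x := 1) (p := p) (Or.inl one_ne_zero)).mul_const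
    Ep).sub (((Real.hasDerivAt_rpow_const (x := 1) (p := α) (Or.inl one_ne_zero)).mul_const
    I).const_mul lam)
  have hloc : IsLocalMin ((fun s : ℝ => s ^ p * Ep) - fun s => lam * (s ^ α * I)) 1 := by
    filter_upwards [lt_mem_nhds (one_pos (α := ℝ))] with s hs
    simpa using hmin s hs
  have := hloc.hasDerivAt_eq_zero hd
  simp only [Real.one_rpow, mul_one] at this
  linarith

end EulerLagrange

/-! ### Nonnegative minimizers are supersolutions -/

section Supersolution

/-- A form of Fatou's lemma. -/
theorem integrable_of_fatou {X : Type*} [MeasurableSpace X] {μ : Measure X} {F : ℕ → X → ℝ}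
    {f : X → ℝ} {d : ℕ → ℝ} {d₀ : ℝ} (hF : ∀ n, Integrable (F n) μ) (hF0 : ∀ n x, 0 ≤ F n x)
    (hf : AEStronglyMeasurable f μ) (hf0 : ∀ x, 0 ≤ f x)
    (hlim : ∀ᵐ x ∂μ, f x = 0 ∨ Tendsto (fun n => F n x) atTop (𝓝 (f x)))
    (hd : ∀ n, ∫ x, F n x ∂μ ≤ d n) (hd₀ : Tendsto d atTop (𝓝 d₀)) :
    Integrable f μ ∧ ∫ x, f x ∂μ ≤ d₀ := by
  have h1 : ∫⁻ x, ENNReal.ofReal (f x) ∂μ ≤ ENNReal.ofReal d₀ := by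
    calc ∫⁻ x, ENNReal.ofReal (f x) ∂μ
        ≤ ∫⁻ x, liminf (fun n => ENNReal.ofReal (F n x)) atTop ∂μ := by
          refine lintegral_mono_ae ?_
          filter_upwards [hlim] with x hx
          rcases hx with hx | hx
          · rw [hx, ENNReal.ofReal_zero]; exact zero_le
          · rw [(ENNReal.tendsto_ofReal hx).liminf_eq]
      _ ≤ liminf (fun n => ∫⁻ x, ENNReal.ofReal (F n x) ∂μ) atTop :=
          lintegral_liminf_le' fun n => (hF n).1.aemeasurable.ennreal_ofReal
      _ ≤ liminf (fun n => ENNReal.ofReal (d n)) atTop := by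
          refine liminf_le_liminf (Eventually.of_forall fun n => ?_)
          rw [← ofReal_integral_eq_lintegral_ofReal (hF n) (Eventually.of_forall (hF0 n))]
          exact ENNReal.ofReal_le_ofReal (hd n)
      _ = ENNReal.ofReal d₀ := (ENNReal.tendsto_ofReal hd₀).liminf_eq
  have hd0 : 0 ≤ d₀ := ge_of_tendsto' hd₀ fun n => (integral_nonneg (hF0 n)).trans (hd n)
  have hi : Integrable f μ := by
    refine ⟨hf, ?_⟩
    rw [hasFiniteIntegral_iff_ofReal (Eventually.of_forall hf0)]
    exact h1.trans_lt ENNReal.ofReal_lt_top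
  refine ⟨hi, ?_⟩
  rwa [← ofReal_integral_eq_lintegral_ofReal hi (Eventually.of_forall hf0),
    ENNReal.ofReal_le_ofReal_iff hd0] at h1

section Shift

variable {X : Type*} [MeasurableSpace X] {μ : Measure X} [IsFiniteMeasure μ] {p q α β : ℝ}
  {u v : X → ℝ}

theorem Exponents.coupling_mono (h : Exponents p q α β) {u' : X → ℝ}
    (hu : MemLp u (ENNReal.ofReal p) μ) (hu' : MemLp u' (ENNReal.ofReal p) μ)
    (hv : MemLp v (ENNReal.ofReal q) μ) (hle : ∀ x, |u x| ≤ |u' x|) :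
    coupling μ α β u v ≤ coupling μ α β u' v :=
  integral_mono (h.integrable_coupling hu hv) (h.integrable_coupling hu' hv) fun x =>
    mul_le_mul_of_nonneg_right (Real.rpow_le_rpow (abs_nonneg _) (hle x) h.α_pos.le)
      (by positivity)

/-- A convex function of the shift with minimum at 0 is nondecreasing along rays: comparing δ with 0
shows that its slope at δ points outward, and the tangent at δ then bounds the value at sδ. -/
theorem Exponents.coupling_shift_mono (h : Exponents p q α β)
    (hu : MemLp u (ENNReal.ofReal p) μ) (hv : MemLp v (ENNReal.ofReal q) μ)
    (hc : constraint μ α β u v = 0) {δ s : ℝ} (hs : 1 ≤ s) :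
    coupling μ α β u (fun x => v x + δ) ≤ coupling μ α β u (fun x => v x + s * δ) := by
  have hvδ : MemLp (fun x => v x + δ) (ENNReal.ofReal q) μ := hv.add (memLp_const δ)
  have h0 := h.coupling_tangent_const_le hu hv δ
  have h1 := h.coupling_tangent_const_le hu hvδ (-δ)
  have h2 := h.coupling_tangent_const_le hu hvδ ((s - 1) * δ)
  rw [hc] at h0
  simp only [add_neg_cancel_right] at h1
  have e : ∀ x, v x + δ + (s - 1) * δ = v x + s * δ := fun x => by ring
  simp only [e] at h2
  set k := constraint μ α β u fun x => v x + δ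
  have h3 : 0 ≤ β * (k * δ) := by linarith
  have h4 : 0 ≤ (s - 1) * (β * (k * δ)) := mul_nonneg (by linarith) h3
  linarith

/-- The shifts that restore the constraint tend to zero. -/
theorem Exponents.tendsto_shift (h : Exponents p q α β) {f : ℕ → X → ℝ} {c : ℕ → ℝ}
    (hf : ∀ n, MemLp (f n) (ENNReal.ofReal p) μ) (hu : MemLp u (ENNReal.ofReal p) μ)
    (hv : MemLp v (ENNReal.ofReal q) μ)
    (hfu : Tendsto (fun n => eLpNorm (fun x => f n x - u x) (ENNReal.ofReal p) μ) atTop (𝓝 0))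
    (hle : ∀ n x, |u x| ≤ |f n x|) (hc : constraint μ α β u v = 0)
    (hu0 : ¬ ∀ᵐ x ∂μ, u x = 0)
    (hcn : ∀ n, constraint μ α β (f n) (fun x => v x + c n) = 0) :
    Tendsto c atTop (𝓝 0) := by
  have hlim := h.tendsto_coupling (g := fun _ => v) hf (fun _ => hv) hu hv hfu (by simp)
  have hvc : ∀ c : ℝ, MemLp (fun x => v x + c) (ENNReal.ofReal q) μ := fun c =>
    hv.add (memLp_const c)
  -- Writing C for the coupling, c_n = sσ with s ≥ 1 would give C(u, v + σ) ≤ C(u, v + c_n) ≤ C(f_n,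
  -- v + c_n) ≤ C(f_n, v) → C(u, v), which is strictly smaller than C(u, v + σ).
  have key : ∀ {σ : ℝ}, σ ≠ 0 → ∀ᶠ n in atTop, ∀ s : ℝ, 1 ≤ s → c n ≠ s * σ := fun {σ} hσ => by
    have hlt := h.coupling_lt_of_constraint hu hv hc hu0 hσ
    filter_upwards [hlim.eventually (gt_mem_nhds hlt)] with n hn s hs hcs
    have h1 := h.coupling_shift_mono hu hv hc (δ := σ) hs
    have h2 := h.coupling_mono hu (hf n) (hvc (s * σ)) (hle n)
    have h3 := h.coupling_tangent_const_le (hf n) (hvc (c n)) (-c n)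
    rw [hcn n] at h3
    simp only [add_neg_cancel_right] at h3
    rw [hcs] at h3
    linarith
  rw [Metric.tendsto_nhds]
  intro ε hε
  filter_upwards [key hε.ne', key (neg_ne_zero.2 hε.ne')] with n h1 h2
  rw [Real.dist_eq, sub_zero, abs_lt]
  constructor
  · by_contra! hlt
    refine h2 (c n / -ε) ?_ (by field_simp)
    rw [le_div_iff_of_neg (by linarith)]; linarith
  · by_contra! hlt
    refine h1 (c n / ε) ?_ (by field_simp)
    rw [le_div_iff₀ hε]; linarith

end Shift

variable {Ω : Set (E N)} {p q α β : ℝ} {u v w : E N → ℝ} {G H W : E N → E N}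

/-- The base point is positive, so the singularity of |·|^α at 0 plays no role. -/
theorem tendsto_abs_rpow_slope {α : ℝ} {a b : ℝ} (ha : 0 < a) {t : ℕ → ℝ} (ht : ∀ n, 0 < t n)
    (ht0 : Tendsto t atTop (𝓝 0)) :
    Tendsto (fun n => (|a + t n * b| ^ α - |a| ^ α) / t n) atTop
      (𝓝 (α * (|a| ^ (α - 2) * a) * b)) := by
  have h1 : HasDerivAt (fun s : ℝ => a + s * b) b 0 := by
    simpa using ((hasDerivAt_id (0 : ℝ)).mul_const b).const_add a
  have h2 : HasDerivAt (fun s : ℝ => (a + s * b) ^ α) (b * α * a ^ (α - 1)) 0 := by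
    simpa using h1.rpow_const (p := α) (Or.inl (by simpa using ha.ne'))
  have h3 := (hasDerivAt_iff_tendsto_slope.1 h2).comp
    (tendsto_nhdsWithin_iff.2 ⟨ht0, Eventually.of_forall fun n => (ht n).ne'⟩)
  have e : b * α * a ^ (α - 1) = α * (|a| ^ (α - 2) * a) * b := by
    rw [abs_of_pos ha, ← Real.rpow_add_one ha.ne']
    ring_nf
  rw [e] at h3
  have hpos : ∀ᶠ n in atTop, 0 < a + t n * b := by
    have : Tendsto (fun n => a + t n * b) atTop (𝓝 a) := by
      simpa using (ht0.mul_const b).const_add a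
    exact this.eventually (lt_mem_nhds ha)
  refine h3.congr' ?_
  filter_upwards [hpos] with n hn
  simp [slope_def_field, abs_of_pos hn, abs_of_pos ha]

theorem aestronglyMeasurable_source {X : Type*} [MeasurableSpace X] {μ : Measure X}
    {u v w : X → ℝ} (hu : AEStronglyMeasurable u μ) (hv : AEStronglyMeasurable v μ)
    (hw : AEStronglyMeasurable w μ) :
    AEStronglyMeasurable (fun x => |u x| ^ (α - 2) * u x * |v x| ^ β * w x) μ := by
  have h1 := hu.aemeasurable
  have h2 := hv.aemeasurable
  have h3 := hw.aemeasurable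
  exact (((((h1.norm.pow_const (α - 2)).mul h1).mul (h2.norm.pow_const β)).mul h3)).aestronglyMeasurable

variable [IsFiniteMeasure (volume.restrict Ω)]

/-- Nonnegative minimizers are supersolutions of the first equation. -/
theorem IsMinimizer.supersolution (h : Exponents p q α β) (hN : 1 ≤ N)
    (hΩ : IsSmoothBoundedDomain Ω) (hm : IsMinimizer Ω p q α β u v G H) (hu0 : ∀ x, 0 ≤ u x)
    (hw : HasW0 Ω p w W) (hw0 : ∀ x, 0 ≤ w x) :
    IntegrableOn (fun x => |u x| ^ (α - 2) * u x * |v x| ^ β * w x) Ω ∧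
    lambdaInf Ω p q α β * α * ∫ x in Ω, |u x| ^ (α - 2) * u x * |v x| ^ β * w x ≤
      ∫ x in Ω, ‖G x‖ ^ (p - 2) * inner ℝ (G x) (W x) := by
  set lam := lambdaInf Ω p q α β with hlam
  have hlam0 : 0 < lam := hm.lambdaInf_pos h hN hΩ
  have hα := h.α_pos
  set t : ℕ → ℝ := fun n => 1 / ((n : ℝ) + 1) with htdef
  have ht : ∀ n, 0 < t n := fun n => by positivity
  have ht0 : Tendsto t atTop (𝓝 0) := tendsto_one_div_add_atTop_nhds_zero_nat
  have hf := fun n => hm.left.add h.one_lt_p (hw.const_mul (t n))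
  choose c hc using fun n => h.exists_constraint_eq_zero (hf n).memLp hm.right.memLp
  have hle : ∀ n x, |u x| ≤ |u x + t n * w x| := fun n x => by
    have := mul_nonneg (ht n).le (hw0 x)
    rw [abs_of_nonneg (hu0 x), abs_of_nonneg (by linarith [hu0 x])]
    linarith
  have hfu : Tendsto (fun n => eLpNorm (fun x => u x + t n * w x - u x) (ENNReal.ofReal p)
      (volume.restrict Ω)) atTop (𝓝 0) := by
    have := ENNReal.Tendsto.mul_const (b := eLpNorm w (ENNReal.ofReal p) (volume.restrict Ω))
      (ENNReal.tendsto_ofReal ht0) (Or.inr hw.memLp.eLpNorm_ne_top)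
    rw [ENNReal.ofReal_zero, zero_mul] at this
    refine this.congr fun n => ?_
    have e : (fun x => u x + t n * w x - u x) = t n • w := by
      ext x; simp
    rw [e, eLpNorm_const_smul, Real.enorm_of_nonneg (ht n).le]
  have hc0 := h.tendsto_shift (fun n => (hf n).memLp) hm.left.memLp hm.right.memLp hfu hle
    hm.constraint_eq (hm.not_ae_zero h) hc
  have hvc := fun n => (hm.right.add_const (c n)).memLp
  -- Difference quotient of |u|^α in the direction w, weighted with the shifted v + c_n that
  -- restores the constraint for u + t_n w. It is nonnegative since w ≥ 0.
  set F : ℕ → E N → ℝ := fun n x =>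
    (|u x + t n * w x| ^ α - |u x| ^ α) / t n * |v x + c n| ^ β with hFdef
  have hFe : ∀ n x, F n x = (|u x + t n * w x| ^ α * |v x + c n| ^ β -
      |u x| ^ α * |v x + c n| ^ β) / t n := fun n x => by simp only [hFdef]; ring
  have i1 := fun n => h.integrable_coupling (hf n).memLp (hvc n)
  have i2 := fun n => h.integrable_coupling hm.left.memLp (hvc n)
  have hFi : ∀ n, Integrable (F n) (volume.restrict Ω) := fun n => by
    rw [show F n = _ from funext (hFe n)]
    exact ((i1 n).sub (i2 n)).div_const _
  have hFd : ∀ n, ∫ x in Ω, F n x ≤ (energy (volume.restrict Ω) p (fun x => G x + t n • W x) -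
      energy (volume.restrict Ω) p G) / t n / lam := fun n => by
    simp only [hFe]
    rw [integral_div, integral_sub (i1 n) (i2 n), div_right_comm,
      div_le_div_iff_of_pos_right (ht n), le_div_iff₀ hlam0]
    have h1 := lambdaInf_mul_coupling_le h hΩ.isOpen (hf n) (hm.right.add_const (c n)) (hc n)
    -- The perturbed pair obeys the variational inequality, while for u itself the shift by c_n can
    -- only raise the coupling above its constrained value. Subtracting leaves a difference quotient
    -- of the energy.
    have h2 := h.coupling_tangent_const_le hm.left.memLp hm.right.memLp (c n)
    rw [hm.constraint_eq, zero_mul, mul_zero, add_zero] at h2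
    have h3 := mul_le_mul_of_nonneg_left h2 hlam0.le
    have h4 := hm.energy_eq
    have e1 : ∫ x in Ω, |u x + t n * w x| ^ α * |v x + c n| ^ β =
      coupling (volume.restrict Ω) α β (fun x => u x + t n * w x) (fun x => v x + c n) := rfl
    have e2 : ∫ x in Ω, |u x| ^ α * |v x + c n| ^ β =
      coupling (volume.restrict Ω) α β u (fun x => v x + c n) := rfl
    rw [e1, e2]
    linarith
  have hd := hasDerivAt_energy h.one_lt_p hm.left.memLp_grad hw.memLp_grad
  have hdt : Tendsto (fun n => (energy (volume.restrict Ω) p (fun x => G x + t n • W x) -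
      energy (volume.restrict Ω) p G) / t n / lam) atTop
      (𝓝 ((∫ x in Ω, ‖G x‖ ^ (p - 2) * inner ℝ (G x) (W x)) / lam)) := by
    have h3 := ((hasDerivAt_iff_tendsto_slope.1 hd).comp
      (tendsto_nhdsWithin_iff.2 ⟨ht0, Eventually.of_forall fun n => (ht n).ne'⟩)).div_const lam
    refine h3.congr fun n => ?_
    simp [slope_def_field, energy]
  have hF0 : ∀ n x, 0 ≤ F n x := fun n x =>
    mul_nonneg (div_nonneg (sub_nonneg.2 (Real.rpow_le_rpow (abs_nonneg _) (hle n x) hα.le))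
      (ht n).le) (by positivity)
  have hf0 : ∀ x, 0 ≤ α * (|u x| ^ (α - 2) * u x * |v x| ^ β * w x) := fun x => by
    have := hu0 x
    have := hw0 x
    positivity
  -- Where u = 0 the source term is 0, so Fatou needs no convergence there; the quotients may even
  -- blow up when α < 1.
  have hFlim : ∀ x, α * (|u x| ^ (α - 2) * u x * |v x| ^ β * w x) = 0 ∨
      Tendsto (fun n => F n x) atTop (𝓝 (α * (|u x| ^ (α - 2) * u x * |v x| ^ β * w x))) :=
    fun x => by
    rcases (hu0 x).eq_or_lt with hx | hx
    · left; simp [← hx]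
    · right
      have l1 := tendsto_abs_rpow_slope (α := α) (b := w x) hx ht ht0
      have l2 : Tendsto (fun n => |v x + c n| ^ β) atTop (𝓝 (|v x| ^ β)) := by
        have := (hc0.const_add (v x)).abs.rpow_const (p := β) (Or.inr h.β_pos.le)
        simpa using this
      have := l1.mul l2
      convert this using 2
      ring
  obtain ⟨h1, h2⟩ := integrable_of_fatou hFi hF0
    ((aestronglyMeasurable_source hm.left.memLp.1 hm.right.memLp.1 hw.memLp.1).const_mul α)
    hf0 (Eventually.of_forall hFlim) hFd hdt
  refine ⟨?_, ?_⟩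
  · have := h1.const_mul α⁻¹
    simp only [← mul_assoc, inv_mul_cancel₀ hα.ne', one_mul] at this
    exact this
  · rw [integral_const_mul, le_div_iff₀ hlam0] at h2
    linarith

end Supersolution

/-! ### The first equation for nonnegative minimizers -/

section LeftEquation

variable {Ω : Set (E N)} {p q α β : ℝ} {u v w : E N → ℝ} {G H W : E N → E N}

theorem measurable_real_sign : Measurable Real.sign := by
  unfold Real.sign
  exact Measurable.ite measurableSet_Iio measurable_const
    (Measurable.ite measurableSet_Ioi measurable_const measurable_const)

theorem abs_one_add_sign_half_le (t : ℝ) : 0 ≤ (1 + Real.sign t) / 2 ∧ (1 + Real.sign t) / 2 ≤ 1 := by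
  rcases lt_trichotomy t 0 with h | rfl | h
  · simp [Real.sign_of_neg h]
  · simp; norm_num
  · simp [Real.sign_of_pos h]

variable [IsFiniteMeasure (volume.restrict Ω)]

/-- The supersolution estimate applied to |w| provides a majorant. -/
theorem IsMinimizer.integrableOn_source (h : Exponents p q α β) (hN : 1 ≤ N)
    (hΩ : IsSmoothBoundedDomain Ω) (hm : IsMinimizer Ω p q α β u v G H) (hu0 : ∀ x, 0 ≤ u x)
    (hw : HasW0 Ω p w W) :
    IntegrableOn (fun x => |u x| ^ (α - 2) * u x * |v x| ^ β * w x) Ω := by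
  refine Integrable.mono
    (hm.supersolution h hN hΩ hu0 (hw.abs h.one_lt_p) fun x => abs_nonneg _).1
    (aestronglyMeasurable_source hm.left.memLp.1 hm.right.memLp.1 hw.memLp.1)
    (Eventually.of_forall fun x => ?_)
  simp only [norm_mul, Real.norm_eq_abs, abs_abs]
  exact le_rfl

/-- The positive part of u + tw is an admissible nonnegative test function and is at least u + tw.
Since the equation holds with equality for w = u, the terms of order zero cancel; dividing by t and
letting t → 0 leaves the inequality for w. -/
theorem IsMinimizer.left_inequality (h : Exponents p q α β) (hN : 1 ≤ N)
    (hΩ : IsSmoothBoundedDomain Ω) (hm : IsMinimizer Ω p q α β u v G H) (hu0 : ∀ x, 0 ≤ u x)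
    (hw : HasW0 Ω p w W) :
    lambdaInf Ω p q α β * α * ∫ x in Ω, |u x| ^ (α - 2) * u x * |v x| ^ β * w x ≤
      ∫ x in Ω, ‖G x‖ ^ (p - 2) * inner ℝ (G x) (W x) := by
  set lam := lambdaInf Ω p q α β with hlam
  have hlam0 : 0 < lam := hm.lambdaInf_pos h hN hΩ
  have hα := h.α_pos
  set t : ℕ → ℝ := fun n => 1 / ((n : ℝ) + 1) with htdef
  have ht : ∀ n, 0 < t n := fun n => by positivity
  have ht0 : Tendsto t atTop (𝓝 0) := tendsto_one_div_add_atTop_nhds_zero_nat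
  have hf := fun n => hm.left.add h.one_lt_p (hw.const_mul (t n))
  set K : E N → ℝ := fun x => ‖G x‖ ^ (p - 2) * inner ℝ (G x) (W x) with hK
  have hKi : Integrable K (volume.restrict Ω) :=
    integrable_norm_rpow_mul_inner h.one_lt_p hm.left.memLp_grad hw.memLp_grad
  set s : ℕ → E N → ℝ := fun n x => (1 + Real.sign (u x + t n * w x)) / 2 with hs
  have hsm : ∀ n, AEStronglyMeasurable (s n) (volume.restrict Ω) := fun n =>
    (((measurable_real_sign.comp_aemeasurable (hf n).memLp.1.aemeasurable).const_add
      1).div_const 2).aestronglyMeasurable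
  have hsb : ∀ n x, 0 ≤ s n x ∧ s n x ≤ 1 := fun n x => abs_one_add_sign_half_le _
  have hsn : ∀ n x, ‖s n x * K x‖ ≤ ‖K x‖ := fun n x => by
    rw [norm_mul, Real.norm_of_nonneg (hsb n x).1]
    exact mul_le_of_le_one_left (norm_nonneg _) (hsb n x).2
  have hsK : ∀ n, Integrable (fun x => s n x * K x) (volume.restrict Ω) := fun n =>
    hKi.mono ((hsm n).mul hKi.1) (Eventually.of_forall (hsn n))
  have key : ∀ n, lam * α * ∫ x in Ω, |u x| ^ (α - 2) * u x * |v x| ^ β * w x ≤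
      ∫ x in Ω, s n x * K x := fun n => by
    have hpp := (hf n).posPart h.one_lt_p
    obtain ⟨i1, h1⟩ := hm.supersolution h hN hΩ hu0 hpp fun x => le_max_right _ _
    have iu := hm.integrableOn_source h hN hΩ hu0 hm.left
    have iw := hm.integrableOn_source h hN hΩ hu0 hw
    have eu : ∫ x in Ω, |u x| ^ (α - 2) * u x * |v x| ^ β * u x =
        coupling (volume.restrict Ω) α β u v := by
      rw [coupling]; congr 1; ext x
      rw [mul_right_comm, abs_rpow_sub_two_mul_mul hα]
    have h2 : coupling (volume.restrict Ω) α β u v +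
        t n * ∫ x in Ω, |u x| ^ (α - 2) * u x * |v x| ^ β * w x ≤
        ∫ x in Ω, |u x| ^ (α - 2) * u x * |v x| ^ β * max (u x + t n * w x) 0 := by
      rw [← eu, ← integral_const_mul, ← integral_add iu (iw.const_mul (t n))]
      refine integral_mono (iu.add (iw.const_mul (t n))) i1 fun x => ?_
      have := hu0 x
      have := mul_le_mul_of_nonneg_left (le_max_left (u x + t n * w x) 0)
        (by positivity : 0 ≤ |u x| ^ (α - 2) * u x * |v x| ^ β)
      simp only
      linarith
    have h3 : ∫ x in Ω, ‖G x‖ ^ (p - 2) * inner ℝ (G x) (s n x • (G x + t n • W x)) ≤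
        p * energy (volume.restrict Ω) p G + t n * ∫ x in Ω, s n x * K x := by
      have ig := hm.left.memLp_grad.integrable_rpow h.one_lt_p
      rw [← integral_rpow_eq_mul_energy h.one_lt_p, ← integral_const_mul,
        ← integral_add ig ((hsK n).const_mul _)]
      refine integral_mono (integrable_norm_rpow_mul_inner h.one_lt_p hm.left.memLp_grad
        hpp.memLp_grad) (ig.add ((hsK n).const_mul _)) fun x => ?_
      have e : ‖G x‖ ^ (p - 2) * inner ℝ (G x) (s n x • (G x + t n • W x)) =
          s n x * ‖G x‖ ^ p + t n * (s n x * K x) := by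
        rw [inner_smul_right, inner_add_right, inner_smul_right,
          ← norm_rpow_mul_inner_self h.one_lt_p (G x)]
        simp only [hK]; ring
      simp only [e]
      gcongr
      exact mul_le_of_le_one_left (by positivity) (hsb n x).2
    have h4 := hm.left_equation_self h hΩ.isOpen
    have h5 := (mul_le_mul_of_nonneg_left h2 (by positivity : 0 ≤ lam * α)).trans (h1.trans h3)
    rw [h4] at h5
    refine le_of_mul_le_mul_left ?_ (ht n)
    linarith
  refine ge_of_tendsto' (tendsto_integral_of_dominated_convergence (fun x => ‖K x‖)
    (fun n => (hsK n).1) hKi.norm (fun n => Eventually.of_forall (hsn n)) ?_) key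
  -- Where u > 0 the factor s_n is eventually 1; where u = 0 the gradient vanishes a.e., so the
  -- value of s_n is irrelevant.
  filter_upwards [hm.left.grad_eq_zero h.one_lt_p hΩ.isOpen] with x hx
  rcases (hu0 x).eq_or_lt with hx' | hx'
  · have : K x = 0 := by simp [hK, hx hx'.symm]
    simp [hx hx'.symm, this]
  · have l1 : Tendsto (fun n => u x + t n * w x) atTop (𝓝 (u x)) := by
      simpa using (ht0.mul_const (w x)).const_add (u x)
    refine tendsto_const_nhds.congr' ?_
    filter_upwards [l1.eventually (lt_mem_nhds hx')] with n hn
    simp [hs, hK, Real.sign_of_pos hn]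

/-- Nonnegative minimizers solve the first equation. -/
theorem IsMinimizer.left_equation_of_nonneg (h : Exponents p q α β) (hN : 1 ≤ N)
    (hΩ : IsSmoothBoundedDomain Ω) (hm : IsMinimizer Ω p q α β u v G H) (hu0 : ∀ x, 0 ≤ u x)
    (hw : HasW0 Ω p w W) :
    ∫ x in Ω, ‖G x‖ ^ (p - 2) * inner ℝ (G x) (W x) = lambdaInf Ω p q α β * α *
      ∫ x in Ω, |u x| ^ (α - 2) * u x * |v x| ^ β * w x := by
  refine le_antisymm ?_ (hm.left_inequality h hN hΩ hu0 hw)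
  have := hm.left_inequality h hN hΩ hu0 (hw.const_mul (-1))
  simp only [neg_mul, one_mul, mul_neg, neg_smul, one_smul, inner_neg_right, integral_neg] at this
  linarith

end LeftEquation

/-! ### The logarithmic gradient estimate -/

section SignConstant

variable {Ω : Set (E N)} {p : ℝ} {u : E N → ℝ} {G : E N → E N}

/-- For sX ≤ M the left side is at most a constant, because k ≥ p gives s^(k−1) ≤ s^(p−1); for sX ≥
M it is absorbed by s^k X^p. It controls the term in which the gradient falls on the cutoff. -/
theorem young_cutoff (hp : 1 < p) {k : ℕ} (hk : p ≤ k) {D : ℝ} (hD : 0 ≤ D) :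
    ∃ C, 0 ≤ C ∧ ∀ s X : ℝ, 0 ≤ s → s ≤ 1 → 0 ≤ X →
      X ^ (p - 1) * (k * s ^ (k - 1) * D) ≤ (p - 1) / 2 * (s ^ k * X ^ p) + C := by
  have hp1 : 0 < p - 1 := by linarith
  have hk1 : 1 ≤ k := by
    have : (1 : ℝ) ≤ k := by linarith
    exact_mod_cast this
  -- Chosen so that kD = (p−1)/2 · M, which leaves half of the coefficient p − 1 after absorption.
  set M : ℝ := 2 * (k * D) / (p - 1) with hM
  have hM0 : 0 ≤ M := by positivity
  refine ⟨M ^ (p - 1) * (k * D), by positivity, fun s X hs hs1 hX => ?_⟩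
  rcases le_total (s * X) M with h | h
  · have h1 : s ^ (k - 1) ≤ s ^ (p - 1) := by
      rcases hs.eq_or_lt with rfl | hs0
      · rw [Real.zero_rpow hp1.ne', zero_pow]
        have : (1 : ℝ) < k := by linarith
        have : 1 < k := by exact_mod_cast this
        omega
      · rw [← Real.rpow_natCast, Nat.cast_sub hk1, Nat.cast_one]
        exact Real.rpow_le_rpow_of_exponent_ge hs0 hs1 (by linarith)
    have h2 : X ^ (p - 1) * s ^ (k - 1) ≤ M ^ (p - 1) := by
      calc X ^ (p - 1) * s ^ (k - 1) ≤ X ^ (p - 1) * s ^ (p - 1) := by gcongr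
        _ = (s * X) ^ (p - 1) := by rw [mul_comm, Real.mul_rpow hs hX]
        _ ≤ M ^ (p - 1) := Real.rpow_le_rpow (by positivity) h hp1.le
    have h3 := mul_le_mul_of_nonneg_right h2 (by positivity : 0 ≤ (k : ℝ) * D)
    have h4 : 0 ≤ (p - 1) / 2 * (s ^ k * X ^ p) := by positivity
    linarith
  · have h1 : (k : ℝ) * D ≤ (p - 1) / 2 * (s * X) := by
      calc (k : ℝ) * D = (p - 1) / 2 * M := by rw [hM]; field_simp
        _ ≤ _ := by gcongr
    have h2 : s ^ k = s ^ (k - 1) * s := by rw [← pow_succ, Nat.sub_add_cancel hk1]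
    have h3 : X ^ p = X ^ (p - 1) * X := by
      rcases hX.eq_or_lt with rfl | hX0
      · rw [Real.zero_rpow (by linarith), mul_zero]
      · rw [← Real.rpow_add_one hX0.ne']; congr 1; ring
    have h4 := mul_le_mul_of_nonneg_left h1 (by positivity : 0 ≤ X ^ (p - 1) * s ^ (k - 1))
    have h5 : 0 ≤ M ^ (p - 1) * (k * D) := by positivity
    rw [h2, h3]
    linarith

variable [IsFiniteMeasure (volume.restrict Ω)]

/-- The chain rule requires a function vanishing at 0, so ε^(1−p) is subtracted from (s + ε)^(1−p)
and added back as a multiple of η. -/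
theorem hasW0_log_test (hp : 1 < p) (hΩ : IsOpen Ω) (hu : HasW0 Ω p u G) (hu0 : ∀ x, 0 ≤ u x)
    {η : E N → ℝ} (hη : IsTestFunction Ω η) {ε : ℝ} (hε : 0 < ε) :
    HasW0 Ω p (fun x => η x * (u x + ε) ^ (1 - p)) (fun x =>
      (η x * ((1 - p) * (u x + ε) ^ (-p))) • G x + (u x + ε) ^ (1 - p) • gradient η x) := by
  set g : ℝ → ℝ := fun s => (s + ε) ^ (1 - p) - ε ^ (1 - p) with hg
  have hd : ∀ s : ℝ, 0 ≤ s → HasDerivAt g ((1 - p) * (s + ε) ^ (-p)) s := fun s hs => by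
    have h1 := ((hasDerivAt_id s).add_const ε).rpow_const (p := 1 - p)
      (Or.inl (by simp only [id]; linarith))
    have h2 := h1.sub_const (ε ^ (1 - p))
    simp only [id, one_mul, sub_sub_cancel_left] at h2
    exact h2
  have hgs : ContDiffOn ℝ ∞ g (Set.Ioi (-ε)) := by
    refine ContDiffOn.sub (ContDiffOn.rpow_const_of_ne (by fun_prop) fun s hs => ?_)
      contDiffOn_const
    have : -ε < s := hs
    linarith
  have h1 := hu.comp_abs hp (h := g) (L := (p - 1) * ε ^ (-p)) hε hgs (by simp [hg])
    (fun t ht => by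
      have ht' : 0 ≤ t := ht
      have hpos : 0 < t + ε := by linarith
      rw [(hd t ht').deriv, abs_mul, abs_of_neg (by linarith : 1 - p < 0),
        abs_of_nonneg (by positivity)]
      have : (t + ε) ^ (-p) ≤ ε ^ (-p) :=
        Real.rpow_le_rpow_of_nonpos hε (by linarith) (by linarith)
      nlinarith)
  have h2 := (h1.testFunction_mul hp hη).add hp (hη.hasW0.const_mul (ε ^ (1 - p)))
  refine h2.congr (Eventually.of_forall fun x => ?_) ?_
  · simp only [hg, abs_of_nonneg (hu0 x)]; ring
  · filter_upwards [hu.grad_eq_zero hp hΩ] with x hx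
    have e : (deriv g |u x| * Real.sign (u x)) • G x = ((1 - p) * (u x + ε) ^ (-p)) • G x := by
      rcases (hu0 x).eq_or_lt with hx' | hx'
      · rw [hx hx'.symm, smul_zero, smul_zero]
      · rw [abs_of_pos hx', (hd _ hx'.le).deriv, Real.sign_of_pos hx', mul_one]
    rw [e]
    simp only [hg, abs_of_nonneg (hu0 x)]
    module

/-- The logarithmic estimate for nonnegative supersolutions. -/
theorem integral_log_gradient_le (hp : 1 < p) (hΩ : IsOpen Ω) (hu : HasW0 Ω p u G)
    (hu0 : ∀ x, 0 ≤ u x)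
    (hsup : ∀ w W, HasW0 Ω p w W → (∀ x, 0 ≤ w x) →
      0 ≤ ∫ x in Ω, ‖G x‖ ^ (p - 2) * inner ℝ (G x) (W x))
    {ψ : E N → ℝ} (hψ : IsTestFunction Ω ψ) (hψ0 : ∀ x, 0 ≤ ψ x) (hψ1 : ∀ x, ψ x ≤ 1) {k : ℕ}
    (hk : p ≤ k) :
    ∃ C, ∀ ε : ℝ, 0 < ε → Integrable (fun x => ψ x ^ k * (‖G x‖ / (u x + ε)) ^ p)
      (volume.restrict Ω) ∧ ∫ x in Ω, ψ x ^ k * (‖G x‖ / (u x + ε)) ^ p ≤ C := by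
  have hp1 : 0 < p - 1 := by linarith
  have hk0 : k ≠ 0 := by
    rintro rfl
    simp only [Nat.cast_zero] at hk
    linarith
  obtain ⟨D, hD⟩ := hψ.exists_bound_gradient
  have hD0 : 0 ≤ D := (norm_nonneg _).trans (hD 0)
  obtain ⟨C₀, hC₀, hY⟩ := young_cutoff hp hk hD0
  have hη : IsTestFunction Ω (fun x => ψ x ^ k) :=
    hψ.comp (F := fun t => t ^ k) (by fun_prop) (zero_pow hk0)
  have hgη : ∀ x, ‖gradient (fun x => ψ x ^ k) x‖ ≤ k * ψ x ^ (k - 1) * D := fun x => by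
    have h1 := gradient_comp_apply hψ.differentiable (F := fun t => t ^ k) (by fun_prop) x
    have h2 : deriv (fun t : ℝ => t ^ k) (ψ x) = k * ψ x ^ (k - 1) := by simp
    have h3 := hψ0 x
    rw [h1, norm_smul, h2, Real.norm_of_nonneg (by positivity)]
    exact mul_le_mul_of_nonneg_left (hD x) (by positivity)
  -- The constant does not depend on ε, which allows the passage ε → 0.
  refine ⟨2 / (p - 1) * (C₀ * (volume.restrict Ω).real Set.univ), fun ε hε => ?_⟩
  have hpos : ∀ x, 0 < u x + ε := fun x => by linarith [hu0 x]
  have hXi : Integrable (fun x => ψ x ^ k * (‖G x‖ / (u x + ε)) ^ p) (volume.restrict Ω) := by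
    have hG := hu.memLp_grad.integrable_rpow hp
    have hm : AEStronglyMeasurable (fun x => ψ x ^ k * (‖G x‖ / (u x + ε)) ^ p)
        (volume.restrict Ω) :=
      (hη.continuous.measurable.aemeasurable.mul
        ((hu.memLp_grad.1.norm.aemeasurable.div
          (hu.memLp.1.aemeasurable.add_const ε)).pow_const p)).aestronglyMeasurable
    refine (hG.const_mul (ε⁻¹ ^ p)).mono' hm (Eventually.of_forall fun x => ?_)
    have h0 := hψ0 x
    have := hpos x
    rw [Real.norm_of_nonneg (by positivity), ← Real.mul_rpow (by positivity) (norm_nonneg _)]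
    refine (mul_le_of_le_one_left (by positivity) (pow_le_one₀ h0 (hψ1 x))).trans ?_
    refine Real.rpow_le_rpow (by positivity) ?_ (by linarith)
    rw [div_eq_inv_mul]
    gcongr
    linarith [hu0 x]
  refine ⟨hXi, ?_⟩
  have hw := hasW0_log_test hp hΩ hu hu0 hη hε
  have h1 := hsup _ _ hw fun x => by
    have := hψ0 x
    have := hpos x
    positivity
  -- Differentiating (u + ε)^(1−p) gives −(p−1) ψ^k (|G|/(u+ε))^p; the cutoff term absorbs half of
  -- it, up to the constant C₀.
  have hT : ∀ x, ‖G x‖ ^ (p - 2) * inner ℝ (G x) ((ψ x ^ k * ((1 - p) * (u x + ε) ^ (-p))) • G x +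
      (u x + ε) ^ (1 - p) • gradient (fun x => ψ x ^ k) x) ≤
      -((p - 1) / 2) * (ψ x ^ k * (‖G x‖ / (u x + ε)) ^ p) + C₀ := fun x => by
    have hx := hpos x
    have e1 : (‖G x‖ / (u x + ε)) ^ p = (u x + ε) ^ (-p) * ‖G x‖ ^ p := by
      rw [Real.div_rpow (norm_nonneg _) hx.le, Real.rpow_neg hx.le]; field_simp
    have e2 : (‖G x‖ / (u x + ε)) ^ (p - 1) = (u x + ε) ^ (1 - p) * ‖G x‖ ^ (p - 1) := by
      rw [Real.div_rpow (norm_nonneg _) hx.le, ← neg_sub p 1, Real.rpow_neg hx.le]; field_simp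
    have h2 := hY (ψ x) (‖G x‖ / (u x + ε)) (hψ0 x) (hψ1 x) (by positivity)
    have h3 := (le_abs_self _).trans
      (abs_norm_rpow_mul_inner_le hp (G x) (gradient (fun x => ψ x ^ k) x))
    have h4 := h3.trans (mul_le_mul_of_nonneg_left (hgη x) (by positivity))
    have h5 := mul_le_mul_of_nonneg_left h4 (by positivity : 0 ≤ (u x + ε) ^ (1 - p))
    have h6 := norm_rpow_mul_inner_self hp (G x)
    rw [inner_add_right, inner_smul_right, inner_smul_right, mul_add]
    have e3 : ‖G x‖ ^ (p - 2) * (ψ x ^ k * ((1 - p) * (u x + ε) ^ (-p)) * inner ℝ (G x) (G x)) =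
        -(p - 1) * (ψ x ^ k * (‖G x‖ / (u x + ε)) ^ p) := by
      rw [e1, ← h6]; ring
    rw [e3]
    rw [e2] at h2
    linarith
  have h2 : ∫ x in Ω, ‖G x‖ ^ (p - 2) * inner ℝ (G x)
      ((ψ x ^ k * ((1 - p) * (u x + ε) ^ (-p))) • G x +
      (u x + ε) ^ (1 - p) • gradient (fun x => ψ x ^ k) x) ≤
      ∫ x in Ω, (-((p - 1) / 2) * (ψ x ^ k * (‖G x‖ / (u x + ε)) ^ p) + C₀) :=
    integral_mono (integrable_norm_rpow_mul_inner hp hu.memLp_grad hw.memLp_grad)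
      ((hXi.const_mul _).add (integrable_const _)) hT
  rw [integral_add (hXi.const_mul _) (integrable_const _), integral_const_mul, integral_const,
    smul_eq_mul] at h2
  have h3 := h1.trans h2
  rw [div_mul_eq_mul_div, le_div_iff₀ hp1]
  linarith

/-- Fatou as ε → 0 in the logarithmic estimate, with a bump equal to 1 on a smaller ball. Where u =
0 the quotient is 0 by the convention for division by zero. -/
theorem locallyIntegrableOn_log_gradient (hp : 1 < p) (hΩ : IsOpen Ω) (hu : HasW0 Ω p u G)
    (hu0 : ∀ x, 0 ≤ u x)
    (hsup : ∀ w W, HasW0 Ω p w W → (∀ x, 0 ≤ w x) →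
      0 ≤ ∫ x in Ω, ‖G x‖ ^ (p - 2) * inner ℝ (G x) (W x)) :
    LocallyIntegrableOn (fun x => ‖G x‖ / u x) Ω := by
  intro x₀ hx₀
  obtain ⟨r, hr, hball⟩ := Metric.nhds_basis_closedBall.mem_iff.1 (hΩ.mem_nhds hx₀)
  let b : ContDiffBump x₀ := ⟨r / 2, r, by positivity, by linarith⟩
  have hb : IsTestFunction Ω b := ⟨b.contDiff, b.hasCompactSupport, by
    rw [b.tsupport_eq]; exact hball⟩
  obtain ⟨k, hk⟩ := exists_nat_ge p
  obtain ⟨C, hC⟩ := integral_log_gradient_le hp hΩ hu hu0 hsup hb (fun _ => b.nonneg)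
    (fun _ => b.le_one) hk
  set t : ℕ → ℝ := fun n => 1 / ((n : ℝ) + 1) with htdef
  have ht : ∀ n, 0 < t n := fun n => by positivity
  have ht0 : Tendsto t atTop (𝓝 0) := tendsto_one_div_add_atTop_nhds_zero_nat
  have hm : AEStronglyMeasurable (fun x => ‖G x‖ / u x) (volume.restrict Ω) :=
    (hu.memLp_grad.1.norm.aemeasurable.div hu.memLp.1.aemeasurable).aestronglyMeasurable
  obtain ⟨h1, -⟩ := integrable_of_fatou (μ := volume.restrict Ω)
    (F := fun n x => b x ^ k * (‖G x‖ / (u x + t n)) ^ p)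
    (f := fun x => b x ^ k * (‖G x‖ / u x) ^ p) (d := fun _ => C) (d₀ := C)
    (fun n => (hC _ (ht n)).1) (fun n x => by
      have := b.nonneg (x := x)
      have := ht n
      have := hu0 x
      positivity)
    ((b.continuous.measurable.pow_const k).aemeasurable.mul
      (hm.aemeasurable.pow_const p)).aestronglyMeasurable
    (fun x => by
      have := b.nonneg (x := x)
      have := hu0 x
      positivity)
    (Eventually.of_forall fun x => by
      rcases (hu0 x).eq_or_lt with hx | hx
      · left; simp [← hx, Real.zero_rpow (by linarith : p ≠ 0)]
      · right
        have h2 : Tendsto (fun n => u x + t n) atTop (𝓝 (u x)) := by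
          simpa using ht0.const_add (u x)
        exact ((tendsto_const_nhds.div h2 hx.ne').rpow_const (Or.inr (by linarith))).const_mul _)
    (fun n => (hC _ (ht n)).2) tendsto_const_nhds
  have hs : Metric.ball x₀ (r / 2) ⊆ Ω := fun y hy =>
    hball (Metric.mem_closedBall.2 (by have := Metric.mem_ball.1 hy; linarith))
  refine ⟨Metric.ball x₀ (r / 2), mem_nhdsWithin_of_mem_nhds (Metric.ball_mem_nhds _ (by positivity)),
    ?_⟩
  have h2 := (h1.mono_measure (Measure.restrict_mono_set volume hs)).add
    (integrableOn_const (s := Metric.ball x₀ (r / 2)) (C := (1 : ℝ))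
      (Metric.isBounded_ball.measure_lt_top).ne)
  refine h2.mono' (hm.mono_set hs) ?_
  filter_upwards [ae_restrict_mem measurableSet_ball] with y hy
  have hby : b y = 1 := b.one_of_mem_closedBall (Metric.ball_subset_closedBall hy)
  have hX : 0 ≤ ‖G y‖ / u y := div_nonneg (norm_nonneg _) (hu0 y)
  rw [Real.norm_of_nonneg hX]
  simp only [Pi.add_apply, hby, one_pow, one_mul]
  rcases le_total (‖G y‖ / u y) 1 with h | h
  · have : 0 ≤ (‖G y‖ / u y) ^ p := by positivity
    linarith
  · have := Real.self_le_rpow_of_one_le h hp.le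
    linarith

end SignConstant

/-! ### Constant sign, the eigenvalue equations and minimality -/

section FirstEquation

variable {Ω : Set (E N)} {p q α β : ℝ} {u v w : E N → ℝ} {G H W : E N → E N}

theorem hasDerivAt_div_sqrt_sq_add {δ : ℝ} (hδ : 0 < δ) (t : ℝ) :
    HasDerivAt (fun t : ℝ => t / √(t ^ 2 + δ ^ 2)) (δ ^ 2 / √(t ^ 2 + δ ^ 2) ^ 3) t := by
  have hpos : 0 < √(t ^ 2 + δ ^ 2) := by positivity
  have h1 := (hasDerivAt_id t).div (hasDerivAt_sqrt_sq_add hδ t) hpos.ne'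
  have h2 : √(t ^ 2 + δ ^ 2) ^ 2 = t ^ 2 + δ ^ 2 := Real.sq_sqrt (by positivity)
  have e : (1 * √(t ^ 2 + δ ^ 2) - id t * (t / √(t ^ 2 + δ ^ 2))) / √(t ^ 2 + δ ^ 2) ^ 2 =
      δ ^ 2 / √(t ^ 2 + δ ^ 2) ^ 3 := by
    simp only [id]
    field_simp
    linarith
  rw [e] at h1
  exact h1

/-- Used with s = δ for a global Lipschitz bound, and with s = |t| for a majorant independent of δ.
-/
theorem div_sqrt_sq_add_pow_le {δ : ℝ} (hδ : 0 < δ) {t s : ℝ} (hs : 0 < s)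
    (h : s ≤ √(t ^ 2 + δ ^ 2)) : δ ^ 2 / √(t ^ 2 + δ ^ 2) ^ 3 ≤ 1 / s := by
  have hpos : 0 < √(t ^ 2 + δ ^ 2) := by positivity
  have h2 : √(t ^ 2 + δ ^ 2) ^ 2 = t ^ 2 + δ ^ 2 := Real.sq_sqrt (by positivity)
  rw [div_le_div_iff₀ (by positivity) hs, one_mul, pow_succ (√(t ^ 2 + δ ^ 2)) 2]
  exact mul_le_mul (by nlinarith [sq_nonneg t]) h hs.le (by positivity)

/-- If `∇ log |u|` is locally integrable then `u` has constant sign. -/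
theorem HasW0.sign_ae_const [IsFiniteMeasure (volume.restrict Ω)] (hp : 1 < p) (hΩ : IsOpen Ω)
    (hΩc : IsPreconnected Ω) (hu : HasW0 Ω p u G)
    (hloc : LocallyIntegrableOn (fun x => ‖G x‖ / |u x|) Ω) :
    ∃ c, ∀ᵐ x ∂(volume.restrict Ω), Real.sign (u x) = c := by
  refine IsWeakGradient.ae_const hΩ hΩc ?_
  have hsm : AEStronglyMeasurable (fun x => Real.sign (u x)) (volume.restrict Ω) :=
    (measurable_real_sign.comp_aemeasurable hu.memLp.1.aemeasurable).aestronglyMeasurable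
  have hsb : ∀ x, ‖Real.sign (u x)‖ ≤ 1 := fun x => by
    rcases lt_trichotomy (u x) 0 with hx | hx | hx
    · simp [Real.sign_of_neg hx]
    · simp [hx]
    · simp [Real.sign_of_pos hx]
  refine ⟨locallyIntegrableOn_of_memLp hp (memLp_of_bounded hsm hsb),
    (locallyIntegrable_zero).locallyIntegrableOn _, fun φ hφ => ?_⟩
  simp only [smul_zero, integral_zero, neg_zero]
  set t : ℕ → ℝ := fun n => 1 / ((n : ℝ) + 1) with htdef
  have ht : ∀ n, 0 < t n := fun n => by positivity
  have ht0 : Tendsto t atTop (𝓝 0) := tendsto_one_div_add_atTop_nhds_zero_nat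
  have hT : ∀ n, HasW0 Ω p (fun x => u x / √(u x ^ 2 + t n ^ 2))
      (fun x => (t n ^ 2 / √(u x ^ 2 + t n ^ 2) ^ 3) • G x) := fun n => by
    have := hu.comp_smooth hp (F := fun s => s / √(s ^ 2 + t n ^ 2)) (L := 1 / t n)
      (contDiff_id.div (contDiff_sqrt_sq_add (ht n)) fun s => by have := ht n; positivity)
      (by simp) fun s => by
        rw [(hasDerivAt_div_sqrt_sq_add (ht n) s).deriv, abs_of_nonneg (by positivity)]
        exact div_sqrt_sq_add_pow_le (ht n) (ht n)
          (Real.le_sqrt_of_sq_le (by nlinarith [sq_nonneg s]))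
    simpa only [(hasDerivAt_div_sqrt_sq_add (ht n) _).deriv] using this
  have l1 : Tendsto (fun n => ∫ x in Ω, (u x / √(u x ^ 2 + t n ^ 2)) • gradient φ x) atTop
      (𝓝 (∫ x in Ω, Real.sign (u x) • gradient φ x)) := by
    refine tendsto_integral_of_dominated_convergence (fun x => ‖gradient φ x‖)
      (fun n => (hT n).memLp.1.smul hφ.continuous_gradient.aestronglyMeasurable)
      (hφ.continuous_gradient.integrable_of_hasCompactSupport
        hφ.hasCompactSupport_gradient).norm.integrableOn
      (fun n => Eventually.of_forall fun x => ?_) (Eventually.of_forall fun x =>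
        (tendsto_div_sqrt_sq_add (u x) ht0).smul_const _)
    rw [norm_smul]
    exact mul_le_of_le_one_left (norm_nonneg _) (abs_div_sqrt_sq_add_le _ _)
  -- The gradients of u / √(u² + t_n²) tend to 0 pointwise and are dominated by |G| / |u|, so the
  -- limit sign u has zero weak gradient.
  have l2 : Tendsto (fun n => ∫ x in Ω, φ x • (t n ^ 2 / √(u x ^ 2 + t n ^ 2) ^ 3) • G x) atTop
      (𝓝 (∫ x in Ω, (0 : E N))) := by
    refine tendsto_integral_of_dominated_convergence (fun x => ‖φ x • (‖G x‖ / |u x|)‖)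
      (fun n => hφ.continuous.aestronglyMeasurable.smul (hT n).memLp_grad.1)
      (hφ.integrable_smul hloc).norm.integrableOn (fun n => ?_) ?_
    · filter_upwards [hu.grad_eq_zero hp hΩ] with x hx
      rw [norm_smul, norm_smul (φ x)]
      refine mul_le_mul_of_nonneg_left ?_ (norm_nonneg _)
      rcases eq_or_ne (u x) 0 with hx' | hx'
      · simp [hx hx']
      · rw [norm_smul, Real.norm_of_nonneg (by positivity : 0 ≤ ‖G x‖ / |u x|),
          Real.norm_of_nonneg (by positivity), div_eq_mul_one_div ‖G x‖, mul_comm]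
        refine mul_le_mul_of_nonneg_left (div_sqrt_sq_add_pow_le (ht n) (abs_pos.2 hx') ?_)
          (norm_nonneg _)
        rw [← Real.sqrt_sq_eq_abs]
        exact Real.sqrt_le_sqrt (by nlinarith [sq_nonneg (t n)])
    · filter_upwards [hu.grad_eq_zero hp hΩ] with x hx
      rcases eq_or_ne (u x) 0 with hx' | hx'
      · simp [hx hx']
      · have h1 := (ht0.pow 2).div ((tendsto_sqrt_sq_add (u x) ht0).pow 3)
          (pow_ne_zero 3 (abs_ne_zero.2 hx'))
        have h2 := (h1.smul_const (G x)).const_smul (φ x)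
        simpa using h2
  rw [integral_zero] at l2
  have l3 := l2.neg
  rw [neg_zero] at l3
  exact tendsto_nhds_unique (l1.congr fun n => (hT n).grad.2.2 φ hφ) l3

variable [IsFiniteMeasure (volume.restrict Ω)]

/-- |u| is a minimizer and hence a supersolution with nonnegative right-hand side, so the
logarithmic estimate applies to it. The constant sign 0 is excluded since u is not a.e. zero. -/
theorem IsMinimizer.sign_ae_const (h : Exponents p q α β) (hN : 1 ≤ N)
    (hΩ : IsSmoothBoundedDomain Ω) (hm : IsMinimizer Ω p q α β u v G H) :
    ∃ c : ℝ, (c = 1 ∨ c = -1) ∧ ∀ᵐ x ∂(volume.restrict Ω), Real.sign (u x) = c := by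
  have hmU := hm.congr_abs h hΩ.isOpen
  have hloc := locallyIntegrableOn_log_gradient h.one_lt_p hΩ.isOpen hmU.left
    (fun x => abs_nonneg _) fun w W hw hw0 => by
      refine le_trans ?_ (hmU.supersolution h hN hΩ (fun x => abs_nonneg _) hw hw0).2
      have := (hm.lambdaInf_pos h hN hΩ).le
      have := h.α_pos.le
      refine mul_nonneg (by positivity) (integral_nonneg fun x => ?_)
      have := hw0 x
      positivity
  have e : (fun x => ‖Real.sign (u x) • G x‖ / |u x|) = fun x => ‖G x‖ / |u x| := by
    ext x
    rcases lt_trichotomy (u x) 0 with hx | hx | hx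
    · simp [Real.sign_of_neg hx]
    · simp [hx]
    · simp [Real.sign_of_pos hx]
  rw [e] at hloc
  obtain ⟨c, hc⟩ := hm.left.sign_ae_const h.one_lt_p hΩ.isOpen hΩ.isConnected.isPreconnected hloc
  refine ⟨c, ?_, hc⟩
  have : ∃ x, u x ≠ 0 ∧ Real.sign (u x) = c := by
    by_contra! hne
    refine hm.not_ae_zero h ?_
    filter_upwards [hc] with x hx
    by_contra hx'
    exact hne x hx' hx
  obtain ⟨x, hx, rfl⟩ := this
  exact (Real.sign_apply_eq_of_ne_zero _ hx).symm

/-- The Euler-Lagrange equation for `u`. -/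
theorem IsMinimizer.left_equation (h : Exponents p q α β) (hN : 1 ≤ N)
    (hΩ : IsSmoothBoundedDomain Ω) (hm : IsMinimizer Ω p q α β u v G H) (hw : HasW0 Ω p w W) :
    IntegrableOn (fun x => |u x| ^ (α - 2) * u x * |v x| ^ β * w x) Ω ∧
    ∫ x in Ω, ‖G x‖ ^ (p - 2) * inner ℝ (G x) (W x) = lambdaInf Ω p q α β * α *
      ∫ x in Ω, |u x| ^ (α - 2) * u x * |v x| ^ β * w x := by
  have hmU := hm.congr_abs h hΩ.isOpen
  obtain ⟨c, hc, hsign⟩ := hm.sign_ae_const h hN hΩ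
  have i := hmU.integrableOn_source h hN hΩ (fun x => abs_nonneg _) hw
  have e := hmU.left_equation_of_nonneg h hN hΩ (fun x => abs_nonneg _) hw
  -- Since u = c|u| a.e. with c = ±1, the equation for u is c times the equation for |u|.
  have e1 : (fun x => c * (|(|u x|)| ^ (α - 2) * |u x| * |v x| ^ β * w x))
      =ᵐ[volume.restrict Ω] fun x => |u x| ^ (α - 2) * u x * |v x| ^ β * w x := by
    filter_upwards [hsign] with x hx
    have : u x = c * |u x| := by
      rw [← hx]
      rcases lt_trichotomy (u x) 0 with hx | hx | hx
      · simp [Real.sign_of_neg hx, abs_of_neg hx]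
      · simp [hx]
      · simp [Real.sign_of_pos hx, abs_of_pos hx]
    rw [abs_abs]
    nth_rewrite 4 [this]
    ring
  have e2 : (fun x => c * (‖Real.sign (u x) • G x‖ ^ (p - 2) *
      inner ℝ (Real.sign (u x) • G x) (W x))) =ᵐ[volume.restrict Ω]
      fun x => ‖G x‖ ^ (p - 2) * inner ℝ (G x) (W x) := by
    filter_upwards [hsign] with x hx
    rw [hx]
    rcases hc with rfl | rfl <;> simp
  refine ⟨(i.const_mul c).congr e1, ?_⟩
  rw [← integral_congr_ae e1, ← integral_congr_ae e2, integral_const_mul, integral_const_mul, e]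
  ring

theorem IsMinimizer.isEigenfunction (h : Exponents p q α β) (hN : 1 ≤ N)
    (hΩ : IsSmoothBoundedDomain Ω)
    (hm : IsMinimizer Ω p q α β u v (weakGradient Ω u) (weakGradient Ω v)) :
    IsEigenfunction Ω p q α β (lambdaInf Ω p q α β) u v := by
  refine ⟨hm.left.memW1Zero hΩ.isOpen, hm.right.memW1, fun h0 => hm.not_ae_zero h ?_,
    fun w hw => hm.left_equation h hN hΩ (hw.hasW0 hΩ.isOpen), fun z hz => ⟨?_, ?_⟩⟩
  · filter_upwards [h0] with x hx using hx.1
  · exact h.integrable_constraint_mul hm.left.memLp hm.right.memLp hz.1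
  · exact hm.right_equation h hΩ.isOpen (hz.hasW1 hΩ.isOpen)

/-- Nontrivial eigenvalues are values of the Rayleigh quotient. -/
theorem IsNontrivialEigenvalue.mem_rayleighValues (h : Exponents p q α β) (hN : 1 ≤ N)
    (hΩ : IsSmoothBoundedDomain Ω) {lam : ℝ} (hl : IsNontrivialEigenvalue Ω p q α β lam) :
    lam ∈ rayleighValues Ω p q α β := by
  obtain ⟨u, v, hnt, hu, hv, -, hleft, hright⟩ := hl
  have hu' := hu.hasW0 hΩ.isOpen
  have hv' := hv.hasW1 hΩ.isOpen
  have hI := (coupling_pos_iff h hu' hv').2 hnt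
  have hp0 := h.p_pos
  have hq0 := h.q_pos
  have h1 := (hleft u hu).2
  have h2 := (hright v hv).2
  -- The constant 1 has zero gradient, so once λ ≠ 0 is known this equation is the constraint.
  have h3 := (hright (fun _ => 1) (hasW1_const 1).memW1).2
  simp only [norm_rpow_mul_inner_self h.one_lt_p, mul_right_comm _ (|v _| ^ β),
    abs_rpow_sub_two_mul_mul h.α_pos] at h1
  simp only [norm_rpow_mul_inner_self h.one_lt_q, mul_assoc (|u _| ^ α),
    abs_rpow_sub_two_mul_mul h.β_pos] at h2
  have e3 : ∫ x in Ω, ‖weakGradient Ω v x‖ ^ (q - 2) *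
      inner ℝ (weakGradient Ω v x) (weakGradient Ω (fun _ => (1 : ℝ)) x) = 0 := by
    refine integral_eq_zero_of_ae ?_
    filter_upwards [weakGradient_ae_eq hΩ.isOpen (isWeakGradient_const (Ω := Ω) 1)] with x hx
    simp [hx]
  rw [e3] at h3
  simp only [mul_one] at h3
  rw [integral_rpow_eq_mul_energy h.one_lt_p] at h1
  rw [integral_rpow_eq_mul_energy h.one_lt_q] at h2
  have e4 : ∫ x in Ω, |u x| ^ α * |v x| ^ β = coupling (volume.restrict Ω) α β u v := rfl
  rw [e4] at h1 h2
  have hlam : lam ≠ 0 := by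
    rintro rfl
    have h4 : energy (volume.restrict Ω) p (weakGradient Ω u) = 0 := by
      simpa [hp0.ne'] using h1
    refine hnt ?_
    filter_upwards [ae_zero_of_energy_eq_zero hN h.one_lt_p hΩ hu' h4] with x hx
    rw [hx, zero_mul]
  have hc : ∫ x in Ω, |u x| ^ α * (|v x| ^ (β - 2) * v x) = 0 :=
    (mul_eq_zero.1 h3.symm).resolve_left (mul_ne_zero hlam h.β_pos.ne')
  refine ⟨u, v, ⟨hu, hv, hnt, hc⟩, ?_⟩
  rw [rayleigh_eq hΩ.isOpen hu' hv', div_eq_iff hI.ne']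
  rw [mul_comm, ← eq_div_iff hp0.ne'] at h1
  rw [mul_comm, ← eq_div_iff hq0.ne'] at h2
  rw [h1, h2]
  -- The two tested equations give energies λ(α/p)I and λ(β/q)I, which add up to λI.
  linear_combination lam * coupling (volume.restrict Ω) α β u v * h.sum_eq

end FirstEquation

end DirichletNeumann

end

/-! ### The main theorem -/

theorem theorem1p1 {N : ℕ} (hN : 1 ≤ N)
    (Ω : Set (DirichletNeumann.E N)) (hΩ : DirichletNeumann.IsSmoothBoundedDomain Ω)
    (p q α β : ℝ) (hp : 1 < p) (hq : 1 < q) (hα : 0 < α) (hβ : 1 < β)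
    (hαβ : α / p + β / q = 1) (hpq : (N : ℝ) ≤ p ∨ (N : ℝ) < q) :
    -- `λ_{p,q}^{α,β}` is the smallest nontrivial eigenvalue
    IsLeast {lam : ℝ | DirichletNeumann.IsNontrivialEigenvalue Ω p q α β lam}
      (DirichletNeumann.lambdaInf Ω p q α β) ∧
    -- the infimum is attained
    IsLeast (DirichletNeumann.rayleighValues Ω p q α β)
      (DirichletNeumann.lambdaInf Ω p q α β) ∧
    -- every minimizer is an eigenfunction
    (∀ u v : DirichletNeumann.E N → ℝ, DirichletNeumann.Admissible Ω p q α β u v →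
      DirichletNeumann.rayleigh Ω p q α β u v = DirichletNeumann.lambdaInf Ω p q α β →
      DirichletNeumann.IsEigenfunction Ω p q α β (DirichletNeumann.lambdaInf Ω p q α β) u v) := by
  have h : DirichletNeumann.Exponents p q α β := ⟨hp, hq, hα, hβ, hαβ⟩
  have := hΩ.isFiniteMeasure
  have hmem := DirichletNeumann.lambdaInf_mem_rayleighValues hN hΩ h
  have hle : ∀ r ∈ DirichletNeumann.rayleighValues Ω p q α β,
      DirichletNeumann.lambdaInf Ω p q α β ≤ r := fun r hr =>
    csInf_le (DirichletNeumann.bddBelow_rayleighValues hp hq) hr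
  have heig : ∀ u v : DirichletNeumann.E N → ℝ, DirichletNeumann.Admissible Ω p q α β u v →
      DirichletNeumann.rayleigh Ω p q α β u v = DirichletNeumann.lambdaInf Ω p q α β →
      DirichletNeumann.IsEigenfunction Ω p q α β (DirichletNeumann.lambdaInf Ω p q α β) u v :=
    fun u v hadm hr =>
      (DirichletNeumann.isMinimizer_of_rayleigh_eq h hΩ.isOpen hadm hr).isEigenfunction h hN hΩ
  refine ⟨⟨?_, fun lam hlam => hle lam ?_⟩, ⟨hmem, hle⟩, heig⟩
  · obtain ⟨u, v, hadm, hr⟩ := hmem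
    exact ⟨u, v, hadm.2.2.1, heig u v hadm hr⟩
  · exact DirichletNeumann.IsNontrivialEigenvalue.mem_rayleighValues h hN hΩ hlam
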